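/- **Conventions.** A *tree* is a locally finite tree $T$ every vertex of which has at least two neighbours, with the path metric $d$ on its vertices (edges have length one). Its boundary $\partial T$ is the set of geodesic rays modulo eventual agreement up to a shift of the parameter. For an oriented edge $e$ from $x$ to $y$ let $A(e)$ be the set of vertices $v$ with $d(v,y)<d(v,x)$ and $U(e)\subset\partial T$ the set of points represented by a ray contained in $A(e)$; $\partial T$ carries the topology generated by the sets $U(e)$ (it is the topology of the metrics $\rho_{x_0}(\xi,\eta)=e^{-L}$, with $L$ the length of $[x_0,\xi]\cap[x_0,\eta]$), and $T\cup\partial T$ (vertices and boundary points) the topology generated by the sets $A(e)\cup U(e)$. A *tree-Schottky group* on $T$ is a finitely generated group $\Gamma$ of automorphisms of $T$ acting without inversion such that no non-identity element fixes a vertex; its *genus* is its rank, its *limit set* $\Lambda_\Gamma\subset\partial T$ is the set of accumulation points of $\Gamma$-orbits of vertices, and $\Gamma\backslash T$ is the quotient graph (loops and multiple edges allowed). For vertices $x_0,x$ the *critical exponent* is $$e(\Gamma)=\limsup_{R\to\infty}\tfrac1R\log\#\{y\in\Gamma x: d(y,x_0)\le R\},$$ and the *Patterson–Sullivan measure* of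 $\Gamma$ (for $x_0$ and the orbit $\Gamma x$) is the Borel probability measure on $\partial T$ which is the weak limit on $T\cup\partial T$, as $s\downarrow e(\Gamma)$, of $$\frac{\sum_{y\in\Gamma x}e^{-s\,d(y,x_0)}\,\delta_y}{\sum_{y\in\Gamma x}e^{-s\,d(y,x_0)}}.$$ A Borel measure $\mu$ on $\partial T$ is *$\Gamma$-conformal of dimension $\delta$* if $\mu(\gamma A)=\int_A j_\gamma^{\delta}\,d\mu$ for all $\gamma\in\Gamma$ and all Borel sets $A$, where $j_\gamma(\xi)=e^{d(x_0,p)-d(p,\gamma^{-1}x_0)}$ and $p$ is the projection of $\xi$ to $[x_0,\gamma^{-1}x_0]$. A map is *absolutely continuous* for two measures if it sends Borel null sets to null sets. **Theorem 1.7.** For $i=1,2$ let $\Gamma_i$ be a tree-Schottky group acting on a tree $T_i$, both of the same genus $g\ge 2$, with $\Lambda_{\Gamma_i}=\partial T_i$. For any choice of base vertices and orbits in $T_1$ and $T_2$, the Patterson–Sullivan measures $\mu_1,\mu_2$ of $\Gamma_1,\Gamma_2$ exist, $\mu_i$ is $\Gamma_i$-conformal of dimension $e(\Gamma_i)$, and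 the following are equivalent: 1. The quotient graphs $\Gamma_1\backslash T_1$ and $\Gamma_2\backslash T_2$ are isomorphic. 2. There are a group isomorphism $\alpha:\Gamma_1\to\Gamma_2$ and a bijective isometry $F:T_1\to T_2$ such that $F\circ\gamma=\alpha(\gamma)\circ F$ for all $\gamma\in\Gamma_1$. 3. There are a group isomorphism $\alpha:\Gamma_1\to\Gamma_2$ and a homeomorphism $\varphi:\Lambda_{\Gamma_1}\to\Lambda_{\Gamma_2}$ with $\varphi(\gamma\xi)=\alpha(\gamma)\varphi(\xi)$ for all $\gamma\in\Gamma_1$ and $\xi\in\Lambda_{\Gamma_1}$, such that $\varphi$ is absolutely continuous for $\mu_1$ and $\mu_2$; moreover, the dimensions are equal: $e(\Gamma_1)=e(\Gamma_2)$. 4. The same as 3, with both $\varphi$ and $\varphi^{-1}$ absolutely continuous. -/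

import Mathlib

open Filter Topology MeasureTheory
open scoped BoundedContinuousFunction

universe u v

namespace TreeRigidity

/-! ### Trees, graph automorphisms and quotient graphs -/

section Trees

variable {V : Type u}

/-- Locally finite trees without ends (leaves): every vertex has finitely many neighbours and at
least two of them, so that removing any vertex disconnects the tree. -/
structure IsLocallyFiniteLeaflessTree (G : SimpleGraph V) : Prop where
  isTree : G.IsTree
  finite_neighbors : ∀ x, (G.neighborSet x).Finite
  nontrivial_neighbors : ∀ x, (G.neighborSet x).Nontrivial

/-- An automorphism acts without inversion if it reverses no edge. -/
def ActsWithoutInversion {G : SimpleGraph V} (γ : G ≃g G) : Prop :=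
  ∀ x y, G.Adj x y → ¬ (γ x = y ∧ γ y = x)

/-- An automorphism is hyperbolic if it acts without inversion and fixes no vertex. -/
def IsHyperbolic {G : SimpleGraph V} (γ : G ≃g G) : Prop :=
  ActsWithoutInversion γ ∧ ∀ x, γ x ≠ x

/-- Tree-Schottky groups: finitely generated groups of automorphisms acting without inversion, all
of whose non-identity elements are hyperbolic. -/
structure IsTreeSchottky {G : SimpleGraph V} (Γ : Subgroup (G ≃g G)) : Prop where
  withoutInversion : ∀ γ ∈ Γ, ActsWithoutInversion γ
  fg : Group.FG Γ
  hyperbolic : ∀ γ ∈ Γ, γ ≠ 1 → IsHyperbolic γ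

/-- The genus of a tree-Schottky group (a finitely generated free group) is its rank. -/
noncomputable def IsTreeSchottky.genus {G : SimpleGraph V} {Γ : Subgroup (G ≃g G)}
    (h : IsTreeSchottky Γ) : ℕ :=
  haveI := h.fg
  Group.rank Γ

/-- The orbit of a vertex. -/
def vertexOrbit {G : SimpleGraph V} (Γ : Subgroup (G ≃g G)) (x : V) : Set V :=
  {y | ∃ γ ∈ Γ, γ x = y}

end Trees

/-- Graphs in the sense of Serre: loops and multiple edges are allowed, and every geometric edge
appears as two distinct oriented edges which are exchanged by `rev`. -/
structure SerreGraph where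
  Vert : Type u
  Edge : Type u
  src : Edge → Vert
  tgt : Edge → Vert
  rev : Edge → Edge
  rev_rev : ∀ e, rev (rev e) = e
  rev_ne : ∀ e, rev e ≠ e
  src_rev : ∀ e, src (rev e) = tgt e

/-- Isomorphisms of Serre graphs. -/
structure SerreGraph.Iso (A : SerreGraph.{u}) (B : SerreGraph.{v}) where
  vert : A.Vert ≃ B.Vert
  edge : A.Edge ≃ B.Edge
  src_edge : ∀ e, B.src (edge e) = vert (A.src e)
  tgt_edge : ∀ e, B.tgt (edge e) = vert (A.tgt e)
  rev_edge : ∀ e, B.rev (edge e) = edge (A.rev e)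

section Quotient

variable {V : Type u} {G : SimpleGraph V}

/-- Two vertices are equivalent if they lie in one `Γ`-orbit. -/
def vertSetoid (Γ : Subgroup (G ≃g G)) : Setoid V where
  r x y := ∃ γ ∈ Γ, γ x = y
  iseqv :=
    { refl := fun x => ⟨1, Γ.one_mem, rfl⟩
      symm := by
        rintro x _ ⟨γ, hγ, rfl⟩
        exact ⟨γ⁻¹, Γ.inv_mem hγ, γ.symm_apply_apply x⟩
      trans := by
        rintro x _ _ ⟨γ, hγ, rfl⟩ ⟨δ, hδ, rfl⟩
        exact ⟨δ * γ, Γ.mul_mem hδ hγ, rfl⟩ }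

/-- Two oriented edges are equivalent if they lie in one `Γ`-orbit. -/
def dartSetoid (Γ : Subgroup (G ≃g G)) : Setoid G.Dart where
  r d e := ∃ γ ∈ Γ, γ d.fst = e.fst ∧ γ d.snd = e.snd
  iseqv :=
    { refl := fun x => ⟨1, Γ.one_mem, rfl, rfl⟩
      symm := by
        rintro d e ⟨γ, hγ, h1, h2⟩
        refine ⟨γ⁻¹, Γ.inv_mem hγ, ?_, ?_⟩
        · rw [← h1]; exact γ.symm_apply_apply _
        · rw [← h2]; exact γ.symm_apply_apply _
      trans := by
        rintro d e f ⟨γ, hγ, h1, h2⟩ ⟨δ, hδ, h3, h4⟩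
        refine ⟨δ * γ, Γ.mul_mem hδ hγ, ?_, ?_⟩
        · rw [← h3, ← h1]; rfl
        · rw [← h4, ← h2]; rfl }

/-- The quotient graph `Γ \ T` of a tree by a group acting without inversion. -/
def quotientGraph (Γ : Subgroup (G ≃g G)) (h : ∀ γ ∈ Γ, ActsWithoutInversion γ) :
    SerreGraph.{u} where
  Vert := _root_.Quotient (vertSetoid Γ)
  Edge := _root_.Quotient (dartSetoid Γ)
  src := _root_.Quotient.map' (fun d => d.fst) (by
    rintro d e ⟨γ, hγ, h1, -⟩
    exact ⟨γ, hγ, h1⟩)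
  tgt := _root_.Quotient.map' (fun d => d.snd) (by
    rintro d e ⟨γ, hγ, -, h2⟩
    exact ⟨γ, hγ, h2⟩)
  rev := _root_.Quotient.map' (fun d => d.symm) (by
    rintro d e ⟨γ, hγ, h1, h2⟩
    exact ⟨γ, hγ, h2, h1⟩)
  rev_rev := by
    rintro ⟨d⟩
    exact congrArg (_root_.Quotient.mk (dartSetoid Γ)) d.symm_symm
  rev_ne := by
    rintro ⟨d⟩ hd
    obtain ⟨γ, hγ, h1, h2⟩ := _root_.Quotient.exact hd
    exact h γ hγ d.snd d.fst d.adj.symm ⟨h1, h2⟩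
  src_rev := by
    rintro ⟨d⟩
    rfl

end Quotient

/-! ### The boundary of a tree -/

section Boundary

variable {V : Type u}

/-- Geodesic rays, given by their sequence of vertices. -/
structure Ray (G : SimpleGraph V) where
  toFun : ℕ → V
  dist_eq : ∀ m n, m ≤ n → G.dist (toFun m) (toFun n) = n - m

/-- Two rays are equivalent if they agree eventually, up to a shift of the parameter. -/
def raySetoid (G : SimpleGraph V) : Setoid (Ray G) where
  r r s := ∃ a b, ∀ n, r.toFun (n + a) = s.toFun (n + b)
  iseqv :=
    { refl := fun r => ⟨0, 0, fun _ => rfl⟩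
      symm := by
        rintro r s ⟨a, b, h⟩
        exact ⟨b, a, fun n => (h n).symm⟩
      trans := by
        rintro r s t ⟨a, b, h⟩ ⟨c, d, h'⟩
        refine ⟨a + c, d + b, fun n => ?_⟩
        have h1 := h (n + c)
        have h2 := h' (n + b)
        rw [show n + (a + c) = n + c + a by omega, h1, show n + c + b = n + b + c by omega, h2,
          show n + b + d = n + (d + b) by omega] }

/-- The boundary `∂T`. -/
def Boundary (G : SimpleGraph V) : Type u := _root_.Quotient (raySetoid G)

/-- The ray `r` represents the boundary point `ξ`. -/
def Ray.Represents {G : SimpleGraph V} (r : Ray G) (ξ : Boundary G) : Prop :=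
  _root_.Quotient.mk (raySetoid G) r = ξ

theorem dist_map_le {G : SimpleGraph V} (γ : G ≃g G) {x y : V} (h : G.Reachable x y) :
    G.dist (γ x) (γ y) ≤ G.dist x y := by
  obtain ⟨p, hp⟩ := h.exists_walk_length_eq_dist
  rw [← hp, ← SimpleGraph.Walk.length_map γ.toHom p]
  exact SimpleGraph.dist_le _

theorem dist_map {G : SimpleGraph V} (γ : G ≃g G) (x y : V) :
    G.dist (γ x) (γ y) = G.dist x y := by
  by_cases h : G.Reachable x y
  · refine le_antisymm (dist_map_le γ h) ?_
    have h2 := dist_map_le γ.symm (h.map γ.toHom)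
    have h3 : ∀ z, γ.symm (γ.toHom z) = z := fun z => γ.symm_apply_apply z
    rw [h3, h3] at h2
    exact h2
  · have h' : ¬ G.Reachable (γ x) (γ y) := fun k => h (γ.reachable_iff.mp k)
    rw [SimpleGraph.dist_eq_zero_of_not_reachable h, SimpleGraph.dist_eq_zero_of_not_reachable h']

/-- The image of a ray under an automorphism. -/
def Ray.map {G : SimpleGraph V} (γ : G ≃g G) (r : Ray G) : Ray G where
  toFun n := γ (r.toFun n)
  dist_eq m n h := by rw [dist_map, r.dist_eq m n h]

/-- The action of an automorphism on the boundary. -/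
def boundaryMap {G : SimpleGraph V} (γ : G ≃g G) : Boundary G → Boundary G :=
  _root_.Quotient.map (Ray.map γ) (by
    rintro r s ⟨a, b, h⟩
    exact ⟨a, b, fun n => congrArg γ (h n)⟩)

/-- The vertices of the basic set `A(e)` of the oriented edge `e` from `x` to `y`: those on the
target side of `e`. -/
def basicSet (G : SimpleGraph V) (x y : V) : Set V :=
  {z | G.dist z y < G.dist z x}

/-- The set `U(e)` of the boundary points with a representative ray contained in `A(e)`. -/
def basicBoundarySet (G : SimpleGraph V) (x y : V) : Set (Boundary G) :=
  {ξ | ∃ r : Ray G, r.Represents ξ ∧ ∀ n, r.toFun n ∈ basicSet G x y}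

/-- The topology of `∂T`, with the sets `U(e)` as a subbasis. For every base vertex it is the
topology of the metric `exp (-L)`, with `L` the length of the common part of the two rays from the
base vertex: the closed and open balls of that metric are the sets `U(e)`, for `e` pointing away
from the base vertex, and the whole space, and the remaining sets `U(e)` are the complements of
such balls. -/
instance (G : SimpleGraph V) : TopologicalSpace (Boundary G) :=
  TopologicalSpace.generateFrom {S | ∃ x y, G.Adj x y ∧ S = basicBoundarySet G x y}

instance (G : SimpleGraph V) : MeasurableSpace (Boundary G) := borel _

instance (G : SimpleGraph V) : BorelSpace (Boundary G) := ⟨rfl⟩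

/-- The compactification `T ∪ ∂T` (of the vertex set). -/
inductive Compactification (G : SimpleGraph V) : Type u
  | vertex (x : V)
  | boundary (ξ : Boundary G)

/-- The part of `T ∪ ∂T` on the target side of the edge from `x` to `y`, that is `A(e) ∪ U(e)`. -/
def halfSpace (G : SimpleGraph V) (x y : V) : Set (Compactification G) :=
  Compactification.vertex '' basicSet G x y ∪
    Compactification.boundary '' basicBoundarySet G x y

/-- The topology of `T ∪ ∂T`, with the half-spaces `A(e) ∪ U(e)` as a subbasis. In a locally finite
tree the vertices are isolated points. -/
instance (G : SimpleGraph V) : TopologicalSpace (Compactification G) :=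
  TopologicalSpace.generateFrom {S | ∃ x y, G.Adj x y ∧ S = halfSpace G x y}

/-- The limit set `Λ_Γ`: the boundary points at which an orbit of vertices accumulates. -/
def limitSet {G : SimpleGraph V} (Γ : Subgroup (G ≃g G)) : Set (Boundary G) :=
  {ξ | ∃ x, Compactification.boundary ξ ∈
    closure (Compactification.vertex '' vertexOrbit Γ x : Set (Compactification G))}

end Boundary

/-! ### Conformal measures and Patterson–Sullivan measures -/

section Measures

variable {V : Type u}

/-- `p` is the projection of the boundary point `ξ` to the geodesic segment `[a, b]`: it lies on the
segment, and a ray from `p` to `ξ` meets the segment in `p` only. -/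
def IsProjection (G : SimpleGraph V) (a b : V) (ξ : Boundary G) (p : V) : Prop :=
  G.dist a p + G.dist p b = G.dist a b ∧
    ∃ r : Ray G, r.Represents ξ ∧ r.toFun 0 = p ∧
      ∀ n, G.dist a (r.toFun n) + G.dist (r.toFun n) b = G.dist a b → n = 0

/-- The projection of `ξ` to `[a, b]`. -/
noncomputable def projection (G : SimpleGraph V) (a b : V) (ξ : Boundary G) : V :=
  @Classical.epsilon V ⟨a⟩ (IsProjection G a b ξ)

/-- The local dilatation `j_γ(ξ) = exp (d(x₀, p) - d(p, γ⁻¹ x₀))`, where `p` is the projection of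
`ξ` to `[x₀, γ⁻¹ x₀]`. -/
noncomputable def dilatation {G : SimpleGraph V} (x₀ : V) (γ : G ≃g G) (ξ : Boundary G) : ℝ :=
  Real.exp ((G.dist x₀ (projection G x₀ (γ.symm x₀) ξ) : ℝ)
    - (G.dist (projection G x₀ (γ.symm x₀) ξ) (γ.symm x₀) : ℝ))

/-- A Borel measure `μ` on `∂T` is `Γ`-conformal of dimension `d` if `γ^* μ = j_γ ^ d μ` for all `γ`
in `Γ`, where `γ^* μ (A) = μ (γ A)`. -/
def IsConformal {G : SimpleGraph V} (Γ : Subgroup (G ≃g G)) (x₀ : V) (d : ℝ)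
    (μ : Measure (Boundary G)) : Prop :=
  ∀ γ ∈ Γ, ∀ A : Set (Boundary G), MeasurableSet A →
    μ (boundaryMap γ '' A) = ∫⁻ ξ in A, ENNReal.ofReal (dilatation x₀ γ ξ ^ d) ∂μ

/-- The number of points of the orbit of `x` at distance at most `R` from `x₀`. -/
noncomputable def orbitCount {G : SimpleGraph V} (Γ : Subgroup (G ≃g G)) (x₀ x : V) (R : ℕ) : ℕ :=
  {y | y ∈ vertexOrbit Γ x ∧ G.dist y x₀ ≤ R}.ncard

/-- The critical exponent `e(Γ)`, the exponential growth rate of the orbit of `x` as seen from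
`x₀`. -/
noncomputable def criticalExponent {G : SimpleGraph V} (Γ : Subgroup (G ≃g G)) (x₀ x : V) : ℝ :=
  limsup (fun R : ℕ => 1 / (R : ℝ) * Real.log (orbitCount Γ x₀ x R)) atTop

/-- `μ` is the Patterson–Sullivan measure of `Γ` with base vertex `x₀`, for the orbit of `x`: the
weak limit on `T ∪ ∂T`, as `s` decreases to `e(Γ)`, of the normalized orbital sums
`∑ exp (-s d(y, x₀)) dirac y / ∑ exp (-s d(y, x₀))`, with `y` in the orbit of `x`. -/
def IsPattersonSullivan {G : SimpleGraph V} (Γ : Subgroup (G ≃g G)) (x₀ x : V)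
    (μ : Measure (Boundary G)) : Prop :=
  IsProbabilityMeasure μ ∧
    ∀ f : Compactification G →ᵇ ℝ,
      Tendsto (fun s : ℝ =>
          (∑' y : vertexOrbit Γ x,
            Real.exp (-s * (G.dist (y : V) x₀ : ℝ)) * f (Compactification.vertex y)) /
          (∑' y : vertexOrbit Γ x, Real.exp (-s * (G.dist (y : V) x₀ : ℝ))))
        (𝓝[>] (criticalExponent Γ x₀ x))
        (𝓝 (∫ ξ, f (Compactification.boundary ξ) ∂μ))

/-- A map is absolutely continuous for the measures `μ` and `ν` if it maps Borel sets of
`μ`-measure zero to sets of `ν`-measure zero. -/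
def IsAbsolutelyContinuousMap {X : Type u} {Y : Type v} [MeasurableSpace X] [MeasurableSpace Y]
    (φ : X → Y) (μ : Measure X) (ν : Measure Y) : Prop :=
  ∀ A : Set X, MeasurableSet A → μ A = 0 → ν (φ '' A) = 0

end Measures

end TreeRigidity

/-!
Let `Γ` be a tree-Schottky group of genus at least two with full limit set. It acts freely with
finitely many orbits of oriented edges (`exists_finite_representatives`), and every oriented edge is
reached from every other one by a path without backtracking, up to the group (`reaches`).
The transfer operator, which sums a function over the continuations of an oriented edge, therefore
behaves like an irreducible nonnegative matrix on the invariant functions: it has a positive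
invariant eigenfunction `h`, with eigenvalue `exp δ`, unique up to scaling
(`exists_isEigenfunction`, `eq_mul_of_superharmonic`). The number `δ` is the critical exponent
(`criticalExponent_eq`), and the mass `exp (-δ d(x₀, o(e))) h(e)` of `U(e)`, for `e` with origin
`o(e)` pointing away from `x₀`, defines a conformal measure (`exists_isVisual`, `isConformal`). As `s`
decreases to `δ`, the parts of the Poincaré series over half-trees become proportional to `h`, by
compactness and the minimum principle (`tendsto_poincare`); hence the orbital sums converge weakly
to this measure, which is the Patterson–Sullivan measure (`isPattersonSullivan`).

An isomorphism of the quotient graphs lifts to the trees because the actions are free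
(`exists_conjugacy_of_iso`), and a conjugacy of the actions carries eigenfunctions to eigenfunctions,
so that the measures correspond up to a density which is bounded away from zero (`null_image_iff`).

The main point is that absolute continuity of an equivariant homeomorphism `φ` implies rigidity.
An absolutely continuous measure is nearly a multiple of the reference measure on suitable small
sets `U(d)` (`exists_endShadow_approx`). Conformality allows one to move these sets to a fixed size
without changing ratios of measures, so that `φ` multiplies the measure by a constant on some open
set (`exists_eq_mul`), and hence, by equivariance, by a locally constant factor everywhere. Since the
dimensions agree, the logarithm of this factor is a coboundary between the Busemann cocycles of the
two trees; corrected by it, the difference of the Gromov products of `φ ξ, φ η` and of `ξ, η` becomes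
invariant and locally constant, hence constant by topological transitivity (`eq_of_invariant`).
Taking the centers of a triple of boundary points and of its image as base vertices, `φ` preserves the
Gromov products exactly, and it is induced by an isomorphism of the trees
(`exists_iso_of_gromovProduct_sub`).
-/

namespace TreeRigidity

/-! ### Distances and half-trees -/

section Distances

variable {V : Type u} {G : SimpleGraph V}

theorem exists_adj_mem_basicSet (hG : G.IsTree) {x z : V} (h : z ≠ x) :
    ∃ y, G.Adj x y ∧ z ∈ basicSet G x y := by
  obtain ⟨p, hp⟩ := hG.connected.exists_walk_length_eq_dist x z
  cases p with
  | nil => exact absurd rfl h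
  | @cons _ y _ hxy p =>
    refine ⟨y, hxy, ?_⟩
    have := SimpleGraph.dist_le p
    simp only [SimpleGraph.Walk.length_cons] at hp
    change G.dist z y < G.dist z x
    rw [G.dist_comm (u := z) (v := y), G.dist_comm (u := z) (v := x)]
    omega

theorem dist_eq_of_mem_basicSet (hG : G.IsTree) {x y z : V} (hxy : G.Adj x y)
    (h : z ∈ basicSet G x y) : G.dist z x = G.dist z y + 1 := by
  have h' : G.dist z y < G.dist z x := h
  rcases hG.dist_eq_dist_add_one_of_adj z hxy with h | h <;> omega

theorem eq_of_mem_basicSet (hG : G.IsTree) {x y y' z : V} (hy : G.Adj x y) (hy' : G.Adj x y')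
    (h : z ∈ basicSet G x y) (h' : z ∈ basicSet G x y') : y = y' := by
  have key : ∀ w, G.Adj x w → z ∈ basicSet G x w →
      ∃ p : G.Walk x z, p.IsPath ∧ p.snd = w := by
    intro w hw hz
    obtain ⟨p, hp⟩ := hG.connected.exists_walk_length_eq_dist w z
    refine ⟨SimpleGraph.Walk.cons hw p, ?_, by simp⟩
    apply SimpleGraph.Walk.isPath_of_length_eq_dist
    have := dist_eq_of_mem_basicSet hG hw hz
    rw [SimpleGraph.Walk.length_cons, hp, G.dist_comm (u := x), this, G.dist_comm (u := w)]
  obtain ⟨p, hp, rfl⟩ := key y hy h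
  obtain ⟨q, hq, rfl⟩ := key y' hy' h'
  rw [(hG.existsUnique_path x z).unique hp hq]

theorem notMem_basicSet_iff (hG : G.IsTree) {x y z : V} (hxy : G.Adj x y) :
    z ∉ basicSet G x y ↔ z ∈ basicSet G y x := by
  change ¬ (G.dist z y < G.dist z x) ↔ G.dist z x < G.dist z y
  rcases hG.dist_eq_dist_add_one_of_adj z hxy with h | h <;> omega

theorem snd_mem_basicSet {x y : V} (hxy : G.Adj x y) : y ∈ basicSet G x y := by
  change G.dist y y < G.dist y x
  rw [SimpleGraph.dist_self, SimpleGraph.dist_eq_one_iff_adj.2 hxy.symm]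
  exact one_pos

theorem fst_notMem_basicSet {x y : V} : x ∉ basicSet G x y := by
  change ¬ (G.dist x y < G.dist x x)
  simp

/-- The only edge that joins the two sides of an edge is this edge. -/
theorem eq_of_adj_of_mem_basicSet (hG : G.IsTree) {x y z w : V} (hxy : G.Adj x y)
    (hzw : G.Adj z w) (hz : z ∈ basicSet G x y) (hw : w ∉ basicSet G x y) : z = y ∧ w = x := by
  have key : ∀ {x y z w : V}, G.Adj x y → G.Adj z w → z ∈ basicSet G x y →
      w ∈ basicSet G y x → z = y := by
    intro x y z w hxy hzw hz hw
    by_contra hne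
    obtain ⟨u, hu, hyu⟩ := exists_adj_mem_basicSet hG (Ne.symm hne)
    have h1 := dist_eq_of_mem_basicSet hG hxy hz
    have h2 := dist_eq_of_mem_basicSet hG hxy.symm hw
    have h3 := dist_eq_of_mem_basicSet hG hu hyu
    have h4 : G.dist u x ≤ G.dist u y + G.dist y x := hG.connected.dist_triangle
    rw [SimpleGraph.dist_eq_one_iff_adj.2 hxy.symm] at h4
    have h5 := hG.dist_eq_dist_add_one_of_adj x hzw
    have h6 := hG.dist_eq_dist_add_one_of_adj y hzw
    simp only [G.dist_comm (u := x), G.dist_comm (u := y)] at h3 h4 h5 h6 ⊢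
    have hx1 : x ∈ basicSet G z u := by
      change G.dist x u < G.dist x z
      simp only [G.dist_comm (u := x)]
      omega
    have hx2 : x ∈ basicSet G z w := by
      change G.dist x w < G.dist x z
      simp only [G.dist_comm (u := x)]
      omega
    have := eq_of_mem_basicSet hG hu hzw hx1 hx2
    subst this
    omega
  rw [notMem_basicSet_iff hG hxy] at hw
  refine ⟨key hxy hzw hz hw, key hxy.symm hzw.symm hw hz⟩

/-- A geodesic between the two sides of an edge runs through this edge. -/
theorem dist_eq_of_separated (hG : G.IsTree) {x y z w : V} (hxy : G.Adj x y)
    (hz : z ∈ basicSet G x y) (hw : w ∉ basicSet G x y) :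
    G.dist w z = G.dist w x + 1 + G.dist y z := by
  have hle : ∀ w, G.dist w z ≤ G.dist w x + 1 + G.dist y z := by
    intro w
    have h1 : G.dist w z ≤ G.dist w x + G.dist x z := hG.connected.dist_triangle
    have h2 : G.dist x z ≤ G.dist x y + G.dist y z := hG.connected.dist_triangle
    rw [SimpleGraph.dist_eq_one_iff_adj.2 hxy] at h2
    omega
  generalize hn : G.dist w z = n
  induction n generalizing w with
  | zero =>
    have := hG.connected.dist_eq_zero_iff.1 hn
    exact absurd hz (this ▸ hw)
  | succ n ih =>
    have hzw : z ≠ w := by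
      rintro rfl
      exact hw hz
    obtain ⟨w', hww', hz'⟩ := exists_adj_mem_basicSet hG hzw
    have h1 := dist_eq_of_mem_basicSet hG hww' hz'
    have h0 := hle w
    rw [G.dist_comm (u := z), hn, G.dist_comm (u := z)] at h1
    by_cases hw' : w' ∈ basicSet G x y
    · obtain ⟨rfl, rfl⟩ := eq_of_adj_of_mem_basicSet hG hxy hww'.symm hw' hw
      simp only [SimpleGraph.dist_self]
      omega
    · have h2 := ih hw' (by omega)
      have h3 : G.dist w x ≤ G.dist w w' + G.dist w' x := hG.connected.dist_triangle
      have h4 : G.dist w' x ≤ G.dist w' w + G.dist w x := hG.connected.dist_triangle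
      rw [SimpleGraph.dist_eq_one_iff_adj.2 hww'] at h3
      rw [SimpleGraph.dist_eq_one_iff_adj.2 hww'.symm] at h4
      omega

/-- Half-trees are nested as soon as the second edge starts in the first half-tree and points away
from the origin of the first edge. -/
theorem basicSet_subset (hG : G.IsTree) {x y x' y' : V} (h : G.Adj x y) (h' : G.Adj x' y')
    (h1 : x' ∈ basicSet G x y) (h2 : x ∉ basicSet G x' y') :
    basicSet G x' y' ⊆ basicSet G x y := by
  intro z hz
  have h3 := dist_eq_of_separated hG h' hz h2
  have h4 := dist_eq_of_mem_basicSet hG h h1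
  have h5 : G.dist y z ≤ G.dist y x' + G.dist x' z := hG.connected.dist_triangle
  have h6 : G.dist x' z ≤ G.dist x' y' + G.dist y' z := hG.connected.dist_triangle
  rw [SimpleGraph.dist_eq_one_iff_adj.2 h'] at h6
  rw [G.dist_comm (u := x'), G.dist_comm (u := x')] at h4
  change G.dist z y < G.dist z x
  rw [G.dist_comm (u := z), G.dist_comm (u := z)]
  omega

theorem basicSet_subset_of_adj (hG : G.IsTree) {x y z : V} (h : G.Adj x y) (h' : G.Adj y z)
    (hzx : z ≠ x) : basicSet G y z ⊆ basicSet G x y := by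
  refine basicSet_subset hG h h' (snd_mem_basicSet h) fun hx => hzx ?_
  exact eq_of_mem_basicSet hG h' h.symm hx (snd_mem_basicSet h.symm)

theorem basicSet_symm_subset_symm (hG : G.IsTree) {x y x' y' : V} (h : G.Adj x y)
    (h' : G.Adj x' y') (hs : basicSet G x' y' ⊆ basicSet G x y) :
    basicSet G y x ⊆ basicSet G y' x' := by
  intro z hz
  rw [← notMem_basicSet_iff hG h] at hz
  rw [← notMem_basicSet_iff hG h']
  exact fun hz' => hz (hs hz')

theorem basicSet_disjoint_of_ne (hG : G.IsTree) {x y y' : V} (h : G.Adj x y) (h' : G.Adj x y')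
    (hne : y ≠ y') : Disjoint (basicSet G x y) (basicSet G x y') :=
  Set.disjoint_left.2 fun _ hz hz' => hne (eq_of_mem_basicSet hG h h' hz hz')

/-- A sequence of adjacent vertices without backtracking is geodesic. -/
theorem dist_eq_of_nonbacktracking (hG : G.IsTree) {f : ℕ → V} (h : ∀ n, G.Adj (f n) (f (n + 1)))
    (h' : ∀ n, f (n + 2) ≠ f n) (m n : ℕ) : G.dist (f m) (f (m + n)) = n := by
  have key : ∀ n, f m ∈ basicSet G (f (m + n + 1)) (f (m + n)) := by
    intro n
    induction n with
    | zero => exact snd_mem_basicSet (h m).symm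
    | succ n ih =>
      change f m ∈ basicSet G (f (m + n + 2)) (f (m + n + 1))
      rw [← notMem_basicSet_iff hG (h (m + n + 1))]
      intro hm
      exact h' (m + n) (eq_of_mem_basicSet hG (h (m + n + 1)) (h (m + n)).symm hm ih)
  induction n with
  | zero => simp
  | succ n ih =>
    have := dist_eq_of_mem_basicSet hG (h (m + n)).symm (key n)
    rw [← add_assoc, this, ih]

theorem exists_dist_eq_one_of_le (hG : G.IsTree) {x z : V} {n : ℕ} (h : G.dist x z = n + 1) :
    ∃ y, G.Adj x y ∧ G.dist y z = n := by
  have hne : z ≠ x := by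
    rintro rfl
    simp at h
  obtain ⟨y, hxy, hy⟩ := exists_adj_mem_basicSet hG hne
  have := dist_eq_of_mem_basicSet hG hxy hy
  rw [G.dist_comm (u := z), G.dist_comm (u := z)] at this
  exact ⟨y, hxy, by omega⟩

end Distances

/-! ### Darts and their shadows -/

section Darts

variable {V : Type u} {G : SimpleGraph V}

/-- The half-tree `A(e)` at which the oriented edge `e` points. -/
abbrev shadow (d : G.Dart) : Set V := basicSet G d.fst d.snd

/-- The set `U(e)` of the ends of the half-tree at which the oriented edge `e` points. -/
abbrev endShadow (d : G.Dart) : Set (Boundary G) := basicBoundarySet G d.fst d.snd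

/-- The oriented edge `e` continues the oriented edge `d` without backtracking. -/
def IsSucc (d e : G.Dart) : Prop := e.fst = d.snd ∧ e.snd ≠ d.fst

theorem Dart.ext' {d e : G.Dart} (h1 : d.fst = e.fst) (h2 : d.snd = e.snd) : d = e := by
  apply SimpleGraph.Dart.ext
  exact Prod.ext h1 h2

theorem fst_notMem_shadow (d : G.Dart) : d.fst ∉ shadow d := fst_notMem_basicSet

theorem snd_mem_shadow (d : G.Dart) : d.snd ∈ shadow d := snd_mem_basicSet d.adj

theorem notMem_shadow_iff (hG : G.IsTree) {d : G.Dart} {z : V} :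
    z ∉ shadow d ↔ z ∈ shadow d.symm :=
  notMem_basicSet_iff hG d.adj

theorem IsSucc.shadow_subset (hG : G.IsTree) {d e : G.Dart} (h : IsSucc d e) :
    shadow e ⊆ shadow d := by
  have h1 : G.Adj d.snd e.snd := h.1 ▸ e.adj
  have h2 := basicSet_subset_of_adj hG d.adj h1 h.2
  rwa [show basicSet G d.snd e.snd = shadow e by rw [← h.1]] at h2

theorem IsSucc.symm {d e : G.Dart} (h : IsSucc d e) : IsSucc e.symm d.symm :=
  ⟨h.1.symm, fun h' => h.2 h'.symm⟩

theorem shadow_symm_subset_symm (hG : G.IsTree) {d e : G.Dart} (h : shadow e ⊆ shadow d) :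
    shadow d.symm ⊆ shadow e.symm :=
  basicSet_symm_subset_symm hG d.adj e.adj h

theorem shadow_disjoint_of_ne (hG : G.IsTree) {d e : G.Dart} (h : d.fst = e.fst) (hne : d ≠ e) :
    Disjoint (shadow d) (shadow e) := by
  have h1 : d.snd ≠ e.snd := fun h2 => hne (Dart.ext' h h2)
  have := basicSet_disjoint_of_ne hG d.adj (h ▸ e.adj) h1
  rwa [show basicSet G d.fst e.snd = shadow e by rw [h]] at this

theorem exists_isSucc_of_mem_shadow (hG : G.IsTree) {d : G.Dart} {z : V} (hz : z ∈ shadow d)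
    (hne : z ≠ d.snd) : ∃ e, IsSucc d e ∧ z ∈ shadow e := by
  obtain ⟨y, hy, hzy⟩ := exists_adj_mem_basicSet hG hne
  refine ⟨⟨(d.snd, y), hy⟩, ⟨rfl, ?_⟩, hzy⟩
  rintro rfl
  exact (notMem_basicSet_iff hG d.adj).2 hzy hz

theorem snd_notMem_of_isSucc {d e : G.Dart} (h : IsSucc d e) : d.snd ∉ shadow e :=
  h.1 ▸ fst_notMem_shadow e

theorem exists_dart_of_ne (hG : G.IsTree) {x z : V} (h : z ≠ x) :
    ∃ d : G.Dart, d.fst = x ∧ z ∈ shadow d := by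
  obtain ⟨y, hy, hz⟩ := exists_adj_mem_basicSet hG h
  exact ⟨⟨(x, y), hy⟩, rfl, hz⟩

/-- The oriented edge that leads to `z ≠ x` on the geodesic from `x`. -/
theorem exists_dart_to (hG : G.IsTree) {x z : V} (h : z ≠ x) :
    ∃ d : G.Dart, d.snd = z ∧ x ∉ shadow d := by
  obtain ⟨d, hd, hx⟩ := exists_dart_of_ne hG (Ne.symm h)
  exact ⟨d.symm, hd, fun h => (notMem_shadow_iff hG).2 h hx⟩

theorem dist_snd_of_notMem (hG : G.IsTree) {x : V} {d : G.Dart} (h : x ∉ shadow d) :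
    G.dist x d.snd = G.dist x d.fst + 1 :=
  dist_eq_of_mem_basicSet hG d.adj.symm ((notMem_basicSet_iff hG d.adj).1 h)

theorem dist_of_mem_of_notMem (hG : G.IsTree) {x z : V} {d : G.Dart} (hz : z ∈ shadow d)
    (h : x ∉ shadow d) : G.dist x z = G.dist x d.fst + G.dist d.fst z := by
  have h1 := dist_eq_of_separated hG d.adj hz h
  have h2 := dist_eq_of_separated hG d.adj hz (fst_notMem_shadow d)
  simp only [SimpleGraph.dist_self] at h2
  omega

theorem dart_eq_of_snd_eq (hG : G.IsTree) {x : V} {d e : G.Dart} (hd : x ∉ shadow d)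
    (he : x ∉ shadow e) (h : d.snd = e.snd) : d = e := by
  rw [notMem_shadow_iff hG] at hd he
  have : d.symm = e.symm := by
    by_contra hne
    exact Set.disjoint_left.1 (shadow_disjoint_of_ne hG h hne) hd he
  rw [← d.symm_symm, this, e.symm_symm]

/-- Induction along a geodesic: a property of `d` that passes to successors holds for all oriented
edges in the shadow of `d`. -/
theorem shadow_induction (hG : G.IsTree) {d : G.Dart} {P : G.Dart → Prop} (h0 : P d)
    (hs : ∀ e f, P e → IsSucc e f → shadow f ⊆ shadow d → P f) {e : G.Dart}
    (he : shadow e ⊆ shadow d) : P e := by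
  have hd : d.fst ∉ shadow e := fun h => fst_notMem_shadow d (he h)
  generalize hn : G.dist d.fst e.fst = n
  induction n generalizing e with
  | zero =>
    have h1 := hG.connected.dist_eq_zero_iff.1 hn
    by_cases h2 : d = e
    · rwa [← h2]
    · have h3 := shadow_disjoint_of_ne hG h1 h2
      exact absurd (snd_mem_shadow e)
        (Set.disjoint_left.1 h3 (he (snd_mem_shadow e)))
  | succ n ih =>
    have hne : e.fst ≠ d.fst := by
      intro h
      rw [h] at hn
      simp at hn
    obtain ⟨f, hf, hdf⟩ := exists_dart_to hG hne
    have hfe : IsSucc f e := by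
      refine ⟨hf.symm, fun h => ?_⟩
      have : e = f.symm := Dart.ext' hf.symm h
      rw [this] at hd
      exact hd ((notMem_shadow_iff hG).1 hdf)
    have hmem : e.fst ∈ shadow d := by
      by_contra hcon
      have h1 := eq_of_adj_of_mem_basicSet hG d.adj e.adj.symm (he (snd_mem_shadow e)) hcon
      exact hne h1.2
    have hsub : shadow f ⊆ shadow d := by
      by_cases h1 : f.fst ∈ shadow d
      · exact basicSet_subset hG d.adj f.adj h1 hdf
      · have h2 := eq_of_adj_of_mem_basicSet hG d.adj f.adj.symm (hf ▸ hmem) h1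
        rw [show f = d from Dart.ext' h2.2 h2.1]
    refine hs f e (ih hsub hdf ?_) hfe he
    have := dist_snd_of_notMem hG hdf
    rw [hf] at this
    omega

end Darts

/-! ### Rays and boundary points -/

section Rays

variable {V : Type u} {G : SimpleGraph V}

theorem Ray.ext' {r s : Ray G} (h : ∀ n, r.toFun n = s.toFun n) : r = s := by
  cases r; cases s; congr; exact funext h

theorem Ray.adj (r : Ray G) (n : ℕ) : G.Adj (r.toFun n) (r.toFun (n + 1)) := by
  rw [← SimpleGraph.dist_eq_one_iff_adj, r.dist_eq n (n + 1) n.le_succ, Nat.add_sub_cancel_left]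

/-- The `n`-th oriented edge of a ray. -/
def Ray.dart (r : Ray G) (n : ℕ) : G.Dart := ⟨(r.toFun n, r.toFun (n + 1)), r.adj n⟩

/-- The ray obtained by deleting the first `k` vertices. -/
def Ray.drop (r : Ray G) (k : ℕ) : Ray G where
  toFun n := r.toFun (n + k)
  dist_eq m n h := by rw [r.dist_eq _ _ (by omega)]; omega

theorem Ray.ne_add_two (r : Ray G) (n : ℕ) : r.toFun (n + 2) ≠ r.toFun n := by
  intro h
  have := r.dist_eq n (n + 2) (by omega)
  rw [h, SimpleGraph.dist_self] at this
  omega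

theorem Ray.isSucc_dart (r : Ray G) (n : ℕ) : IsSucc (r.dart n) (r.dart (n + 1)) :=
  ⟨rfl, r.ne_add_two n⟩

theorem Ray.shadow_dart_subset (hG : G.IsTree) (r : Ray G) {m n : ℕ} (h : m ≤ n) :
    shadow (r.dart n) ⊆ shadow (r.dart m) := by
  induction n, h using Nat.le_induction with
  | base => exact subset_rfl
  | succ n _ ih => exact ((r.isSucc_dart n).shadow_subset hG).trans ih

/-- A sequence of adjacent vertices without backtracking, as a ray. -/
def Ray.ofNonbacktracking (hG : G.IsTree) (f : ℕ → V) (h : ∀ n, G.Adj (f n) (f (n + 1)))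
    (h' : ∀ n, f (n + 2) ≠ f n) : Ray G where
  toFun := f
  dist_eq m n hmn := by
    obtain ⟨k, rfl⟩ := Nat.exists_eq_add_of_le hmn
    rw [dist_eq_of_nonbacktracking hG h h', Nat.add_sub_cancel_left]

/-- The ray obtained by adding an initial vertex. -/
def Ray.cons (hG : G.IsTree) (x : V) (r : Ray G) (h : G.Adj x (r.toFun 0))
    (h' : r.toFun 1 ≠ x) : Ray G :=
  Ray.ofNonbacktracking hG (fun n => Nat.casesOn n x r.toFun)
    (fun n => by cases n with
      | zero => exact h
      | succ n => exact r.adj n)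
    (fun n => by cases n with
      | zero => exact h'
      | succ n => exact r.ne_add_two n)

theorem Ray.Represents.drop {r : Ray G} {ξ : Boundary G} (h : r.Represents ξ) (k : ℕ) :
    (r.drop k).Represents ξ := by
  refine (_root_.Quotient.sound ?_ : _root_.Quotient.mk (raySetoid G) _ = _).trans h
  exact ⟨0, k, fun n => rfl⟩

theorem Ray.Represents.cons (hG : G.IsTree) {r : Ray G} {ξ : Boundary G} (h : r.Represents ξ)
    (x : V) (h1 : G.Adj x (r.toFun 0)) (h2 : r.toFun 1 ≠ x) :
    (Ray.cons hG x r h1 h2).Represents ξ := by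
  refine (_root_.Quotient.sound ?_ : _root_.Quotient.mk (raySetoid G) _ = _).trans h
  exact ⟨1, 0, fun n => rfl⟩

theorem Ray.Represents.exists_shift {r s : Ray G} {ξ : Boundary G} (hr : r.Represents ξ)
    (hs : s.Represents ξ) : ∃ a b, ∀ n, r.toFun (n + a) = s.toFun (n + b) :=
  _root_.Quotient.exact (hr.trans hs.symm)

theorem exists_ray_from (hG : G.IsTree) (x : V) (ξ : Boundary G) :
    ∃ r : Ray G, r.Represents ξ ∧ r.toFun 0 = x := by
  obtain ⟨r₀, hr₀⟩ := _root_.Quotient.exists_rep ξ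
  generalize hn : G.dist x (r₀.toFun 0) = n
  induction n generalizing x with
  | zero => exact ⟨r₀, hr₀, (hG.connected.dist_eq_zero_iff.1 hn).symm⟩
  | succ n ih =>
    obtain ⟨y, hxy, hy⟩ := exists_dist_eq_one_of_le hG hn
    obtain ⟨r, hr, rfl⟩ := ih y hy
    by_cases h : r.toFun 1 = x
    · exact ⟨r.drop 1, hr.drop 1, h⟩
    · exact ⟨Ray.cons hG x r hxy h, hr.cons hG x hxy h, rfl⟩

theorem Ray.Represents.eq (hG : G.IsTree) {r s : Ray G} {ξ : Boundary G} (hr : r.Represents ξ)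
    (hs : s.Represents ξ) (h0 : r.toFun 0 = s.toFun 0) : r = s := by
  obtain ⟨a, b, hab⟩ := hr.exists_shift hs
  have h1 := r.dist_eq 0 a (Nat.zero_le _)
  have h2 := s.dist_eq 0 b (Nat.zero_le _)
  have h3 := hab 0
  simp only [Nat.zero_add] at h3
  obtain rfl : a = b := by
    rw [h0, h3, h2] at h1
    omega
  have hdown : ∀ k, k ≤ a → r.toFun (a - k) = s.toFun (a - k) := by
    intro k
    induction k with
    | zero => simpa using h3
    | succ k ih =>
      intro hk
      have ih := ih (by omega)
      obtain ⟨m, hm⟩ : ∃ m, a - k = m + 1 := ⟨a - k - 1, by omega⟩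
      rw [show a - (k + 1) = m by omega]
      rw [hm] at ih
      refine eq_of_mem_basicSet hG (r.adj m).symm (ih ▸ (s.adj m).symm) (z := r.toFun 0) ?_ ?_
      · change G.dist _ _ < G.dist _ _
        rw [r.dist_eq _ _ (Nat.zero_le _), r.dist_eq _ _ (Nat.zero_le _)]
        omega
      · change G.dist _ _ < G.dist _ _
        rw [r.dist_eq _ _ (Nat.zero_le _), h0, s.dist_eq _ _ (Nat.zero_le _)]
        omega
  refine Ray.ext' fun n => ?_
  rcases le_total a n with h | h
  · obtain ⟨k, rfl⟩ := Nat.exists_eq_add_of_le' h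
    exact hab k
  · have := hdown (a - n) (by omega)
    rwa [show a - (a - n) = n by omega] at this

/-- The ray from the vertex `x` to the boundary point `ξ`. -/
noncomputable def rayTo (hG : G.IsTree) (x : V) (ξ : Boundary G) : Ray G :=
  (exists_ray_from hG x ξ).choose

theorem rayTo_represents (hG : G.IsTree) (x : V) (ξ : Boundary G) :
    (rayTo hG x ξ).Represents ξ :=
  (exists_ray_from hG x ξ).choose_spec.1

@[simp]
theorem rayTo_zero (hG : G.IsTree) (x : V) (ξ : Boundary G) : (rayTo hG x ξ).toFun 0 = x :=
  (exists_ray_from hG x ξ).choose_spec.2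

theorem Ray.Represents.rayTo_eq (hG : G.IsTree) {r : Ray G} {ξ : Boundary G}
    (hr : r.Represents ξ) {x : V} (hx : r.toFun 0 = x) : rayTo hG x ξ = r :=
  (rayTo_represents hG _ ξ).eq hG hr ((rayTo_zero hG x ξ).trans hx.symm)

theorem rayTo_toFun_add (hG : G.IsTree) (x : V) (ξ : Boundary G) (k n : ℕ) :
    (rayTo hG ((rayTo hG x ξ).toFun k) ξ).toFun n = (rayTo hG x ξ).toFun (n + k) := by
  rw [((rayTo_represents hG x ξ).drop k).rayTo_eq hG (x := (rayTo hG x ξ).toFun k)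
    (by simp [Ray.drop])]
  rfl

theorem Ray.mem_shadow (r : Ray G) {n m : ℕ} (h : n < m) : r.toFun m ∈ shadow (r.dart n) := by
  change G.dist (r.toFun m) (r.toFun (n + 1)) < G.dist (r.toFun m) (r.toFun n)
  rw [G.dist_comm (u := r.toFun m), G.dist_comm (u := r.toFun m), r.dist_eq _ _ h,
    r.dist_eq _ _ h.le]
  omega

theorem Ray.notMem_shadow (r : Ray G) {n m : ℕ} (h : m ≤ n) : r.toFun m ∉ shadow (r.dart n) := by
  change ¬ (G.dist (r.toFun m) (r.toFun (n + 1)) < G.dist (r.toFun m) (r.toFun n))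
  rw [r.dist_eq _ _ (by omega), r.dist_eq _ _ h]
  omega

theorem Ray.Represents.mem_endShadow {r : Ray G} {ξ : Boundary G} (hr : r.Represents ξ) (n : ℕ) :
    ξ ∈ endShadow (r.dart n) :=
  ⟨r.drop (n + 1), hr.drop _, fun _ => r.mem_shadow (by omega)⟩

theorem Ray.Represents.eventually_mem_shadow {r : Ray G} {ξ : Boundary G} (hr : r.Represents ξ)
    {d : G.Dart} (hξ : ξ ∈ endShadow d) : ∃ N, ∀ n, N ≤ n → r.toFun n ∈ shadow d := by
  obtain ⟨s, hs, hsd⟩ := hξ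
  obtain ⟨a, b, hab⟩ := hr.exists_shift hs
  refine ⟨a, fun n hn => ?_⟩
  obtain ⟨k, rfl⟩ := Nat.exists_eq_add_of_le' hn
  rw [hab]
  exact hsd _

theorem endShadow_mono {d e : G.Dart} (h : shadow e ⊆ shadow d) : endShadow e ⊆ endShadow d := by
  rintro ξ ⟨r, hr, hre⟩
  exact ⟨r, hr, fun n => h (hre n)⟩

theorem endShadow_disjoint {d e : G.Dart} (h : Disjoint (shadow d) (shadow e)) :
    Disjoint (endShadow d) (endShadow e) := by
  refine Set.disjoint_left.2 fun ξ hd he => ?_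
  obtain ⟨r, hr, hrd⟩ := hd
  obtain ⟨N, hN⟩ := hr.eventually_mem_shadow he
  exact Set.disjoint_left.1 h (hrd N) (hN N le_rfl)

theorem shadow_disjoint_symm (hG : G.IsTree) (d : G.Dart) :
    Disjoint (shadow d) (shadow d.symm) :=
  Set.disjoint_left.2 fun _ h h' => (notMem_shadow_iff hG).2 h' h

theorem exists_dart_mem_endShadow (hG : G.IsTree) (x : V) (ξ : Boundary G) :
    ∃ d : G.Dart, d.fst = x ∧ ξ ∈ endShadow d :=
  ⟨_, rayTo_zero hG x ξ, (rayTo_represents hG x ξ).mem_endShadow 0⟩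

theorem eq_of_mem_endShadow (hG : G.IsTree) {d e : G.Dart} (h : d.fst = e.fst) {ξ : Boundary G}
    (hd : ξ ∈ endShadow d) (he : ξ ∈ endShadow e) : d = e := by
  by_contra hne
  exact Set.disjoint_left.1 (endShadow_disjoint (shadow_disjoint_of_ne hG h hne)) hd he

theorem mem_endShadow_iff (hG : G.IsTree) {d : G.Dart} {ξ : Boundary G} :
    ξ ∈ endShadow d ↔ (rayTo hG d.fst ξ).toFun 1 = d.snd := by
  have h := (rayTo_represents hG d.fst ξ).mem_endShadow 0
  constructor
  · intro hd
    have := eq_of_mem_endShadow hG (rayTo_zero hG d.fst ξ) h hd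
    exact congrArg (fun e : G.Dart => e.snd) this
  · intro h1
    have : (rayTo hG d.fst ξ).dart 0 = d := Dart.ext' (rayTo_zero hG d.fst ξ) h1
    rwa [this] at h

theorem notMem_endShadow_iff (hG : G.IsTree) {d : G.Dart} {ξ : Boundary G} :
    ξ ∉ endShadow d ↔ ξ ∈ endShadow d.symm := by
  constructor
  · intro h
    obtain ⟨e, he, hξ⟩ := exists_dart_mem_endShadow hG d.fst ξ
    have hne : e.snd ≠ d.snd := by
      intro h1
      rw [Dart.ext' he h1] at hξ
      exact h hξ
    exact endShadow_mono (IsSucc.shadow_subset hG (d := d.symm) ⟨he, hne⟩) hξ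
  · intro h h'
    exact Set.disjoint_left.1 (endShadow_disjoint (shadow_disjoint_symm hG d)) h' h

theorem exists_isSucc_of_mem_endShadow (hG : G.IsTree) {d : G.Dart} {ξ : Boundary G}
    (h : ξ ∈ endShadow d) : ∃ e, IsSucc d e ∧ ξ ∈ endShadow e := by
  obtain ⟨e, he, hξ⟩ := exists_dart_mem_endShadow hG d.snd ξ
  refine ⟨e, ⟨he, fun h1 => ?_⟩, hξ⟩
  rw [show e = d.symm from Dart.ext' he h1] at hξ
  exact (notMem_endShadow_iff hG).2 hξ h

theorem Ray.Represents.exists_shadow_subset (hG : G.IsTree) {r : Ray G} {ξ : Boundary G}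
    (hr : r.Represents ξ) {d : G.Dart} (hξ : ξ ∈ endShadow d) :
    ∃ N, ∀ n, N ≤ n → shadow (r.dart n) ⊆ shadow d := by
  obtain ⟨N, hN⟩ := hr.eventually_mem_shadow hξ
  refine ⟨max N (G.dist (r.toFun 0) d.fst + 1), fun n hn => ?_⟩
  refine basicSet_subset hG d.adj (r.dart n).adj (hN n (le_of_max_le_left hn)) fun h => ?_
  have h1 := dist_of_mem_of_notMem hG h (r.notMem_shadow (Nat.zero_le n))
  have h2 : G.dist (r.toFun 0) (r.dart n).fst = n := r.dist_eq 0 n (Nat.zero_le n)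
  have := le_of_max_le_right hn
  omega

/-- Bar induction: this is the compactness of the boundary in the form in which it is used. -/
theorem bar_induction (hG : G.IsTree) {P : G.Dart → Prop}
    (hs : ∀ d, (∀ e, IsSucc d e → P e) → P d) (hr : ∀ r : Ray G, ∃ n, P (r.dart n))
    (d : G.Dart) : P d := by
  by_contra hd
  have hnext : ∀ d : {d // ¬ P d}, ∃ e : {e // ¬ P e}, IsSucc d.1 e.1 := by
    rintro ⟨d, hd⟩
    by_contra hcon
    refine hd (hs d fun e he => ?_)
    by_contra hPe
    exact hcon ⟨⟨e, hPe⟩, he⟩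
  choose next hnext using hnext
  let s : ℕ → {d // ¬ P d} := fun n => Nat.rec ⟨d, hd⟩ (fun _ e => next e) n
  have hss : ∀ n, IsSucc (s n).1 (s (n + 1)).1 := fun n => hnext (s n)
  let r : Ray G := Ray.ofNonbacktracking hG (fun n => (s n).1.fst)
    (fun n => by rw [(hss n).1]; exact (s n).1.adj)
    (fun n => by rw [(hss (n + 1)).1]; exact (hss n).2)
  obtain ⟨n, hn⟩ := hr r
  have : r.dart n = (s n).1 := Dart.ext' rfl (hss n).1
  exact (s n).2 (this ▸ hn)

theorem IsLocallyFiniteLeaflessTree.exists_isSucc (hT : IsLocallyFiniteLeaflessTree G)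
    (d : G.Dart) : ∃ e, IsSucc d e := by
  obtain ⟨y, hy, hne⟩ := (hT.nontrivial_neighbors d.snd).exists_ne d.fst
  exact ⟨⟨(d.snd, y), hy⟩, rfl, hne⟩

theorem endShadow_nonempty (hT : IsLocallyFiniteLeaflessTree G) (d : G.Dart) :
    (endShadow d).Nonempty := by
  refine bar_induction hT.isTree (P := fun d => (endShadow d).Nonempty) (fun d hd => ?_)
    (fun r => ⟨0, _, Ray.Represents.mem_endShadow (ξ := _root_.Quotient.mk _ r) rfl 0⟩) d
  obtain ⟨e, he⟩ := hT.exists_isSucc d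
  exact (hd e he).mono (endShadow_mono (he.shadow_subset hT.isTree))

theorem finite_out (hT : IsLocallyFiniteLeaflessTree G) (x : V) :
    {d : G.Dart | d.fst = x}.Finite := by
  refine Set.Finite.of_finite_image (f := fun d : G.Dart => d.snd)
    ((hT.finite_neighbors x).subset ?_) ?_
  · rintro _ ⟨d, rfl, rfl⟩
    exact d.adj
  · rintro d rfl e he h
    exact Dart.ext' he.symm h

/-- The finite set of oriented edges with origin `x`. -/
noncomputable def outDarts (hT : IsLocallyFiniteLeaflessTree G) (x : V) : Finset G.Dart :=
  (finite_out hT x).toFinset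

@[simp]
theorem mem_outDarts {hT : IsLocallyFiniteLeaflessTree G} {x : V} {d : G.Dart} :
    d ∈ outDarts hT x ↔ d.fst = x := by
  simp [outDarts]

theorem finite_isSucc (hT : IsLocallyFiniteLeaflessTree G) (d : G.Dart) :
    {e : G.Dart | IsSucc d e}.Finite :=
  (finite_out hT d.snd).subset fun _ he => he.1

/-- The finite set of oriented edges that continue `d` without backtracking. -/
noncomputable def succs (hT : IsLocallyFiniteLeaflessTree G) (d : G.Dart) : Finset G.Dart :=
  (finite_isSucc hT d).toFinset

@[simp]
theorem mem_succs {hT : IsLocallyFiniteLeaflessTree G} {d e : G.Dart} :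
    e ∈ succs hT d ↔ IsSucc d e := by
  simp [succs]

theorem IsSucc.shadow_disjoint (hG : G.IsTree) {d e f : G.Dart} (he : IsSucc d e)
    (hf : IsSucc d f) (hne : e ≠ f) : Disjoint (shadow e) (shadow f) :=
  shadow_disjoint_of_ne hG (he.1.trans hf.1.symm) hne

theorem endShadow_eq_biUnion (hT : IsLocallyFiniteLeaflessTree G) (d : G.Dart) :
    endShadow d = ⋃ e ∈ succs hT d, endShadow e := by
  refine Set.Subset.antisymm (fun ξ hξ => ?_) ?_
  · obtain ⟨e, he, h⟩ := exists_isSucc_of_mem_endShadow hT.isTree hξ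
    exact Set.mem_biUnion (mem_succs.2 he) h
  · exact Set.iUnion₂_subset fun e he =>
      endShadow_mono ((mem_succs.1 he).shadow_subset hT.isTree)

theorem pairwiseDisjoint_succs (hT : IsLocallyFiniteLeaflessTree G) (d : G.Dart) :
    (succs hT d : Set G.Dart).PairwiseDisjoint (endShadow (G := G)) :=
  fun _ he _ hf hne => endShadow_disjoint
    ((mem_succs.1 he).shadow_disjoint hT.isTree (mem_succs.1 hf) hne)

theorem univ_eq_biUnion_outDarts (hT : IsLocallyFiniteLeaflessTree G) (x : V) :
    (Set.univ : Set (Boundary G)) = ⋃ e ∈ outDarts hT x, endShadow e := by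
  refine Set.Subset.antisymm (fun ξ _ => ?_) (Set.subset_univ _)
  obtain ⟨e, he, h⟩ := exists_dart_mem_endShadow hT.isTree x ξ
  exact Set.mem_biUnion (mem_outDarts.2 he) h

theorem pairwiseDisjoint_outDarts (hT : IsLocallyFiniteLeaflessTree G) (x : V) :
    (outDarts hT x : Set G.Dart).PairwiseDisjoint (endShadow (G := G)) :=
  fun _ he _ hf hne => endShadow_disjoint (shadow_disjoint_of_ne hT.isTree
    ((mem_outDarts.1 he).trans (mem_outDarts.1 hf).symm) hne)

end Rays

/-! ### Isomorphisms of trees -/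

section Iso

universe w

variable {V : Type u} {W : Type v} {X : Type w} {G : SimpleGraph V} {H : SimpleGraph W}
  {K : SimpleGraph X}

theorem iso_dist (F : G ≃g H) (x y : V) : H.dist (F x) (F y) = G.dist x y := by
  have key : ∀ {V : Type u} {W : Type v} {G : SimpleGraph V} {H : SimpleGraph W} (F : G ≃g H)
      (x y : V), G.Reachable x y → H.dist (F x) (F y) ≤ G.dist x y := by
    intro V W G H F x y h
    obtain ⟨p, hp⟩ := h.exists_walk_length_eq_dist
    rw [← hp, ← SimpleGraph.Walk.length_map F.toHom p]
    exact SimpleGraph.dist_le _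
  have key' : ∀ {V : Type u} {W : Type v} {G : SimpleGraph V} {H : SimpleGraph W} (F : G ≃g H)
      (x y : W), H.Reachable x y → G.dist (F.symm x) (F.symm y) ≤ H.dist x y := by
    intro V W G H F x y h
    obtain ⟨p, hp⟩ := h.exists_walk_length_eq_dist
    rw [← hp, ← SimpleGraph.Walk.length_map F.symm.toHom p]
    exact SimpleGraph.dist_le _
  by_cases h : G.Reachable x y
  · refine le_antisymm (key F x y h) ?_
    simpa using key' F (F x) (F y) (F.reachable_iff.2 h)
  · rw [SimpleGraph.dist_eq_zero_of_not_reachable h, SimpleGraph.dist_eq_zero_of_not_reachable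
      fun k => h (F.reachable_iff.1 k)]

/-- The image of an oriented edge under an isomorphism. -/
def mapDart (F : G ≃g H) (d : G.Dart) : H.Dart := ⟨(F d.fst, F d.snd), F.map_adj_iff.2 d.adj⟩

@[simp] theorem mapDart_fst (F : G ≃g H) (d : G.Dart) : (mapDart F d).fst = F d.fst := rfl

@[simp] theorem mapDart_snd (F : G ≃g H) (d : G.Dart) : (mapDart F d).snd = F d.snd := rfl

@[simp] theorem mapDart_symm_dart (F : G ≃g H) (d : G.Dart) :
    mapDart F d.symm = (mapDart F d).symm := rfl

@[simp] theorem mapDart_symm_mapDart (F : G ≃g H) (d : G.Dart) :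
    mapDart F.symm (mapDart F d) = d :=
  Dart.ext' (F.symm_apply_apply _) (F.symm_apply_apply _)

@[simp] theorem mapDart_mapDart_symm (F : G ≃g H) (d : H.Dart) :
    mapDart F (mapDart F.symm d) = d :=
  Dart.ext' (F.apply_symm_apply _) (F.apply_symm_apply _)

theorem mapDart_mul (γ δ : G ≃g G) (d : G.Dart) : mapDart (γ * δ) d = mapDart γ (mapDart δ d) :=
  rfl

@[simp] theorem mapDart_one (d : G.Dart) : mapDart (1 : G ≃g G) d = d := rfl

theorem mapDart_injective (F : G ≃g H) : Function.Injective (mapDart F) :=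
  Function.LeftInverse.injective (mapDart_symm_mapDart F)

theorem IsSucc.map (F : G ≃g H) {d e : G.Dart} (h : IsSucc d e) :
    IsSucc (mapDart F d) (mapDart F e) :=
  ⟨congrArg F h.1, fun h' => h.2 (F.injective h')⟩

@[simp] theorem mem_shadow_mapDart (F : G ≃g H) {d : G.Dart} {z : V} :
    F z ∈ shadow (mapDart F d) ↔ z ∈ shadow d := by
  change H.dist (F z) (F d.snd) < H.dist (F z) (F d.fst) ↔ _
  rw [iso_dist, iso_dist]
  rfl

theorem mem_shadow_mapDart' (F : G ≃g H) {d : G.Dart} {z : W} :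
    z ∈ shadow (mapDart F d) ↔ F.symm z ∈ shadow d := by
  rw [← mem_shadow_mapDart F, F.apply_symm_apply]

theorem shadow_mapDart_subset_iff (F : G ≃g H) {d e : G.Dart} :
    shadow (mapDart F e) ⊆ shadow (mapDart F d) ↔ shadow e ⊆ shadow d := by
  constructor
  · intro h z hz
    exact (mem_shadow_mapDart F).1 (h ((mem_shadow_mapDart F).2 hz))
  · intro h z hz
    rw [mem_shadow_mapDart'] at hz ⊢
    exact h hz

/-- The image of a ray under an isomorphism. -/
def Ray.mapIso (F : G ≃g H) (r : Ray G) : Ray H where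
  toFun n := F (r.toFun n)
  dist_eq m n h := by rw [iso_dist, r.dist_eq m n h]

/-- The map that an isomorphism of trees induces on the boundaries. -/
def boundaryMapIso (F : G ≃g H) : Boundary G → Boundary H :=
  _root_.Quotient.map (Ray.mapIso F) (by
    rintro r s ⟨a, b, h⟩
    exact ⟨a, b, fun n => congrArg F (h n)⟩)

theorem boundaryMapIso_eq_boundaryMap (γ : G ≃g G) : boundaryMapIso γ = boundaryMap γ := rfl

theorem Ray.Represents.mapIso (F : G ≃g H) {r : Ray G} {ξ : Boundary G} (h : r.Represents ξ) :
    (r.mapIso F).Represents (boundaryMapIso F ξ) := by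
  subst h
  rfl

@[simp] theorem boundaryMapIso_symm_apply (F : G ≃g H) (ξ : Boundary G) :
    boundaryMapIso F.symm (boundaryMapIso F ξ) = ξ := by
  obtain ⟨r, rfl⟩ := _root_.Quotient.exists_rep ξ
  refine congrArg (_root_.Quotient.mk _) (Ray.ext' fun n => ?_)
  exact F.symm_apply_apply _

theorem boundaryMapIso_trans (F : G ≃g H) (F' : H ≃g K) (ξ : Boundary G) :
    boundaryMapIso (F.trans F') ξ = boundaryMapIso F' (boundaryMapIso F ξ) := by
  obtain ⟨r, rfl⟩ := _root_.Quotient.exists_rep ξ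
  rfl

@[simp] theorem boundaryMapIso_apply_symm (F : G ≃g H) (ξ : Boundary H) :
    boundaryMapIso F (boundaryMapIso F.symm ξ) = ξ := by
  obtain ⟨r, rfl⟩ := _root_.Quotient.exists_rep ξ
  refine congrArg (_root_.Quotient.mk _) (Ray.ext' fun n => ?_)
  exact F.apply_symm_apply _

theorem rayTo_mapIso (hG : G.IsTree) (hH : H.IsTree) (F : G ≃g H) (x : V) (ξ : Boundary G)
    (n : ℕ) : (rayTo hH (F x) (boundaryMapIso F ξ)).toFun n = F ((rayTo hG x ξ).toFun n) := by
  rw [((rayTo_represents hG x ξ).mapIso F).rayTo_eq hH (x := F x)]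
  · rfl
  · exact congrArg F (rayTo_zero hG x ξ)

theorem mem_endShadow_mapDart (F : G ≃g H) {d : G.Dart} {ξ : Boundary G} :
    boundaryMapIso F ξ ∈ endShadow (mapDart F d) ↔ ξ ∈ endShadow d := by
  have key : ∀ {V : Type u} {W : Type v} {G : SimpleGraph V} {H : SimpleGraph W} (F : G ≃g H)
      {d : G.Dart} {ξ : Boundary G}, ξ ∈ endShadow d →
      boundaryMapIso F ξ ∈ endShadow (mapDart F d) := by
    rintro V W G H F d ξ ⟨r, hr, hrd⟩
    exact ⟨r.mapIso F, hr.mapIso F, fun n => (mem_shadow_mapDart F).2 (hrd n)⟩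
  refine ⟨?_, key F⟩
  rintro ⟨r, hr, hrd⟩
  refine ⟨r.mapIso F.symm, ?_, fun n => ?_⟩
  · simpa using hr.mapIso F.symm
  · have := hrd n
    rw [mem_shadow_mapDart'] at this
    exact this

theorem boundaryMapIso_image_endShadow (F : G ≃g H) (d : G.Dart) :
    boundaryMapIso F '' endShadow d = endShadow (mapDart F d) := by
  refine Set.Subset.antisymm ?_ fun ξ hξ => ?_
  · rintro _ ⟨ξ, hξ, rfl⟩
    exact (mem_endShadow_mapDart F).2 hξ
  · refine ⟨boundaryMapIso F.symm ξ, ?_, boundaryMapIso_apply_symm F ξ⟩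
    rw [← mem_endShadow_mapDart F, boundaryMapIso_apply_symm]
    exact hξ

end Iso

/-! ### Topology of the boundary -/

section Topology

variable {V : Type u} {W : Type v} {G : SimpleGraph V} {H : SimpleGraph W}

theorem finite_closedBall (hT : IsLocallyFiniteLeaflessTree G) (x : V) (n : ℕ) :
    {y | G.dist y x ≤ n}.Finite := by
  induction n with
  | zero =>
    refine (Set.finite_singleton x).subset fun y hy => ?_
    exact hT.isTree.connected.dist_eq_zero_iff.1 (Nat.le_zero.1 hy)
  | succ n ih =>
    refine ((ih.biUnion fun z _ => hT.finite_neighbors z).union ih).subset fun y hy => ?_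
    by_cases h : G.dist y x ≤ n
    · exact Or.inr h
    · obtain ⟨z, hyz, hz⟩ := exists_dist_eq_one_of_le hT.isTree (x := y) (z := x) (n := n)
        (le_antisymm hy (by omega))
      exact Or.inl (Set.mem_biUnion (show z ∈ {y | G.dist y x ≤ n} from hz.le) hyz.symm)

theorem countable_vertices (hT : IsLocallyFiniteLeaflessTree G) : Countable V := by
  obtain ⟨x⟩ := hT.isTree.connected.nonempty
  have : (Set.univ : Set V) = ⋃ n : ℕ, {y | G.dist y x ≤ n} := by
    refine Set.Subset.antisymm (fun y _ => ?_) (Set.subset_univ _)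
    exact Set.mem_iUnion.2 ⟨G.dist y x, le_refl (G.dist y x)⟩
  rw [← Set.countable_univ_iff, this]
  exact Set.countable_iUnion fun n => (finite_closedBall hT x n).countable

theorem countable_darts (hT : IsLocallyFiniteLeaflessTree G) : Countable G.Dart := by
  have := countable_vertices hT
  exact Function.Injective.countable (f := fun d : G.Dart => (d.fst, d.snd))
    fun d e h => Dart.ext' (Prod.ext_iff.1 h).1 (Prod.ext_iff.1 h).2

theorem isOpen_endShadow (d : G.Dart) : IsOpen (endShadow d) :=
  TopologicalSpace.isOpen_generateFrom_of_mem ⟨d.fst, d.snd, d.adj, rfl⟩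

theorem compl_endShadow (hG : G.IsTree) (d : G.Dart) : (endShadow d)ᶜ = endShadow d.symm :=
  Set.ext fun _ => notMem_endShadow_iff hG

theorem isClopen_endShadow (hG : G.IsTree) (d : G.Dart) : IsClopen (endShadow d) :=
  ⟨⟨compl_endShadow hG d ▸ isOpen_endShadow d.symm⟩, isOpen_endShadow d⟩

theorem measurableSet_endShadow (d : G.Dart) : MeasurableSet (endShadow d) :=
  (isOpen_endShadow d).measurableSet

/-- The shadows of the oriented edges of a ray form a neighbourhood basis of its end. -/
theorem Ray.Represents.exists_endShadow_subset (hG : G.IsTree) {r : Ray G} {ξ : Boundary G}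
    (hr : r.Represents ξ) {O : Set (Boundary G)} (hO : IsOpen O) (hξ : ξ ∈ O) :
    ∃ N, ∀ n, N ≤ n → endShadow (r.dart n) ⊆ O := by
  induction (show TopologicalSpace.GenerateOpen _ O from hO) with
  | basic S hS =>
    obtain ⟨x, y, hxy, rfl⟩ := hS
    obtain ⟨N, hN⟩ := hr.exists_shadow_subset hG (d := ⟨(x, y), hxy⟩) hξ
    exact ⟨N, fun n hn => endShadow_mono (hN n hn)⟩
  | univ => exact ⟨0, fun _ _ => Set.subset_univ _⟩
  | inter S T hS hT ihS ihT =>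
    obtain ⟨N, hN⟩ := ihS hS hξ.1
    obtain ⟨M, hM⟩ := ihT hT hξ.2
    exact ⟨max N M, fun n hn => Set.subset_inter (hN n (le_of_max_le_left hn))
      (hM n (le_of_max_le_right hn))⟩
  | sUnion S hS ih =>
    obtain ⟨T, hT, hξT⟩ := hξ
    obtain ⟨N, hN⟩ := ih T hT (hS T hT) hξT
    exact ⟨N, fun n hn => (hN n hn).trans (Set.subset_sUnion_of_mem hT)⟩

theorem eq_of_forall_mem_endShadow (hG : G.IsTree) {r : Ray G} {ξ η : Boundary G}
    (hr : r.Represents ξ) (h : ∀ n, η ∈ endShadow (r.dart n)) : ξ = η := by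
  have key : ∀ n, (rayTo hG (r.toFun 0) η).toFun n = r.toFun n := by
    intro n
    induction n with
    | zero => simp
    | succ n ih =>
      have h1 := (mem_endShadow_iff hG).1 (h n)
      change (rayTo hG (r.toFun n) η).toFun 1 = r.toFun (n + 1) at h1
      rw [← h1, ← ih, rayTo_toFun_add, add_comm]
  have h2 : rayTo hG (r.toFun 0) η = r := Ray.ext' key
  have h3 := rayTo_represents hG (r.toFun 0) η
  rw [h2] at h3
  exact hr.symm.trans h3

theorem t2Space_boundary (hG : G.IsTree) : T2Space (Boundary G) := by
  refine ⟨fun ξ η hne => ?_⟩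
  obtain ⟨r, hr⟩ := _root_.Quotient.exists_rep ξ
  obtain ⟨n, hn⟩ : ∃ n, η ∉ endShadow (r.dart n) := by
    by_contra! hcon
    exact hne (eq_of_forall_mem_endShadow hG hr hcon)
  exact ⟨_, _, isOpen_endShadow (r.dart n), (isClopen_endShadow hG (r.dart n)).compl.2,
    Ray.Represents.mem_endShadow hr n, hn, disjoint_compl_right⟩

theorem compactSpace_boundary (hT : IsLocallyFiniteLeaflessTree G) :
    CompactSpace (Boundary G) := by
  refine ⟨isCompact_of_finite_subcover fun {ι} U hU hcov => ?_⟩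
  have key : ∀ d : G.Dart, ∃ t : Finset ι, endShadow d ⊆ ⋃ i ∈ t, U i := by
    classical
    refine bar_induction hT.isTree (fun d hd => ?_) (fun r => ?_)
    · choose! t ht using hd
      refine ⟨(succs hT d).biUnion t, ?_⟩
      rw [endShadow_eq_biUnion hT d]
      refine Set.iUnion₂_subset fun e he => (ht e (mem_succs.1 he)).trans ?_
      refine Set.iUnion₂_subset fun i hi => ?_
      exact Set.subset_biUnion_of_mem (u := U) (Finset.mem_biUnion.2 ⟨e, he, hi⟩)
    · obtain ⟨i, hi⟩ := Set.mem_iUnion.1 (hcov (Set.mem_univ (_root_.Quotient.mk _ r)))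
      obtain ⟨N, hN⟩ := Ray.Represents.exists_endShadow_subset hT.isTree
        (r := r) (ξ := _root_.Quotient.mk _ r) rfl (hU i) hi
      exact ⟨N, {i}, by simpa using hN N le_rfl⟩
  classical
  choose t ht using key
  obtain ⟨x⟩ := hT.isTree.connected.nonempty
  refine ⟨(outDarts hT x).biUnion t, ?_⟩
  rw [univ_eq_biUnion_outDarts hT x]
  refine Set.iUnion₂_subset fun e he => (ht e).trans ?_
  refine Set.iUnion₂_subset fun i hi => ?_
  exact Set.subset_biUnion_of_mem (u := U) (Finset.mem_biUnion.2 ⟨e, he, hi⟩)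

theorem secondCountable_boundary (hT : IsLocallyFiniteLeaflessTree G) :
    SecondCountableTopology (Boundary G) := by
  have := countable_darts hT
  refine ⟨⟨_, ?_, rfl⟩⟩
  refine (Set.countable_range (endShadow (G := G))).mono ?_
  rintro _ ⟨x, y, h, rfl⟩
  exact ⟨⟨(x, y), h⟩, rfl⟩

/-- The homeomorphism of the boundaries that is induced by an isomorphism of trees. -/
def boundaryHomeo (F : G ≃g H) : Boundary G ≃ₜ Boundary H where
  toFun := boundaryMapIso F
  invFun := boundaryMapIso F.symm
  left_inv := boundaryMapIso_symm_apply F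
  right_inv := boundaryMapIso_apply_symm F
  continuous_toFun := by
    refine continuous_generateFrom_iff.2 ?_
    rintro _ ⟨x, y, h, rfl⟩
    convert isOpen_endShadow (mapDart F.symm ⟨(x, y), h⟩) using 1
    ext ξ
    rw [Set.mem_preimage, ← mem_endShadow_mapDart F, mapDart_mapDart_symm]
  continuous_invFun := by
    refine continuous_generateFrom_iff.2 ?_
    rintro _ ⟨x, y, h, rfl⟩
    convert isOpen_endShadow (mapDart F ⟨(x, y), h⟩) using 1
    ext ξ
    rw [Set.mem_preimage, ← mem_endShadow_mapDart F.symm, mapDart_symm_mapDart]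

@[simp]
theorem boundaryMap_image (γ : G ≃g G) (A : Set (Boundary G)) :
    boundaryMap γ '' A = boundaryMap γ.symm ⁻¹' A :=
  (boundaryHomeo γ).toEquiv.image_eq_preimage_symm A

theorem measurable_boundaryMap (γ : G ≃g G) : Measurable (boundaryMap γ) :=
  (boundaryHomeo γ).continuous.measurable

theorem continuous_boundary :
    Continuous (Compactification.boundary : Boundary G → Compactification G) := by
  refine continuous_generateFrom_iff.2 ?_
  rintro _ ⟨x, y, h, rfl⟩
  convert isOpen_endShadow (⟨(x, y), h⟩ : G.Dart) using 1
  ext ξ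
  simp [halfSpace]

theorem isOpen_halfSpace (d : G.Dart) : IsOpen (halfSpace G d.fst d.snd) :=
  TopologicalSpace.isOpen_generateFrom_of_mem ⟨d.fst, d.snd, d.adj, rfl⟩

theorem boundary_mem_halfSpace {x y : V} {ξ : Boundary G} :
    Compactification.boundary ξ ∈ halfSpace G x y ↔ ξ ∈ basicBoundarySet G x y := by
  simp [halfSpace]

theorem vertex_mem_halfSpace {x y z : V} :
    Compactification.vertex z ∈ halfSpace G x y ↔ z ∈ basicSet G x y := by
  simp [halfSpace]

theorem halfSpace_mono {d e : G.Dart} (h : shadow e ⊆ shadow d) :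
    halfSpace G e.fst e.snd ⊆ halfSpace G d.fst d.snd :=
  Set.union_subset_union (Set.image_mono h) (Set.image_mono (endShadow_mono h))

theorem Ray.Represents.exists_halfSpace_subset (hG : G.IsTree) {r : Ray G} {ξ : Boundary G}
    (hr : r.Represents ξ) {O : Set (Compactification G)} (hO : IsOpen O)
    (hξ : Compactification.boundary ξ ∈ O) :
    ∃ N, ∀ n, N ≤ n → halfSpace G (r.dart n).fst (r.dart n).snd ⊆ O := by
  induction (show TopologicalSpace.GenerateOpen _ O from hO) with
  | basic S hS =>
    obtain ⟨x, y, hxy, rfl⟩ := hS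
    obtain ⟨N, hN⟩ := hr.exists_shadow_subset hG (d := ⟨(x, y), hxy⟩) (boundary_mem_halfSpace.1 hξ)
    exact ⟨N, fun n hn => halfSpace_mono (d := ⟨(x, y), hxy⟩) (hN n hn)⟩
  | univ => exact ⟨0, fun _ _ => Set.subset_univ _⟩
  | inter S T hS hT ihS ihT =>
    obtain ⟨N, hN⟩ := ihS hS hξ.1
    obtain ⟨M, hM⟩ := ihT hT hξ.2
    exact ⟨max N M, fun n hn => Set.subset_inter (hN n (le_of_max_le_left hn))
      (hM n (le_of_max_le_right hn))⟩
  | sUnion S hS ih =>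
    obtain ⟨T, hT, hξT⟩ := hξ
    obtain ⟨N, hN⟩ := ih T hT (hS T hT) hξT
    exact ⟨N, fun n hn => (hN n hn).trans (Set.subset_sUnion_of_mem hT)⟩

end Topology

/-! ### Borel measures on the boundary -/

section BorelMeasures

variable {V : Type u} {G : SimpleGraph V}

theorem shadow_trichotomy (hG : G.IsTree) {x : V} {d e : G.Dart} (hd : x ∉ shadow d)
    (he : x ∉ shadow e) :
    shadow e ⊆ shadow d ∨ shadow d ⊆ shadow e ∨ Disjoint (shadow d) (shadow e) := by
  have key : ∀ {d e : G.Dart}, x ∉ shadow d → x ∉ shadow e → d.fst ∈ shadow e →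
      shadow d ⊆ shadow e := by
    intro d e hd he h
    refine basicSet_subset hG e.adj d.adj h fun h' => ?_
    have h1 := dist_of_mem_of_notMem hG h he
    have h2 := dist_of_mem_of_notMem hG h' hd
    have h3 : G.dist e.fst d.fst = 0 := by omega
    rw [hG.connected.dist_eq_zero_iff] at h3
    rw [h3] at h'
    exact fst_notMem_shadow d h'
  by_cases h1 : d.fst ∈ shadow e
  · exact Or.inr (Or.inl (key hd he h1))
  by_cases h2 : e.fst ∈ shadow d
  · exact Or.inl (key he hd h2)
  by_cases h4 : d = e
  · exact Or.inl (by rw [h4])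
  refine Or.inr (Or.inr (Set.disjoint_left.2 fun z hz hz' => ?_))
  have h5 := dist_of_mem_of_notMem hG hz h2
  have h6 := dist_of_mem_of_notMem hG hz' h1
  have h3 : G.dist d.fst e.fst = 0 := by omega
  rw [hG.connected.dist_eq_zero_iff] at h3
  exact Set.disjoint_left.1 (shadow_disjoint_of_ne hG h3 h4) hz hz'

/-- The boundary sets of the oriented edges that point away from a vertex, and the empty set. -/
def shadowSystem (G : SimpleGraph V) (x : V) : Set (Set (Boundary G)) :=
  insert ∅ {S | ∃ d : G.Dart, x ∉ shadow d ∧ S = endShadow d}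

theorem isPiSystem_shadowSystem (hG : G.IsTree) (x : V) : IsPiSystem (shadowSystem G x) := by
  rintro S hS T hT -
  rcases hS with rfl | ⟨d, hd, rfl⟩
  · exact Or.inl (Set.empty_inter _)
  rcases hT with rfl | ⟨e, he, rfl⟩
  · exact Or.inl (Set.inter_empty _)
  rcases shadow_trichotomy hG hd he with h | h | h
  · exact Or.inr ⟨e, he, Set.inter_eq_right.2 (endShadow_mono h)⟩
  · exact Or.inr ⟨d, hd, Set.inter_eq_left.2 (endShadow_mono h)⟩
  · exact Or.inl (Set.disjoint_iff_inter_eq_empty.1 (endShadow_disjoint h))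

theorem borel_eq_generateFrom_shadowSystem (hT : IsLocallyFiniteLeaflessTree G) (x : V) :
    borel (Boundary G) = MeasurableSpace.generateFrom (shadowSystem G x) := by
  have := secondCountable_boundary hT
  rw [borel_eq_generateFrom_of_subbasis (s := {S | ∃ x y, G.Adj x y ∧ S = basicBoundarySet G x y})
    rfl]
  refine le_antisymm (MeasurableSpace.generateFrom_le ?_) (MeasurableSpace.generateFrom_le ?_)
  · rintro _ ⟨y, z, h, rfl⟩
    by_cases hx : x ∈ shadow (⟨(y, z), h⟩ : G.Dart)
    · have h1 : basicBoundarySet G y z = (endShadow (⟨(y, z), h⟩ : G.Dart).symm)ᶜ := by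
        rw [← compl_endShadow hT.isTree, compl_compl]
      rw [h1]
      refine MeasurableSet.compl (MeasurableSpace.measurableSet_generateFrom (Or.inr ⟨_, ?_, rfl⟩))
      exact fun h' => (notMem_shadow_iff hT.isTree).2 h' hx
    · exact MeasurableSpace.measurableSet_generateFrom (Or.inr ⟨⟨(y, z), h⟩, hx, rfl⟩)
  · rintro _ (rfl | ⟨d, hd, rfl⟩)
    · exact @MeasurableSet.empty _ (MeasurableSpace.generateFrom _)
    · exact MeasurableSpace.measurableSet_generateFrom ⟨d.fst, d.snd, d.adj, rfl⟩

/-- Two finite measures agree on `U(d)` if they agree on the sets `U(e)`, for `e` in the shadow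
of `d`. -/
theorem restrict_endShadow_eq (hT : IsLocallyFiniteLeaflessTree G) {μ ν : Measure (Boundary G)}
    [IsFiniteMeasure μ] {d : G.Dart}
    (h : ∀ e, shadow e ⊆ shadow d → μ (endShadow e) = ν (endShadow e)) :
    μ.restrict (endShadow d) = ν.restrict (endShadow d) := by
  refine ext_of_generate_finite (shadowSystem G d.fst)
    (borel_eq_generateFrom_shadowSystem hT d.fst) (isPiSystem_shadowSystem hT.isTree d.fst) ?_ ?_
  · rintro _ (rfl | ⟨e, he, rfl⟩)
    · simp
    rw [Measure.restrict_apply (measurableSet_endShadow e),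
      Measure.restrict_apply (measurableSet_endShadow e)]
    rcases shadow_trichotomy hT.isTree (fst_notMem_shadow d) he with h1 | h1 | h1
    · rw [Set.inter_eq_left.2 (endShadow_mono h1)]
      exact h e h1
    · rw [Set.inter_eq_right.2 (endShadow_mono h1)]
      exact h d subset_rfl
    · rw [Set.inter_comm, Set.disjoint_iff_inter_eq_empty.1 (endShadow_disjoint h1)]
      simp
  · simpa using h d subset_rfl

theorem measure_eq_of_subset_endShadow (hT : IsLocallyFiniteLeaflessTree G)
    {μ ν : Measure (Boundary G)} [IsFiniteMeasure μ] {d : G.Dart}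
    (h : ∀ e, shadow e ⊆ shadow d → μ (endShadow e) = ν (endShadow e))
    {B : Set (Boundary G)} (hB : MeasurableSet B) (hBd : B ⊆ endShadow d) : μ B = ν B := by
  have h1 := congrArg (fun m => m B) (restrict_endShadow_eq hT h)
  simp only [Measure.restrict_apply hB, Set.inter_eq_left.2 hBd] at h1
  exact h1

theorem measureReal_endShadow_eq_sum (hT : IsLocallyFiniteLeaflessTree G)
    (μ : Measure (Boundary G)) [IsFiniteMeasure μ] (d : G.Dart) :
    μ.real (endShadow d) = ∑ e ∈ succs hT d, μ.real (endShadow e) := by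
  conv_lhs => rw [endShadow_eq_biUnion hT d]
  exact measureReal_biUnion_finset (pairwiseDisjoint_succs hT d)
    (fun e _ => measurableSet_endShadow e)

theorem measureReal_univ_eq_sum (hT : IsLocallyFiniteLeaflessTree G)
    (μ : Measure (Boundary G)) [IsFiniteMeasure μ] (x : V) :
    μ.real Set.univ = ∑ e ∈ outDarts hT x, μ.real (endShadow e) := by
  rw [univ_eq_biUnion_outDarts hT x]
  exact measureReal_biUnion_finset (pairwiseDisjoint_outDarts hT x)
    (fun e _ => measurableSet_endShadow e)

theorem setIntegral_endShadow_eq_sum (hT : IsLocallyFiniteLeaflessTree G)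
    {μ : Measure (Boundary G)} {f : Boundary G → ℝ} (hf : Integrable f μ) (d : G.Dart) :
    ∫ ξ in endShadow d, f ξ ∂μ = ∑ e ∈ succs hT d, ∫ ξ in endShadow e, f ξ ∂μ := by
  conv_lhs => rw [endShadow_eq_biUnion hT d]
  exact integral_biUnion_finset _ (fun e _ => measurableSet_endShadow e)
    (pairwiseDisjoint_succs hT d) (fun e _ => hf.integrableOn)

theorem integral_eq_sum_outDarts (hT : IsLocallyFiniteLeaflessTree G)
    {μ : Measure (Boundary G)} {f : Boundary G → ℝ} (hf : Integrable f μ) (x : V) :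
    ∫ ξ, f ξ ∂μ = ∑ e ∈ outDarts hT x, ∫ ξ in endShadow e, f ξ ∂μ := by
  rw [← setIntegral_univ, univ_eq_biUnion_outDarts hT x]
  exact integral_biUnion_finset _ (fun e _ => measurableSet_endShadow e)
    (pairwiseDisjoint_outDarts hT x) (fun e _ => hf.integrableOn)

end BorelMeasures

/-! ### Cocompactness and irreducibility -/

section Groups

variable {V : Type u} {G : SimpleGraph V} {Γ : Subgroup (G ≃g G)}

theorem IsTreeSchottky.eq_one_of_apply_eq (hΓ : IsTreeSchottky Γ) {γ : G ≃g G} (hγ : γ ∈ Γ)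
    {x : V} (h : γ x = x) : γ = 1 := by
  by_contra hne
  exact (hΓ.hyperbolic γ hγ hne).2 x h

theorem exists_mem_shadow_of_limitSet (hT : IsLocallyFiniteLeaflessTree G)
    (hΛ : limitSet Γ = Set.univ) (d : G.Dart) (x : V) : ∃ γ ∈ Γ, γ x ∈ shadow d := by
  obtain ⟨ξ, hξ⟩ := endShadow_nonempty hT d
  obtain ⟨z, hz⟩ : ξ ∈ limitSet Γ := hΛ ▸ Set.mem_univ ξ
  have hr := rayTo_represents hT.isTree d.fst ξ
  have hd : (rayTo hT.isTree d.fst ξ).dart 0 = d :=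
    Dart.ext' (rayTo_zero hT.isTree d.fst ξ) ((mem_endShadow_iff hT.isTree).1 hξ)
  generalize rayTo hT.isTree d.fst ξ = r at hr hd
  have hc := mem_closure_iff.1 hz _ (isOpen_halfSpace (r.dart (G.dist x z + 1)))
    (boundary_mem_halfSpace.2 (hr.mem_endShadow _))
  obtain ⟨_, hy, _, ⟨γ, hγ, rfl⟩, rfl⟩ := hc
  rw [vertex_mem_halfSpace] at hy
  refine ⟨γ, hγ, ?_⟩
  by_contra hx
  have h1 := dist_map γ x z
  have h2 : r.toFun 0 ∉ shadow (r.dart (G.dist x z + 1)) := r.notMem_shadow (Nat.zero_le _)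
  have h3 := dist_of_mem_of_notMem hT.isTree hy h2
  have h4 : G.dist (r.toFun 0) (r.dart (G.dist x z + 1)).fst = G.dist x z + 1 :=
    r.dist_eq 0 _ (Nat.zero_le _)
  have h5 : γ z ∈ shadow d := by
    rw [← hd]
    exact r.shadow_dart_subset hT.isTree (Nat.zero_le _) hy
  have h6 := dist_of_mem_of_notMem hT.isTree h5 hx
  rw [show d.fst = r.toFun 0 by rw [← hd]; rfl] at h6
  omega

/-- Up to the group, the oriented edge `e` can be reached from `d` by a path without
backtracking. -/
def Reaches (Γ : Subgroup (G ≃g G)) (d e : G.Dart) : Prop :=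
  ∃ γ ∈ Γ, shadow (mapDart γ e) ⊆ shadow d

/-- A finitely generated group with full limit set acts cocompactly. If both sides of an edge
contain points of the orbit of `x`, then a word in the generators crosses this edge, so that the
edge lies near the orbit. -/
theorem exists_dist_le (hT : IsLocallyFiniteLeaflessTree G) (hΓ : IsTreeSchottky Γ)
    (hΛ : limitSet Γ = Set.univ) (x : V) :
    ∃ C, ∀ v, ∃ γ ∈ Γ, G.dist (γ v) x ≤ C := by
  obtain ⟨S, hS⟩ := (Group.fg_def.1 hΓ.fg)
  refine ⟨S.sup fun s => G.dist x ((s : G ≃g G) x), fun v => ?_⟩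
  by_contra! hcon
  obtain ⟨y, hy, y', hy', hne⟩ := hT.nontrivial_neighbors v
  let d : G.Dart := ⟨(v, y), hy⟩
  let d' : G.Dart := ⟨(v, y'), hy'⟩
  obtain ⟨γ, hγ, hγx⟩ := exists_mem_shadow_of_limitSet hT hΛ d x
  obtain ⟨δ, hδ, hδx⟩ := exists_mem_shadow_of_limitSet hT hΛ d' x
  have hδx' : δ x ∉ shadow d := fun h => Set.disjoint_left.1
    (basicSet_disjoint_of_ne hT.isTree hy hy' hne) h hδx
  have hstep : ∀ s ∈ S, ∀ γ : Γ, ((γ : G ≃g G) x ∈ shadow d ↔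
      ((γ * s : Γ) : G ≃g G) x ∈ shadow d) := by
    intro s hs γ
    have h1 : G.dist ((γ : G ≃g G) x) (((γ * s : Γ) : G ≃g G) x) = G.dist x ((s : G ≃g G) x) :=
      dist_map (γ : G ≃g G) x ((s : G ≃g G) x)
    have h2 : G.dist x ((s : G ≃g G) x) ≤ S.sup fun s => G.dist x ((s : G ≃g G) x) :=
      Finset.le_sup (f := fun s : Γ => G.dist x ((s : G ≃g G) x)) hs
    have h3 : ∀ γ : Γ, (S.sup fun s => G.dist x ((s : G ≃g G) x)) <
        G.dist ((γ : G ≃g G) x) v := by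
      intro γ
      have h4 := hcon ((γ : G ≃g G)⁻¹) (Γ.inv_mem γ.2)
      have h5 := dist_map ((γ : G ≃g G)⁻¹) v ((γ : G ≃g G) x)
      rw [show ((γ : G ≃g G)⁻¹) ((γ : G ≃g G) x) = x from (γ : G ≃g G).symm_apply_apply x] at h5
      rwa [h5, G.dist_comm] at h4
    have h4 := h3 γ
    have h5 := h3 (γ * s)
    constructor
    · intro h
      by_contra h'
      have h6 : _ = G.dist _ v + 1 + _ := dist_eq_of_separated hT.isTree hy h h'
      rw [G.dist_comm] at h6
      omega
    · intro h
      by_contra h'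
      have h6 : _ = G.dist _ v + 1 + _ := dist_eq_of_separated hT.isTree hy h h'
      omega
  have hall : ∀ t : Γ, ∀ γ : Γ, ((γ : G ≃g G) x ∈ shadow d ↔
      ((γ * t : Γ) : G ≃g G) x ∈ shadow d) := by
    intro t
    have ht : t ∈ Subgroup.closure (S : Set Γ) := hS ▸ Subgroup.mem_top t
    induction ht using Subgroup.closure_induction with
    | mem s hs => exact hstep s hs
    | one => intro γ; rw [mul_one]
    | mul s t _ _ hs ht => intro γ; rw [hs γ, ht (γ * s), mul_assoc]
    | inv s _ hs => intro γ; rw [hs (γ * s⁻¹), inv_mul_cancel_right]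
  have h1 := (hall (⟨γ, hγ⟩⁻¹ * ⟨δ, hδ⟩) ⟨γ, hγ⟩).1 hγx
  rw [mul_inv_cancel_left] at h1
  exact hδx' h1

theorem exists_finite_representatives (hT : IsLocallyFiniteLeaflessTree G)
    (hΓ : IsTreeSchottky Γ) (hΛ : limitSet Γ = Set.univ) :
    ∃ R : Finset G.Dart, ∀ d, ∃ γ ∈ Γ, mapDart γ d ∈ R := by
  obtain ⟨x⟩ := hT.isTree.connected.nonempty
  obtain ⟨C, hC⟩ := exists_dist_le hT hΓ hΛ x
  have hfin : {d : G.Dart | G.dist d.fst x ≤ C}.Finite := by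
    refine ((finite_closedBall hT x C).biUnion fun y _ => finite_out hT y).subset fun d hd => ?_
    exact Set.mem_biUnion (show d.fst ∈ {y | G.dist y x ≤ C} from hd) rfl
  refine ⟨hfin.toFinset, fun d => ?_⟩
  obtain ⟨γ, hγ, h⟩ := hC d.fst
  exact ⟨γ, hγ, by simpa using h⟩

theorem Reaches.trans {d e f : G.Dart} (h : Reaches Γ d e) (h' : Reaches Γ e f) :
    Reaches Γ d f := by
  obtain ⟨γ, hγ, h⟩ := h
  obtain ⟨δ, hδ, h'⟩ := h'
  refine ⟨γ * δ, Γ.mul_mem hγ hδ, ?_⟩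
  rw [mapDart_mul]
  exact ((shadow_mapDart_subset_iff γ).2 h').trans h

theorem reaches_of_subset {d e : G.Dart} (h : shadow e ⊆ shadow d) : Reaches Γ d e :=
  ⟨1, Γ.one_mem, h⟩

theorem reaches_mapDart {γ : G ≃g G} (hγ : γ ∈ Γ) (d : G.Dart) : Reaches Γ d (mapDart γ d) := by
  refine ⟨γ⁻¹, Γ.inv_mem hγ, ?_⟩
  rw [← mapDart_mul, inv_mul_cancel, mapDart_one]

theorem Reaches.symm (hG : G.IsTree) {d e : G.Dart} (h : Reaches Γ d e) :
    Reaches Γ e.symm d.symm := by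
  obtain ⟨γ, hγ, h⟩ := h
  refine ⟨γ⁻¹, Γ.inv_mem hγ, ?_⟩
  rw [← shadow_mapDart_subset_iff γ, ← mapDart_mul, mul_inv_cancel, mapDart_one]
  exact shadow_symm_subset_symm hG h

theorem reaches_or_reaches_symm (hT : IsLocallyFiniteLeaflessTree G)
    (hΛ : limitSet Γ = Set.univ) (d e : G.Dart) : Reaches Γ d e ∨ Reaches Γ d e.symm := by
  obtain ⟨γ, hγ, h⟩ := exists_mem_shadow_of_limitSet hT hΛ d e.fst
  by_cases h1 : d.fst ∈ shadow (mapDart γ e)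
  · by_cases h2 : γ e.snd ∈ shadow d
    · refine Or.inr ⟨γ, hγ, basicSet_subset hT.isTree d.adj (mapDart γ e.symm).adj h2 fun h3 => ?_⟩
      exact (notMem_shadow_iff hT.isTree (d := mapDart γ e)).2 h3 h1
    · obtain ⟨h3, h4⟩ := eq_of_adj_of_mem_basicSet hT.isTree d.adj (mapDart γ e).adj h h2
      refine Or.inr ⟨γ, hγ, ?_⟩
      rw [show mapDart γ e.symm = d from Dart.ext' h4 h3]
  · exact Or.inl ⟨γ, hγ, basicSet_subset hT.isTree d.adj (mapDart γ e).adj h h1⟩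

theorem rank_le_one_of_isCyclic {A : Type*} [Group A] [Group.FG A] [IsCyclic A] :
    Group.rank A ≤ 1 := by
  obtain ⟨a, ha⟩ := IsCyclic.exists_generator (α := A)
  have h : Subgroup.closure (({a} : Finset A) : Set A) = ⊤ := by
    rw [Finset.coe_singleton, ← Subgroup.zpowers_eq_closure]
    exact (Subgroup.eq_top_iff' _).2 ha
  exact (Group.rank_le h).trans (Finset.card_singleton a).le

/-- If an equivariant map `π` moves every vertex along a ray, and if all these rays meet, then the
group fixes the common end of the rays, and the displacement towards this end embeds the group
into `ℤ`. -/
theorem isCyclic_of_equivariant_parent (hG : G.IsTree) (hΓ : IsTreeSchottky Γ) (π : V → V)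
    (hadj : ∀ x, G.Adj x (π x)) (hne : ∀ x, π (π x) ≠ x)
    (hequiv : ∀ γ ∈ Γ, ∀ x, π (γ x) = γ (π x))
    (hmeet : ∀ x y, G.Adj x y → π x = y ∨ π y = x) : IsCyclic Γ := by
  obtain ⟨x⟩ := hG.connected.nonempty
  have hmerge : ∀ y z, ∃ a b : ℕ, π^[a] y = π^[b] z := by
    intro y z
    obtain ⟨p⟩ := hG.connected.preconnected y z
    induction p with
    | nil => exact ⟨0, 0, rfl⟩
    | @cons u v w h p ih =>
      obtain ⟨a, b, hab⟩ := ih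
      rcases hmeet u v h with h | h
      · exact ⟨a + 1, b, by rw [Function.iterate_succ_apply, h, hab]⟩
      · refine ⟨a, b + 1, ?_⟩
        rw [← h, ← Function.iterate_succ_apply, Function.iterate_succ_apply', hab,
          ← Function.iterate_succ_apply' π]
  have hinj : Function.Injective fun n => π^[n] x := by
    let r : Ray G := Ray.ofNonbacktracking hG (fun n => π^[n] x)
      (fun n => by rw [Function.iterate_succ_apply']; exact hadj _)
      (fun n => by rw [Function.iterate_succ_apply', Function.iterate_succ_apply']; exact hne _)
    intro m n h
    have key : ∀ m n, m ≤ n → π^[m] x = π^[n] x → m = n := by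
      intro m n hmn h
      have h1 : G.dist (π^[m] x) (π^[n] x) = n - m := r.dist_eq m n hmn
      rw [h, SimpleGraph.dist_self] at h1
      omega
    rcases le_total m n with h1 | h1
    · exact key m n h1 h
    · exact (key n m h1 h.symm).symm
  have hiter : ∀ γ ∈ Γ, ∀ n y, π^[n] (γ y) = γ (π^[n] y) := by
    intro γ hγ n
    induction n with
    | zero => exact fun _ => rfl
    | succ n ih =>
      intro y
      rw [Function.iterate_succ_apply, Function.iterate_succ_apply, hequiv γ hγ, ih]
  choose a b hab using fun γ : Γ => hmerge ((γ : G ≃g G) x) x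
  have hshift : ∀ (γ : Γ) n, (γ : G ≃g G) (π^[a γ + n] x) = π^[b γ + n] x := by
    intro γ n
    rw [← hiter γ γ.2, add_comm, Function.iterate_add_apply, hab, ← Function.iterate_add_apply,
      add_comm]
  let f : Γ →* Multiplicative ℤ := MonoidHom.mk'
    (fun γ => Multiplicative.ofAdd ((b γ : ℤ) - a γ)) (by
      intro γ δ
      have h1 : (γ : G ≃g G) ((δ : G ≃g G) (π^[a δ + (a γ + a (γ * δ))] x)) =
          π^[b γ + (b δ + a (γ * δ))] x := by
        rw [hshift δ, show b δ + (a γ + a (γ * δ)) = a γ + (b δ + a (γ * δ)) by omega, hshift γ]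
      have h2 : (γ : G ≃g G) ((δ : G ≃g G) (π^[a δ + (a γ + a (γ * δ))] x)) =
          π^[b (γ * δ) + (a γ + a δ)] x := by
        rw [← hshift (γ * δ), show a δ + (a γ + a (γ * δ)) = a (γ * δ) + (a γ + a δ) by omega]
        rfl
      have h3 := hinj (h1.symm.trans h2)
      rw [← ofAdd_add]
      congr 1
      omega)
  refine isCyclic_of_injective f ?_
  rw [injective_iff_map_eq_one]
  intro γ hγ
  have h1 : ((b γ : ℤ) - a γ) = 0 := hγ
  have h2 : b γ = a γ := by omega
  have h3 := hshift γ 0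
  rw [h2] at h3
  exact Subtype.ext (hΓ.eq_one_of_apply_eq γ.2 h3)

/-- Every oriented edge can be reached from every other one. Otherwise the oriented edges reached
from a given one form an invariant orientation in which every vertex has exactly one incoming
edge, and the group is cyclic. -/
theorem reaches (hT : IsLocallyFiniteLeaflessTree G) (hΓ : IsTreeSchottky Γ)
    (hΛ : limitSet Γ = Set.univ) (hg : 2 ≤ hΓ.genus) (d e : G.Dart) : Reaches Γ d e := by
  have hG := hT.isTree
  suffices hsymm : ∀ c : G.Dart, Reaches Γ c c.symm by
    rcases reaches_or_reaches_symm hT hΛ d e with h | h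
    · exact h
    · exact h.trans (by simpa using hsymm e.symm)
  intro c
  by_contra hc
  have hexcl : ∀ d, Reaches Γ c d → ¬ Reaches Γ c d.symm := fun d h h' =>
    hc (h.trans (by simpa using h'.symm hG))
  have hex : ∀ w, ∃ d : G.Dart, d.snd = w ∧ Reaches Γ c d := by
    intro w
    obtain ⟨γ, hγ, hw⟩ := exists_mem_shadow_of_limitSet hT hΛ c w
    have hne : γ w ≠ c.fst := fun h => fst_notMem_shadow c (h ▸ hw)
    obtain ⟨p, hp, hcp⟩ := exists_dart_to hG hne
    have hsub : shadow p ⊆ shadow c := by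
      by_cases h1 : p.fst ∈ shadow c
      · exact basicSet_subset hG c.adj p.adj h1 hcp
      · have h2 := eq_of_adj_of_mem_basicSet hG c.adj p.adj.symm (hp ▸ hw) h1
        rw [show p = c from Dart.ext' h2.2 h2.1]
    refine ⟨mapDart γ⁻¹ p, ?_, (reaches_of_subset hsub).trans (reaches_mapDart (Γ.inv_mem hγ) p)⟩
    rw [mapDart_snd, hp]
    exact γ.symm_apply_apply w
  have huniq : ∀ d e : G.Dart, d.snd = e.snd → Reaches Γ c d → Reaches Γ c e → d = e := by
    intro d e h hd he
    by_contra hne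
    have hs : IsSucc d e.symm := ⟨h.symm, fun h' => hne (Dart.ext' h'.symm h)⟩
    exact hexcl e he (hd.trans (reaches_of_subset (hs.shadow_subset hG)))
  choose par hpar hS using hex
  have hcyc : IsCyclic Γ := by
    refine isCyclic_of_equivariant_parent hG hΓ (fun w => (par w).fst) (fun w => ?_) (fun w h => ?_)
      (fun γ hγ w => ?_) (fun y z hyz => ?_)
    · have := (par w).adj.symm
      rwa [hpar w] at this
    · refine hexcl _ (hS w) ?_
      have : (par w).symm = par (par w).fst := Dart.ext' ((hpar w).trans h.symm) (hpar _).symm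
      rw [this]
      exact hS _
    · have := huniq (par (γ w)) (mapDart γ (par w)) ?_ (hS _)
        ((hS w).trans (reaches_mapDart hγ _))
      · rw [this, mapDart_fst]
      · rw [hpar, mapDart_snd, hpar]
    · rcases reaches_or_reaches_symm hT hΛ c ⟨(y, z), hyz⟩ with h | h
      · exact Or.inr (congrArg (fun d : G.Dart => d.fst) (huniq _ _ (hpar z) (hS z) h))
      · exact Or.inl (congrArg (fun d : G.Dart => d.fst) (huniq _ _ (hpar y) (hS y) h))
  have := hΓ.fg
  have h1 : Group.rank Γ ≤ 1 := rank_le_one_of_isCyclic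
  have h2 : 2 ≤ Group.rank Γ := hg
  omega

/-- The tree branches: in a line, the element that reverses an edge fixes a vertex or reverses an
edge. -/
theorem exists_branching (hT : IsLocallyFiniteLeaflessTree G) (hΓ : IsTreeSchottky Γ)
    (hΛ : limitSet Γ = Set.univ) (hg : 2 ≤ hΓ.genus) :
    ∃ d e f : G.Dart, IsSucc d e ∧ IsSucc d f ∧ e ≠ f := by
  by_contra! hcon
  have hG := hT.isTree
  obtain ⟨x⟩ := hG.connected.nonempty
  obtain ⟨y, hy⟩ := (hT.nontrivial_neighbors x).nonempty
  choose next hnext using hT.exists_isSucc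
  let D : ℕ → G.Dart := fun n => next^[n] ⟨(x, y), hy⟩
  have hD : ∀ n, IsSucc (D n) (D (n + 1)) := fun n => by
    change IsSucc _ (next^[n + 1] _)
    rw [Function.iterate_succ_apply']
    exact hnext _
  obtain ⟨γ, hγ, hsub⟩ := reaches hT hΓ hΛ hg (D 0) (D 0).symm
  obtain ⟨n, hn⟩ : ∃ n, mapDart γ (D 0).symm = D n := by
    refine shadow_induction hG (P := fun e => ∃ n, e = D n) ⟨0, rfl⟩ ?_ hsub
    rintro _ f ⟨n, rfl⟩ hf -
    exact ⟨n + 1, hcon _ _ _ hf (hD n)⟩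
  have hrev : ∀ k m, k + m = n → mapDart γ (D k) = (D m).symm := by
    intro k
    induction k with
    | zero =>
      rintro m hm
      rw [zero_add] at hm
      rw [hm, ← hn]
      rfl
    | succ k ih =>
      intro m hm
      have h1 := ih (m + 1) (by omega)
      refine hcon (mapDart γ (D k)) _ _ ((hD k).map γ) ?_
      rw [h1]
      exact (hD m).symm
  rcases Nat.even_or_odd' n with ⟨k, rfl | rfl⟩
  · have h1 := hrev k k (by omega)
    refine hΓ.withoutInversion γ hγ _ _ (D k).adj ⟨?_, ?_⟩
    · exact congrArg (fun d : G.Dart => d.fst) h1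
    · exact congrArg (fun d : G.Dart => d.snd) h1
  · have h1 := hrev k (k + 1) (by omega)
    have h2 : γ (D k).snd = (D k).snd :=
      (congrArg (fun d : G.Dart => d.snd) h1).trans (hD k).1
    have h3 := hΓ.eq_one_of_apply_eq hγ h2
    rw [h3, mapDart_one] at h1
    exact (hD k).2 (congrArg (fun d : G.Dart => d.fst) h1).symm

end Groups

/-! ### The transfer operator and its positive eigenfunction -/

section Transfer

variable {V : Type u} {G : SimpleGraph V} {Γ : Subgroup (G ≃g G)}

/-- The properties of a tree-Schottky group of genus at least two with full limit set on which the
construction of its conformal measure rests: it acts freely on a branching tree, with finitely many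
orbits of oriented edges, each of which is reached from every oriented edge. -/
structure IsUniformLattice (Γ : Subgroup (G ≃g G)) : Prop where
  tree : IsLocallyFiniteLeaflessTree G
  free : ∀ γ ∈ Γ, ∀ x, γ x = x → γ = 1
  finite : ∃ R : Finset G.Dart, ∀ d, ∃ γ ∈ Γ, mapDart γ d ∈ R
  reaches : ∀ d e, Reaches Γ d e
  branching : ∃ d e f : G.Dart, IsSucc d e ∧ IsSucc d f ∧ e ≠ f

theorem IsTreeSchottky.isUniformLattice (hT : IsLocallyFiniteLeaflessTree G)
    (hΓ : IsTreeSchottky Γ) (hΛ : limitSet Γ = Set.univ) (hg : 2 ≤ hΓ.genus) :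
    IsUniformLattice Γ where
  tree := hT
  free _ hγ _ h := hΓ.eq_one_of_apply_eq hγ h
  finite := exists_finite_representatives hT hΓ hΛ
  reaches := TreeRigidity.reaches hT hΓ hΛ hg
  branching := exists_branching hT hΓ hΛ hg

/-- A function on oriented edges is `Γ`-invariant. -/
def IsInvariantFun (Γ : Subgroup (G ≃g G)) (h : G.Dart → ℝ) : Prop :=
  ∀ γ ∈ Γ, ∀ d, h (mapDart γ d) = h d

theorem IsInvariantFun.le_sum {h : G.Dart → ℝ} (hh : IsInvariantFun Γ h) (h0 : ∀ d, 0 ≤ h d)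
    {R : Finset G.Dart} (hR : ∀ d, ∃ γ ∈ Γ, mapDart γ d ∈ R) (d : G.Dart) :
    h d ≤ ∑ e ∈ R, h e := by
  obtain ⟨γ, hγ, hd⟩ := hR d
  rw [← hh γ hγ d]
  exact Finset.single_le_sum (fun e _ => h0 e) hd

theorem IsInvariantFun.sub {h k : G.Dart → ℝ} (hh : IsInvariantFun Γ h)
    (hk : IsInvariantFun Γ k) : IsInvariantFun Γ (h - k) := fun γ hγ d => by
  simp only [Pi.sub_apply, hh γ hγ d, hk γ hγ d]

theorem IsInvariantFun.smul {h : G.Dart → ℝ} (hh : IsInvariantFun Γ h) (c : ℝ) :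
    IsInvariantFun Γ (c • h) := fun γ hγ d => by
  simp only [Pi.smul_apply, hh γ hγ d]

/-- The transfer operator: the sum of a function over the oriented edges that continue a given one
without backtracking. -/
noncomputable def transfer (hT : IsLocallyFiniteLeaflessTree G) :
    (G.Dart → ℝ) →ₗ[ℝ] (G.Dart → ℝ) where
  toFun h d := ∑ e ∈ succs hT d, h e
  map_add' h k := by ext d; simp [Finset.sum_add_distrib]
  map_smul' c h := by ext d; simp [Finset.mul_sum]

theorem transfer_apply (hT : IsLocallyFiniteLeaflessTree G) (h : G.Dart → ℝ) (d : G.Dart) :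
    transfer hT h d = ∑ e ∈ succs hT d, h e := rfl

theorem sum_succs_mapDart (hT : IsLocallyFiniteLeaflessTree G) (γ : G ≃g G) (d : G.Dart)
    {M : Type*} [AddCommMonoid M] (h : G.Dart → M) :
    ∑ e ∈ succs hT (mapDart γ d), h e = ∑ e ∈ succs hT d, h (mapDart γ e) := by
  symm
  refine Finset.sum_bij (fun e _ => mapDart γ e) (fun e he => ?_) (fun _ _ _ _ h =>
    mapDart_injective γ h) (fun e he => ?_) (fun _ _ => rfl)
  · exact mem_succs.2 ((mem_succs.1 he).map γ)
  · refine ⟨mapDart γ.symm e, mem_succs.2 ?_, mapDart_mapDart_symm γ e⟩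
    simpa using (mem_succs.1 he).map γ.symm

theorem IsInvariantFun.transfer (hT : IsLocallyFiniteLeaflessTree G) {h : G.Dart → ℝ}
    (hh : IsInvariantFun Γ h) : IsInvariantFun Γ (transfer hT h) := fun γ hγ d => by
  rw [transfer_apply, transfer_apply, sum_succs_mapDart]
  exact Finset.sum_congr rfl fun e _ => hh γ hγ e

theorem IsInvariantFun.transfer_pow (hT : IsLocallyFiniteLeaflessTree G) {h : G.Dart → ℝ}
    (hh : IsInvariantFun Γ h) (n : ℕ) :
    IsInvariantFun Γ ((TreeRigidity.transfer hT ^ n) h) := by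
  induction n with
  | zero => exact hh
  | succ n ih =>
    rw [pow_succ']
    exact ih.transfer hT

theorem transfer_nonneg (hT : IsLocallyFiniteLeaflessTree G) {h : G.Dart → ℝ}
    (h0 : ∀ d, 0 ≤ h d) (d : G.Dart) : 0 ≤ transfer hT h d :=
  Finset.sum_nonneg fun e _ => h0 e

theorem transfer_pow_nonneg (hT : IsLocallyFiniteLeaflessTree G) {h : G.Dart → ℝ}
    (h0 : ∀ d, 0 ≤ h d) (n : ℕ) (d : G.Dart) : 0 ≤ (transfer hT ^ n) h d := by
  induction n generalizing d with
  | zero => exact h0 d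
  | succ n ih =>
    rw [pow_succ']
    exact transfer_nonneg hT ih d

theorem le_transfer (hT : IsLocallyFiniteLeaflessTree G) {h : G.Dart → ℝ} (h0 : ∀ d, 0 ≤ h d)
    {d e : G.Dart} (he : IsSucc d e) : h e ≤ transfer hT h d :=
  Finset.single_le_sum (fun e _ => h0 e) (mem_succs.2 he)

theorem exists_le_transfer_pow (hT : IsLocallyFiniteLeaflessTree G) {d e : G.Dart}
    (he : shadow e ⊆ shadow d) :
    ∃ n, ∀ h : G.Dart → ℝ, (∀ d, 0 ≤ h d) → h e ≤ (transfer hT ^ n) h d := by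
  refine shadow_induction hT.isTree
    (P := fun e => ∃ n, ∀ h : G.Dart → ℝ, (∀ d, 0 ≤ h d) → h e ≤ (transfer hT ^ n) h d)
    ⟨0, fun h _ => le_rfl⟩ ?_ he
  rintro e f ⟨n, hn⟩ hef -
  refine ⟨n + 1, fun h h0 => ?_⟩
  rw [pow_succ]
  exact (le_transfer hT h0 hef).trans (hn _ (transfer_nonneg hT h0))

namespace IsUniformLattice

theorem exists_dart (hU : IsUniformLattice Γ) : Nonempty G.Dart :=
  hU.branching.nonempty

theorem exists_uniform_le_transfer_pow (hU : IsUniformLattice Γ) (e : G.Dart) :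
    ∃ N, ∀ h : G.Dart → ℝ, IsInvariantFun Γ h → (∀ d, 0 ≤ h d) → ∀ d, ∃ n < N,
      h e ≤ (transfer hU.tree ^ n) h d := by
  obtain ⟨R, hR⟩ := hU.finite
  have key : ∀ d, ∃ n, ∀ h : G.Dart → ℝ, IsInvariantFun Γ h → (∀ d, 0 ≤ h d) →
      h e ≤ (transfer hU.tree ^ n) h d := by
    intro d
    obtain ⟨γ, hγ, hsub⟩ := hU.reaches d e
    obtain ⟨n, hn⟩ := exists_le_transfer_pow hU.tree hsub
    exact ⟨n, fun h hh h0 => hh γ hγ e ▸ hn h h0⟩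
  choose n hn using key
  refine ⟨R.sup n + 1, fun h hh h0 d => ?_⟩
  obtain ⟨γ, hγ, hd⟩ := hR d
  refine ⟨n (mapDart γ d), Nat.lt_succ_of_le (Finset.le_sup hd), ?_⟩
  have := hn (mapDart γ d) h hh h0
  rwa [hh.transfer_pow hU.tree _ γ hγ d] at this

/-- The minimum principle: an invariant superharmonic function is a multiple of the positive
harmonic function. -/
theorem eq_mul_of_superharmonic (hU : IsUniformLattice Γ) {t : ℝ} (ht : 0 < t)
    {h f : G.Dart → ℝ} (hh : IsInvariantFun Γ h) (hf : IsInvariantFun Γ f) (hpos : ∀ d, 0 < h d)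
    (hharm : ∀ d, h d = t * transfer hU.tree h d)
    (hsuper : ∀ d, t * transfer hU.tree f d ≤ f d) : ∃ c, ∀ d, f d = c * h d := by
  obtain ⟨R, hR⟩ := hU.finite
  obtain ⟨d₁⟩ := hU.exists_dart
  have hne : R.Nonempty := by
    obtain ⟨γ, -, h⟩ := hR d₁
    exact ⟨_, h⟩
  obtain ⟨d₀, -, hmin⟩ := R.exists_min_image (fun d => f d / h d) hne
  refine ⟨f d₀ / h d₀, ?_⟩
  set c := f d₀ / h d₀ with hc
  let k : G.Dart → ℝ := f - c • h
  have hkinv : IsInvariantFun Γ k := hf.sub (hh.smul c)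
  have hk0 : ∀ d, 0 ≤ k d := by
    intro d
    obtain ⟨γ, hγ, hd⟩ := hR d
    have h1 := hmin _ hd
    rw [hf γ hγ, hh γ hγ, le_div_iff₀ (hpos d)] at h1
    simpa [k] using h1
  have hksuper : ∀ d, t * transfer hU.tree k d ≤ k d := by
    intro d
    have h1 := hsuper d
    have h2 := hharm d
    simp only [k, map_sub, map_smul, Pi.sub_apply, Pi.smul_apply, smul_eq_mul]
    rw [h2] at *
    nlinarith
  have hzero : ∀ e, shadow e ⊆ shadow d₀ → k e = 0 := by
    intro e he
    refine shadow_induction hU.tree.isTree (P := fun e => k e = 0) ?_ ?_ he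
    · simp [k, hc, (hpos d₀).ne']
    · intro e f he hef _
      have h1 := hksuper e
      rw [he] at h1
      have h2 := le_transfer hU.tree hk0 hef
      have h3 := hk0 f
      nlinarith
  intro d
  obtain ⟨γ, hγ, hsub⟩ := hU.reaches d₀ d
  have := hzero _ hsub
  rw [hkinv γ hγ] at this
  simpa [k, sub_eq_zero] using this

theorem exists_card_bound (hU : IsUniformLattice Γ) {R : Finset G.Dart}
    (hR : ∀ d, ∃ γ ∈ Γ, mapDart γ d ∈ R) {h : G.Dart → ℝ} (hh : IsInvariantFun Γ h)
    (h1 : ∑ e ∈ R, h e = 1) {l : ℝ}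
    (hl : ∀ d, l * h d ≤ transfer hU.tree h d) :
    l ≤ ∑ d ∈ R, ((succs hU.tree d).card : ℝ) := by
  have hne : R.Nonempty := by
    by_contra hcon
    rw [Finset.not_nonempty_iff_eq_empty.1 hcon] at h1
    simp at h1
  obtain ⟨d₀, hd₀, hmax⟩ := R.exists_max_image h hne
  have hmax' : ∀ d, h d ≤ h d₀ := by
    intro d
    obtain ⟨γ, hγ, hd⟩ := hR d
    rw [← hh γ hγ d]
    exact hmax _ hd
  have hpos : 0 < h d₀ := by
    by_contra hcon
    have : ∑ e ∈ R, h e ≤ 0 := Finset.sum_nonpos fun e _ => (hmax' e).trans (not_lt.1 hcon)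
    linarith
  have h2 : transfer hU.tree h d₀ ≤ (succs hU.tree d₀).card * h d₀ := by
    rw [transfer_apply, ← nsmul_eq_mul]
    exact Finset.sum_le_card_nsmul _ _ _ fun e _ => hmax' e
  have h3 : l ≤ (succs hU.tree d₀).card := le_of_mul_le_mul_right ((hl d₀).trans h2) hpos
  exact h3.trans (Finset.single_le_sum (f := fun d => ((succs hU.tree d).card : ℝ))
    (fun _ _ => Nat.cast_nonneg _) hd₀)

/-- The transfer operator has a positive invariant eigenfunction. The eigenvalue is the largest `l`
for which some invariant `h ≥ 0`, `h ≠ 0` satisfies `l h ≤ L h`: if the inequality were strict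
somewhere, then averaging over paths would make it strict everywhere. -/
theorem exists_eigenfunction (hU : IsUniformLattice Γ) :
    ∃ (l : ℝ) (h : G.Dart → ℝ), 1 ≤ l ∧ IsInvariantFun Γ h ∧ (∀ d, 0 < h d) ∧
      ∀ d, transfer hU.tree h d = l * h d := by
  obtain ⟨R, hR⟩ := hU.finite
  obtain ⟨d₁⟩ := hU.exists_dart
  have hne : R.Nonempty := by
    obtain ⟨γ, -, h⟩ := hR d₁
    exact ⟨_, h⟩
  have hcard : (0 : ℝ) < R.card := Nat.cast_pos.2 hne.card_pos
  let L := transfer hU.tree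
  set M : ℝ := ∑ d ∈ R, ((succs hU.tree d).card : ℝ) with hM
  let K : Set (ℝ × (G.Dart → ℝ)) :=
    (Set.Icc 1 M ×ˢ Set.pi Set.univ fun _ => Set.Icc 0 1) ∩
      ((⋂ γ ∈ Γ, ⋂ d, {p | p.2 (mapDart γ d) = p.2 d}) ∩
      ({p | ∑ e ∈ R, p.2 e = 1} ∩ ⋂ d, {p | p.1 * p.2 d ≤ L p.2 d}))
  have hL : ∀ d, Continuous fun p : ℝ × (G.Dart → ℝ) => L p.2 d := fun d => by
    simp only [L, transfer_apply]
    fun_prop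
  have hK : IsCompact K := by
    refine (isCompact_Icc.prod (isCompact_univ_pi fun _ => isCompact_Icc)).inter_right ?_
    refine IsClosed.inter ?_ (IsClosed.inter ?_ ?_)
    · refine isClosed_biInter fun γ _ => isClosed_iInter fun d => ?_
      exact isClosed_eq (by fun_prop) (by fun_prop)
    · exact isClosed_eq (by fun_prop) (by fun_prop)
    · exact isClosed_iInter fun d => isClosed_le (by fun_prop) (hL d)
  have hmk : ∀ (l : ℝ) (h : G.Dart → ℝ), 1 ≤ l → IsInvariantFun Γ h → (∀ d, 0 ≤ h d) →
      0 < ∑ e ∈ R, h e → (∀ d, l * h d ≤ L h d) →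
      (l, (∑ e ∈ R, h e)⁻¹ • h) ∈ K := by
    intro l h hl hh h0 hsum hle
    set c := (∑ e ∈ R, h e)⁻¹ with hc
    have hcpos : 0 < c := inv_pos.2 hsum
    have hinv := hh.smul c
    have hnn : ∀ d, 0 ≤ (c • h) d := fun d => mul_nonneg hcpos.le (h0 d)
    have hone : ∑ e ∈ R, (c • h) e = 1 := by
      simp only [Pi.smul_apply, smul_eq_mul, ← Finset.mul_sum, hc]
      exact inv_mul_cancel₀ hsum.ne'
    have hle' : ∀ d, l * (c • h) d ≤ L (c • h) d := fun d => by
      simp only [map_smul, Pi.smul_apply, smul_eq_mul]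
      have := mul_le_mul_of_nonneg_left (hle d) hcpos.le
      linarith
    refine ⟨⟨⟨hl, hU.exists_card_bound hR hinv hone hle'⟩, fun d _ => ⟨hnn d, ?_⟩⟩, ?_, hone, ?_⟩
    · exact hone ▸ hinv.le_sum hnn hR d
    · simp only [Set.mem_iInter]
      exact fun γ hγ d => hinv γ hγ d
    · simp only [Set.mem_iInter]
      exact hle'
  have hKne : K.Nonempty := by
    refine ⟨_, hmk 1 (fun _ => 1) le_rfl (fun _ _ _ => rfl) (fun _ => zero_le_one) (by simpa)
      (fun d => ?_)⟩
    obtain ⟨e, he⟩ := hU.tree.exists_isSucc d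
    have := le_transfer hU.tree (h := fun _ => 1) (fun _ => zero_le_one) he
    simpa using this
  obtain ⟨⟨l, h⟩, hmem, hmax⟩ := hK.exists_isMaxOn hKne continuous_fst.continuousOn
  obtain ⟨⟨⟨hl1, -⟩, h01⟩, hinv, hone, hle⟩ := hmem
  simp only [Set.mem_iInter, Set.mem_ofPred_eq] at hinv hone hle hl1
  have h0 : ∀ d, 0 ≤ h d := fun d => (h01 d (Set.mem_univ d)).1
  have hh : IsInvariantFun Γ h := hinv
  have heq : ∀ d, L h d = l * h d := by
    by_contra! hcon
    obtain ⟨e, he⟩ := hcon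
    let k : G.Dart → ℝ := L h - l • h
    have hkinv : IsInvariantFun Γ k := (hh.transfer hU.tree).sub (hh.smul l)
    have hk0 : ∀ d, 0 ≤ k d := fun d => sub_nonneg.2 (hle d)
    have hke : 0 < k e := lt_of_le_of_ne (hk0 e) (by
      simp only [k, Pi.sub_apply, Pi.smul_apply, smul_eq_mul]
      intro h1
      exact he (sub_eq_zero.1 h1.symm))
    obtain ⟨N, hN⟩ := hU.exists_uniform_le_transfer_pow e
    let A : Module.End ℝ (G.Dart → ℝ) := ∑ n ∈ Finset.range (N + 1), L ^ n
    have hA : ∀ (f : G.Dart → ℝ) d, A f d = ∑ n ∈ Finset.range (N + 1), (L ^ n) f d := by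
      intro f d
      simp only [A, LinearMap.sum_apply, Finset.sum_apply]
    have hAnn : ∀ f : G.Dart → ℝ, (∀ d, 0 ≤ f d) → ∀ d, 0 ≤ A f d := by
      intro f hf d
      rw [hA]
      exact Finset.sum_nonneg fun n _ => transfer_pow_nonneg hU.tree hf n d
    have hAinv : IsInvariantFun Γ (A h) := by
      intro γ hγ d
      rw [hA, hA]
      exact Finset.sum_congr rfl fun n _ => hh.transfer_pow hU.tree n γ hγ d
    have hAk : ∀ d, k e ≤ A k d := by
      intro d
      obtain ⟨n, hn, hle⟩ := hN k hkinv hk0 d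
      rw [hA]
      exact hle.trans (Finset.single_le_sum (f := fun n => (L ^ n) k d)
        (fun n _ => transfer_pow_nonneg hU.tree hk0 n d) (Finset.mem_range.2 (by omega)))
    have hcomm : L (A h) = A (L h) := by
      have : L * A = A * L := by
        simp only [A, Finset.mul_sum, Finset.sum_mul, ← pow_succ, ← pow_succ']
      exact LinearMap.congr_fun this h
    have hAh : ∀ d, h d ≤ A h d := by
      intro d
      rw [hA]
      exact Finset.single_le_sum (f := fun n => (L ^ n) h d)
        (fun n _ => transfer_pow_nonneg hU.tree h0 n d) (Finset.mem_range.2 (Nat.succ_pos N))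
    have hsum : 0 < ∑ e ∈ R, A h e := by
      have : ∑ e ∈ R, h e ≤ ∑ e ∈ R, A h e := Finset.sum_le_sum fun d _ => hAh d
      linarith
    -- the gain `k e` at every oriented edge allows a larger eigenvalue
    set ε := k e / ∑ e ∈ R, A h e with hε
    have hεpos : 0 < ε := div_pos hke hsum
    have hnew := hmk (l + ε) (A h) (by linarith) hAinv (hAnn h h0) hsum (fun d => by
      have h1 : A k d = L (A h) d - l * A h d := by
        rw [hcomm]
        simp [k, map_sub, map_smul]
      have h2 := hAk d
      have h3 : ε * A h d ≤ k e := by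
        rw [hε, div_mul_eq_mul_div, div_le_iff₀ hsum]
        exact mul_le_mul_of_nonneg_left (hAinv.le_sum (hAnn h h0) hR d) hke.le
      rw [add_mul]
      linarith)
    have : l + ε ≤ l := hmax hnew
    linarith
  refine ⟨l, h, hl1, hh, fun d => ?_, heq⟩
  have hpow : ∀ n d, (L ^ n) h d = l ^ n * h d := by
    have hLh : L h = l • h := funext heq
    intro n
    induction n with
    | zero => intro d; simp
    | succ n ih =>
      intro d
      rw [pow_succ]
      change (L ^ n) (L h) d = _
      rw [hLh, map_smul, Pi.smul_apply, ih, smul_eq_mul]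
      ring
  obtain ⟨e, -, he⟩ : ∃ e ∈ R, 0 < h e := by
    by_contra! hcon
    have := Finset.sum_nonpos hcon
    linarith
  obtain ⟨N, hN⟩ := hU.exists_uniform_le_transfer_pow e
  obtain ⟨n, -, hn⟩ := hN h hh h0 d
  have h1 := hpow n d
  have h2 : 0 < l ^ n * h d := by
    rw [← h1]
    exact he.trans_le hn
  exact pos_of_mul_pos_right h2 (by positivity)

/-- `h` is a positive invariant eigenfunction of the transfer operator with eigenvalue `exp δ`. -/
structure IsEigenfunction (hU : IsUniformLattice Γ) (δ : ℝ) (h : G.Dart → ℝ) : Prop where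
  invariant : IsInvariantFun Γ h
  pos : ∀ d, 0 < h d
  eigen : ∀ d, ∑ e ∈ succs hU.tree d, h e = Real.exp δ * h d

theorem exists_isEigenfunction (hU : IsUniformLattice Γ) :
    ∃ δ h, hU.IsEigenfunction δ h := by
  obtain ⟨l, h, hl, hinv, hpos, heig⟩ := hU.exists_eigenfunction
  refine ⟨Real.log l, h, hinv, hpos, fun d => ?_⟩
  rw [Real.exp_log (by linarith)]
  exact heig d

theorem IsEigenfunction.harmonic {hU : IsUniformLattice Γ} {δ : ℝ} {h : G.Dart → ℝ}
    (hh : hU.IsEigenfunction δ h) (d : G.Dart) :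
    h d = Real.exp (-δ) * transfer hU.tree h d := by
  rw [transfer_apply, hh.eigen, ← mul_assoc, ← Real.exp_add]
  simp

theorem IsEigenfunction.exists_bounds {hU : IsUniformLattice Γ} {δ : ℝ} {h : G.Dart → ℝ}
    (hh : hU.IsEigenfunction δ h) : ∃ a b, 0 < a ∧ 0 < b ∧ ∀ d, a ≤ h d ∧ h d ≤ b := by
  obtain ⟨R, hR⟩ := hU.finite
  obtain ⟨d₁⟩ := hU.exists_dart
  have hne : R.Nonempty := by
    obtain ⟨γ, -, h⟩ := hR d₁
    exact ⟨_, h⟩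
  obtain ⟨d₀, -, hmin⟩ := R.exists_min_image h hne
  refine ⟨h d₀, ∑ e ∈ R, h e, hh.pos d₀, Finset.sum_pos (fun e _ => hh.pos e) hne, fun d => ⟨?_, ?_⟩⟩
  · obtain ⟨γ, hγ, hd⟩ := hR d
    rw [← hh.invariant γ hγ d]
    exact hmin _ hd
  · exact hh.invariant.le_sum (fun d => (hh.pos d).le) hR d

/-- The exponent is positive because the tree branches. -/
theorem IsEigenfunction.exponent_pos {hU : IsUniformLattice Γ} {δ : ℝ} {h : G.Dart → ℝ}
    (hh : hU.IsEigenfunction δ h) : 0 < δ := by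
  by_contra hδ
  rw [not_lt] at hδ
  have hone : 1 ≤ Real.exp (-δ) := Real.one_le_exp (by linarith)
  -- a constant is superharmonic only if there is no branching
  obtain ⟨R, hR⟩ := hU.finite
  obtain ⟨d, e, f, hde, hdf, hef⟩ := hU.branching
  have hne : R.Nonempty := by
    obtain ⟨γ, -, h⟩ := hR d
    exact ⟨_, h⟩
  obtain ⟨d₀, -, hmin⟩ := R.exists_min_image h hne
  have hmin' : ∀ d, h d₀ ≤ h d := by
    intro d
    obtain ⟨γ, hγ, hd⟩ := hR d
    rw [← hh.invariant γ hγ d]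
    exact hmin _ hd
  have hconst : ∀ e, shadow e ⊆ shadow d₀ → h e = h d₀ := by
    intro e he
    refine shadow_induction hU.tree.isTree (P := fun e => h e = h d₀) rfl ?_ he
    intro e f he hef _
    refine le_antisymm ?_ (hmin' f)
    have h1 := hh.harmonic e
    have h2 := le_transfer hU.tree (fun d => (hh.pos d).le) hef
    have h3 := hh.pos f
    nlinarith
  have hall : ∀ d, h d = h d₀ := by
    intro d
    obtain ⟨γ, hγ, hsub⟩ := hU.reaches d₀ d
    rw [← hh.invariant γ hγ d]
    exact hconst _ hsub
  have h1 := hh.harmonic d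
  have h2 : h e + h f ≤ transfer hU.tree h d := by
    rw [transfer_apply]
    classical
    rw [← Finset.sum_pair hef]
    refine Finset.sum_le_sum_of_subset_of_nonneg ?_ fun e _ _ => (hh.pos e).le
    intro x hx
    rcases Finset.mem_insert.1 hx with rfl | hx
    · exact mem_succs.2 hde
    · rw [Finset.mem_singleton.1 hx]
      exact mem_succs.2 hdf
  rw [hall d] at h1
  rw [hall e, hall f] at h2
  have h3 := hh.pos d₀
  nlinarith

end IsUniformLattice

end Transfer

/-! ### Sums over an orbit -/

section OrbitSums

open scoped ENNReal

variable {V : Type u} {G : SimpleGraph V} {Γ : Subgroup (G ≃g G)}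

theorem shadow_eq (hT : IsLocallyFiniteLeaflessTree G) (d : G.Dart) (z : V) :
    z ∈ shadow d ↔ z = d.snd ∨ ∃ e ∈ succs hT d, z ∈ shadow e := by
  constructor
  · intro hz
    by_cases h : z = d.snd
    · exact Or.inl h
    · obtain ⟨e, he, hze⟩ := exists_isSucc_of_mem_shadow hT.isTree hz h
      exact Or.inr ⟨e, mem_succs.2 he, hze⟩
  · rintro (rfl | ⟨e, he, hz⟩)
    · exact snd_mem_shadow d
    · exact (mem_succs.1 he).shadow_subset hT.isTree hz

theorem indicator_biUnion_shadow {M : Type*} [AddCommMonoid M] (s : Finset G.Dart)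
    (hs : ∀ e ∈ s, ∀ f ∈ s, e ≠ f → Disjoint (shadow e) (shadow f)) (φ : V → M) (z : V) :
    ∑ e ∈ s, (shadow e).indicator φ z = {z | ∃ e ∈ s, z ∈ shadow e}.indicator φ z := by
  by_cases h : ∃ e ∈ s, z ∈ shadow e
  · obtain ⟨e, he, hz⟩ := h
    rw [Finset.sum_eq_single_of_mem e he, Set.indicator_of_mem hz,
      Set.indicator_of_mem (show z ∈ {z | ∃ e ∈ s, z ∈ shadow e} from ⟨e, he, hz⟩)]
    intro f hf hne
    exact Set.indicator_of_notMem
      (fun hzf => Set.disjoint_left.1 (hs f hf e he hne) hzf hz) _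
  · rw [Set.indicator_of_notMem (show z ∉ {z | ∃ e ∈ s, z ∈ shadow e} from h)]
    exact Finset.sum_eq_zero fun e he => Set.indicator_of_notMem (fun hz => h ⟨e, he, hz⟩) _

theorem indicator_shadow {M : Type*} [AddCommMonoid M] (hT : IsLocallyFiniteLeaflessTree G)
    (d : G.Dart) (φ : V → M) (z : V) :
    (shadow d).indicator φ z =
      ({d.snd} : Set V).indicator φ z + ∑ e ∈ succs hT d, (shadow e).indicator φ z := by
  rw [indicator_biUnion_shadow]
  · by_cases h : z = d.snd
    · have h' : z ∉ {z | ∃ e ∈ succs hT d, z ∈ shadow e} := by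
        rintro ⟨e, he, hz⟩
        exact snd_notMem_of_isSucc (mem_succs.1 he) (h ▸ hz)
      rw [Set.indicator_of_mem ((shadow_eq hT d z).2 (Or.inl h)),
        Set.indicator_of_mem (show z ∈ ({d.snd} : Set V) from h), Set.indicator_of_notMem h',
        add_zero]
    · rw [Set.indicator_of_notMem (show z ∉ ({d.snd} : Set V) from h), zero_add]
      by_cases h' : z ∈ shadow d
      · rw [Set.indicator_of_mem h', Set.indicator_of_mem]
        exact ((shadow_eq hT d z).1 h').resolve_left h
      · rw [Set.indicator_of_notMem h', Set.indicator_of_notMem]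
        exact fun h'' => h' ((shadow_eq hT d z).2 (Or.inr h''))
  · exact fun e he f hf hne => (mem_succs.1 he).shadow_disjoint hT.isTree (mem_succs.1 hf) hne

theorem eq_indicator_add_sum_outDarts {M : Type*} [AddCommMonoid M]
    (hT : IsLocallyFiniteLeaflessTree G) (x : V) (φ : V → M) (z : V) :
    φ z = ({x} : Set V).indicator φ z + ∑ e ∈ outDarts hT x, (shadow e).indicator φ z := by
  rw [indicator_biUnion_shadow]
  · by_cases h : z = x
    · have h' : z ∉ {z | ∃ e ∈ outDarts hT x, z ∈ shadow e} := by
        rintro ⟨e, he, hz⟩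
        rw [h, ← mem_outDarts.1 he] at hz
        exact fst_notMem_shadow e hz
      rw [Set.indicator_of_mem (show z ∈ ({x} : Set V) from h), Set.indicator_of_notMem h',
        add_zero]
    · obtain ⟨d, hd, hz⟩ := exists_dart_of_ne hT.isTree h
      rw [Set.indicator_of_notMem (show z ∉ ({x} : Set V) from h), zero_add,
        Set.indicator_of_mem (show z ∈ {z | ∃ e ∈ outDarts hT x, z ∈ shadow e} from
          ⟨d, mem_outDarts.2 hd, hz⟩)]
  · exact fun e he f hf hne => shadow_disjoint_of_ne hT.isTree
      ((mem_outDarts.1 he).trans (mem_outDarts.1 hf).symm) hne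

/-- The sum of a weight of the distance from the origin of `d`, over the points of `O` in the shadow
of `d`. -/
noncomputable def shadowSum (O : Set V) (w : ℕ → ℝ≥0∞) (d : G.Dart) : ℝ≥0∞ :=
  ∑' y, (shadow d).indicator (O.indicator fun y => w (G.dist d.fst y)) y

theorem tsum_indicator_singleton {α : Type*} (x : α) (φ : α → ℝ≥0∞) :
    ∑' y, ({x} : Set α).indicator φ y = φ x := by
  rw [tsum_eq_single x, Set.indicator_of_mem (Set.mem_singleton x)]
  intro y hy
  exact Set.indicator_of_notMem (show y ∉ ({x} : Set α) from hy) φ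

theorem shadowSum_eq (hT : IsLocallyFiniteLeaflessTree G) (O : Set V) (w : ℕ → ℝ≥0∞)
    (d : G.Dart) :
    shadowSum O w d = O.indicator (fun _ => w 1) d.snd +
      ∑ e ∈ succs hT d, shadowSum O (fun n => w (n + 1)) e := by
  unfold shadowSum
  simp_rw [indicator_shadow hT d]
  rw [ENNReal.tsum_add, Summable.tsum_finsetSum (fun _ _ => ENNReal.summable),
    tsum_indicator_singleton]
  congr 1
  · by_cases h : d.snd ∈ O
    · rw [Set.indicator_of_mem h, Set.indicator_of_mem h, SimpleGraph.dist_eq_one_iff_adj.2 d.adj]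
    · rw [Set.indicator_of_notMem h, Set.indicator_of_notMem h]
  · refine Finset.sum_congr rfl fun e he => tsum_congr fun y => ?_
    by_cases hy : y ∈ shadow e
    · rw [Set.indicator_of_mem hy, Set.indicator_of_mem hy]
      have he := mem_succs.1 he
      have h1 : d.fst ∉ shadow e := fun h => fst_notMem_shadow d (he.shadow_subset hT.isTree h)
      have h2 := dist_of_mem_of_notMem hT.isTree hy h1
      rw [he.1, SimpleGraph.dist_eq_one_iff_adj.2 d.adj, add_comm, ← he.1] at h2
      by_cases hO : y ∈ O
      · rw [Set.indicator_of_mem hO, Set.indicator_of_mem hO, h2]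
      · rw [Set.indicator_of_notMem hO, Set.indicator_of_notMem hO]
    · rw [Set.indicator_of_notMem hy, Set.indicator_of_notMem hy]

theorem tsum_orbit_eq (hT : IsLocallyFiniteLeaflessTree G) (O : Set V) (w : ℕ → ℝ≥0∞) (x : V) :
    ∑' y, O.indicator (fun y => w (G.dist x y)) y = O.indicator (fun _ => w 0) x +
      ∑ e ∈ outDarts hT x, shadowSum O w e := by
  rw [tsum_congr (eq_indicator_add_sum_outDarts hT x _), ENNReal.tsum_add,
    Summable.tsum_finsetSum (fun _ _ => ENNReal.summable), tsum_indicator_singleton]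
  congr 1
  · by_cases h : x ∈ O
    · rw [Set.indicator_of_mem h, Set.indicator_of_mem h, SimpleGraph.dist_self]
    · rw [Set.indicator_of_notMem h, Set.indicator_of_notMem h]
  · refine Finset.sum_congr rfl fun e he => ?_
    rw [shadowSum, mem_outDarts.1 he]

theorem shadowSum_const_mul {O : Set V} (c : ℝ≥0∞) (w : ℕ → ℝ≥0∞) (d : G.Dart) :
    shadowSum O (fun n => c * w n) d = c * shadowSum O w d := by
  classical
  unfold shadowSum
  rw [← ENNReal.tsum_mul_left]
  refine tsum_congr fun y => ?_
  rw [Set.indicator_apply, Set.indicator_apply, Set.indicator_apply, Set.indicator_apply]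
  split_ifs <;> simp

theorem smul_mem_vertexOrbit {γ : G ≃g G} (hγ : γ ∈ Γ) {x z : V} :
    γ z ∈ vertexOrbit Γ x ↔ z ∈ vertexOrbit Γ x := by
  constructor
  · rintro ⟨δ, hδ, h⟩
    refine ⟨γ⁻¹ * δ, Γ.mul_mem (Γ.inv_mem hγ) hδ, ?_⟩
    change γ.symm (δ x) = z
    rw [h, γ.symm_apply_apply]
  · rintro ⟨δ, hδ, rfl⟩
    exact ⟨γ * δ, Γ.mul_mem hγ hδ, rfl⟩

theorem shadowSum_mapDart {γ : G ≃g G} (hγ : γ ∈ Γ) (x : V) (w : ℕ → ℝ≥0∞) (d : G.Dart) :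
    shadowSum (vertexOrbit Γ x) w (mapDart γ d) = shadowSum (vertexOrbit Γ x) w d := by
  classical
  unfold shadowSum
  rw [← γ.toEquiv.tsum_eq]
  refine tsum_congr fun y => ?_
  change (shadow (mapDart γ d)).indicator _ (γ y) = _
  have h1 := mem_shadow_mapDart γ (d := d) (z := y)
  have h2 := smul_mem_vertexOrbit hγ (x := x) (z := y)
  simp only [Set.indicator_apply, h1, h2, mapDart_fst, dist_map]

namespace IsUniformLattice

theorem exists_orbit_dist_le (hU : IsUniformLattice Γ) (x : V) :
    ∃ D : ℕ, ∀ d : G.Dart, ∃ y ∈ vertexOrbit Γ x, y ∈ shadow d ∧ G.dist d.fst y ≤ D := by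
  obtain ⟨R, hR⟩ := hU.finite
  have key : ∀ d : G.Dart, ∃ y ∈ vertexOrbit Γ x, y ∈ shadow d := by
    intro d
    obtain ⟨y, hy⟩ := (hU.tree.nontrivial_neighbors x).nonempty
    obtain ⟨γ, hγ, hsub⟩ := hU.reaches d ⟨(y, x), hy.symm⟩
    exact ⟨γ x, ⟨γ, hγ, rfl⟩, hsub (snd_mem_shadow (mapDart γ ⟨(y, x), hy.symm⟩))⟩
  choose y hy hyd using key
  refine ⟨R.sup fun d => G.dist d.fst (y d), fun d => ?_⟩
  obtain ⟨γ, hγ, hd⟩ := hR d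
  refine ⟨γ⁻¹ (y (mapDart γ d)), (smul_mem_vertexOrbit (Γ.inv_mem hγ)).2 (hy _), ?_, ?_⟩
  · have := hyd (mapDart γ d)
    rw [mem_shadow_mapDart'] at this
    exact this
  · refine le_trans (le_of_eq ?_) (Finset.le_sup (f := fun d : G.Dart => G.dist d.fst (y d)) hd)
    rw [← dist_map γ]
    congr 1
    exact γ.apply_symm_apply _

/-- The weight of the Poincaré series. -/
noncomputable def expWeight (s : ℝ) (n : ℕ) : ℝ≥0∞ := ENNReal.ofReal (Real.exp (-s * n))

theorem expWeight_succ (s : ℝ) (n : ℕ) :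
    expWeight s (n + 1) = ENNReal.ofReal (Real.exp (-s)) * expWeight s n := by
  rw [expWeight, expWeight, ← ENNReal.ofReal_mul (Real.exp_pos _).le, ← Real.exp_add]
  push_cast
  ring_nf

theorem shadowSum_expWeight_eq (hU : IsUniformLattice Γ) (O : Set V) (s : ℝ) (d : G.Dart) :
    shadowSum O (expWeight s) d = ENNReal.ofReal (Real.exp (-s)) *
      (O.indicator (fun _ => 1) d.snd +
        ∑ e ∈ succs hU.tree d, shadowSum O (expWeight s) e) := by
  rw [shadowSum_eq hU.tree, mul_add]
  simp_rw [expWeight_succ, shadowSum_const_mul]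
  rw [Finset.mul_sum]
  congr 1
  by_cases h : d.snd ∈ O
  · rw [Set.indicator_of_mem h, Set.indicator_of_mem h]
    simp [expWeight]
  · rw [Set.indicator_of_notMem h, Set.indicator_of_notMem h, mul_zero]

variable {hU : IsUniformLattice Γ} {δ : ℝ} {h : G.Dart → ℝ}

/-- Above the exponent of a positive eigenfunction, the Poincaré series over a shadow is bounded. -/
theorem IsEigenfunction.shadowSum_le (hh : hU.IsEigenfunction δ h) (O : Set V) {s : ℝ}
    (hs : δ < s) : ∃ K : ℝ, ∀ d : G.Dart, shadowSum O (expWeight s) d ≤ ENNReal.ofReal K := by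
  obtain ⟨a, b, ha, hb, hab⟩ := hh.exists_bounds
  classical
  have hgap : 0 < 1 - Real.exp (δ - s) := by
    have : Real.exp (δ - s) < 1 := by rw [Real.exp_lt_one_iff]; linarith
    linarith
  set K := Real.exp (-s) / (a * (1 - Real.exp (δ - s))) with hK
  have hKpos : 0 < K := by positivity
  have hKa : Real.exp (-s) = K * a * (1 - Real.exp (δ - s)) := by
    rw [hK]
    field_simp
  let w : ℕ → ℕ → ℝ≥0∞ := fun R n => if n < R then expWeight s n else 0
  have hw : ∀ R d, shadowSum O (w R) d ≤ ENNReal.ofReal (K * h d) := by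
    intro R
    induction R with
    | zero =>
      intro d
      have : shadowSum O (w 0) d = 0 := by simp [shadowSum, w]
      rw [this]
      exact zero_le
    | succ R ih =>
      intro d
      rw [shadowSum_eq hU.tree]
      have h1 : ∀ e : G.Dart, shadowSum O (fun n => w (R + 1) (n + 1)) e =
          ENNReal.ofReal (Real.exp (-s)) * shadowSum O (w R) e := by
        intro e
        rw [← shadowSum_const_mul]
        congr 1
        funext n
        simp only [w, add_lt_add_iff_right, expWeight_succ]
        split_ifs <;> simp
      have h2 : O.indicator (fun _ => w (R + 1) 1) d.snd ≤ ENNReal.ofReal (Real.exp (-s)) := by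
        refine Set.indicator_apply_le' (fun _ => ?_) (fun _ => zero_le)
        simp only [w]
        split_ifs
        · simp [expWeight]
        · exact zero_le
      have h3 : ∑ e ∈ succs hU.tree d, shadowSum O (fun n => w (R + 1) (n + 1)) e ≤
          ENNReal.ofReal (Real.exp (-s) * (K * (Real.exp δ * h d))) := by
        simp_rw [h1]
        rw [← Finset.mul_sum, ENNReal.ofReal_mul (Real.exp_pos _).le]
        refine mul_le_mul_right ((Finset.sum_le_sum fun e _ => ih e).trans ?_) _
        rw [← ENNReal.ofReal_sum_of_nonneg fun e _ => mul_nonneg hKpos.le (hh.pos e).le,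
          ← Finset.mul_sum, hh.eigen]
      refine (add_le_add h2 h3).trans ?_
      have h4 := hh.pos d
      rw [← ENNReal.ofReal_add (Real.exp_pos _).le (by positivity)]
      refine ENNReal.ofReal_le_ofReal ?_
      have h5 : Real.exp (-s) * (K * (Real.exp δ * h d)) = K * h d * Real.exp (δ - s) := by
        rw [sub_eq_add_neg, Real.exp_add]
        ring
      have h6 := (hab d).1
      rw [h5]
      nlinarith [mul_le_mul_of_nonneg_left h6 (mul_pos hKpos hgap).le]
  refine ⟨K * b, fun d => ?_⟩
  rw [shadowSum, ENNReal.tsum_eq_iSup_sum]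
  refine iSup_le fun F => ?_
  refine le_trans ?_ ((hw (F.sup (fun y => G.dist d.fst y) + 1) d).trans
    (ENNReal.ofReal_le_ofReal (mul_le_mul_of_nonneg_left (hab d).2 hKpos.le)))
  refine le_trans (Finset.sum_le_sum fun y hy => ?_) (ENNReal.sum_le_tsum F)
  have : G.dist d.fst y < F.sup (fun y => G.dist d.fst y) + 1 :=
    Nat.lt_succ_of_le (Finset.le_sup (f := fun y => G.dist d.fst y) hy)
  simp only [w, this, Set.indicator_apply, if_true, le_refl]

/-- The weight which counts points up to distance `R`. -/
noncomputable def countWeight (R n : ℕ) : ℝ≥0∞ := if n ≤ R then 1 else 0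

theorem IsEigenfunction.le_shadowSum_countWeight (hh : hU.IsEigenfunction δ h) (x : V) :
    ∃ c : ℝ, 0 < c ∧ ∃ D : ℕ, ∀ (R : ℕ) (d : G.Dart),
      ENNReal.ofReal (c * Real.exp (δ * R)) ≤
        shadowSum (vertexOrbit Γ x) (countWeight (D + R)) d := by
  obtain ⟨a, b, ha, hb, hab⟩ := hh.exists_bounds
  obtain ⟨D, hD⟩ := hU.exists_orbit_dist_le x
  have key : ∀ (R : ℕ) (d : G.Dart), ENNReal.ofReal (b⁻¹ * Real.exp (δ * R) * h d) ≤
      shadowSum (vertexOrbit Γ x) (countWeight (D + R)) d := by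
    intro R
    induction R with
    | zero =>
      intro d
      obtain ⟨y, hy, hyd, hle⟩ := hD d
      have h1 : b⁻¹ * Real.exp (δ * (0 : ℕ)) * h d ≤ 1 := by
        simp only [Nat.cast_zero, mul_zero, Real.exp_zero, mul_one]
        rw [inv_mul_le_iff₀ hb, mul_one]
        exact (hab d).2
      refine (ENNReal.ofReal_le_one.2 h1).trans ?_
      refine le_trans (le_of_eq ?_) (ENNReal.le_tsum y)
      rw [Set.indicator_of_mem hyd, Set.indicator_of_mem hy, countWeight, add_zero, if_pos hle]
    | succ R ih =>
      intro d
      rw [shadowSum_eq hU.tree]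
      refine le_trans ?_ le_add_self
      have h1 : ∀ n, countWeight (D + (R + 1)) (n + 1) = countWeight (D + R) n := fun n => by
        simp only [countWeight, ← add_assoc, add_le_add_iff_right]
      simp_rw [h1]
      refine le_trans ?_ (Finset.sum_le_sum fun e _ => ih e)
      rw [← ENNReal.ofReal_sum_of_nonneg fun e _ => by
        have := hh.pos e
        positivity]
      rw [← Finset.mul_sum, hh.eigen]
      refine ENNReal.ofReal_le_ofReal (le_of_eq ?_)
      push_cast
      rw [mul_add, Real.exp_add, mul_one]
      ring
  refine ⟨b⁻¹ * a, by positivity, D, fun R d => le_trans (ENNReal.ofReal_le_ofReal ?_) (key R d)⟩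
  have := (hab d).1
  have h2 : 0 < b⁻¹ * Real.exp (δ * R) := by positivity
  nlinarith

theorem orbitCount_eq (hU : IsUniformLattice Γ) (x₀ x : V) (R : ℕ) :
    (orbitCount Γ x₀ x R : ℝ≥0∞) =
      ∑' y, (vertexOrbit Γ x).indicator (fun y => countWeight R (G.dist x₀ y)) y := by
  classical
  have hfin : {y | y ∈ vertexOrbit Γ x ∧ G.dist y x₀ ≤ R}.Finite :=
    (finite_closedBall hU.tree x₀ R).subset fun y hy => hy.2
  have h1 : ∀ y, (vertexOrbit Γ x).indicator (fun y => countWeight R (G.dist x₀ y)) y =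
      {y | y ∈ vertexOrbit Γ x ∧ G.dist y x₀ ≤ R}.indicator (fun _ => 1) y := by
    intro y
    simp only [Set.indicator_apply, countWeight, Set.mem_ofPred_eq, G.dist_comm (u := x₀), ite_and]
  rw [tsum_congr h1, ← tsum_subtype, ENNReal.tsum_set_one, orbitCount,
    ← hfin.cast_ncard_eq]
  simp

/-- The exponent of a positive eigenfunction is the exponential growth rate of every orbit. -/
theorem IsEigenfunction.criticalExponent_eq (hh : hU.IsEigenfunction δ h) (x₀ x : V) :
    criticalExponent Γ x₀ x = δ := by
  obtain ⟨c, hc, D, hlow⟩ := hh.le_shadowSum_countWeight x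
  obtain ⟨d₀, hd₀⟩ : ∃ d : G.Dart, d.fst = x₀ := by
    obtain ⟨y, hy⟩ := (hU.tree.nontrivial_neighbors x₀).nonempty
    exact ⟨⟨(x₀, y), hy⟩, rfl⟩
  have hlow' : ∀ R : ℕ, c * Real.exp (δ * R) ≤ orbitCount Γ x₀ x (D + R) := by
    intro R
    have h1 : ENNReal.ofReal (c * Real.exp (δ * R)) ≤ (orbitCount Γ x₀ x (D + R) : ℝ≥0∞) := by
      rw [orbitCount_eq hU, tsum_orbit_eq hU.tree]
      refine (hlow R d₀).trans (le_trans ?_ le_add_self)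
      exact Finset.single_le_sum (f := fun e => shadowSum (vertexOrbit Γ x) (countWeight (D + R)) e)
        (fun _ _ => zero_le) (mem_outDarts.2 hd₀)
    rw [← ENNReal.ofReal_natCast] at h1
    exact (ENNReal.ofReal_le_ofReal_iff (Nat.cast_nonneg _)).1 h1
  have hδ := hh.exponent_pos
  have hup : ∀ s, δ < s → ∃ K : ℝ, 0 < K ∧ ∀ R : ℕ,
      (orbitCount Γ x₀ x R : ℝ) ≤ K * Real.exp (s * R) := by
    intro s hs
    obtain ⟨K, hK⟩ := hh.shadowSum_le (vertexOrbit Γ x) hs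
    refine ⟨1 + (outDarts hU.tree x₀).card * max K 0, by positivity, fun R => ?_⟩
    have h1 : (orbitCount Γ x₀ x R : ℝ≥0∞) ≤ ENNReal.ofReal (Real.exp (s * R)) *
        ENNReal.ofReal (1 + (outDarts hU.tree x₀).card * max K 0) := by
      have h2 : ∀ n, countWeight R n ≤ ENNReal.ofReal (Real.exp (s * R)) * expWeight s n := by
        intro n
        rw [countWeight, expWeight, ← ENNReal.ofReal_mul (Real.exp_pos _).le, ← Real.exp_add]
        split_ifs with hn
        · rw [← ENNReal.ofReal_one]
          refine ENNReal.ofReal_le_ofReal (Real.one_le_exp ?_)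
          have : (n : ℝ) ≤ R := Nat.cast_le.2 hn
          nlinarith
        · exact zero_le
      rw [orbitCount_eq hU]
      refine (ENNReal.tsum_le_tsum fun y => Set.indicator_le_indicator
        (g := fun y => ENNReal.ofReal (Real.exp (s * R)) * expWeight s (G.dist x₀ y)) (h2 _)).trans ?_
      rw [tsum_orbit_eq hU.tree _ (fun n => ENNReal.ofReal (Real.exp (s * R)) * expWeight s n)]
      simp_rw [shadowSum_const_mul]
      rw [← Finset.mul_sum, ENNReal.ofReal_add zero_le_one (by positivity), mul_add]
      refine add_le_add ?_ (mul_le_mul_right ?_ _)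
      · refine Set.indicator_apply_le' (fun _ => ?_) (fun _ => zero_le)
        simp [expWeight]
      · rw [ENNReal.ofReal_mul (Nat.cast_nonneg _), ENNReal.ofReal_natCast, ← nsmul_eq_mul]
        exact Finset.sum_le_card_nsmul _ _ _ fun e _ =>
          (hK e).trans (ENNReal.ofReal_le_ofReal (le_max_left _ _))
    rw [← ENNReal.ofReal_natCast, ← ENNReal.ofReal_mul (Real.exp_pos _).le] at h1
    have h2 := (ENNReal.ofReal_le_ofReal_iff (by positivity)).1 h1
    linarith
  refine Tendsto.limsup_eq (tendsto_order.2 ⟨fun s hs => ?_, fun s hs => ?_⟩)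
  · -- lower bound
    have h1 : Tendsto (fun R : ℕ => (δ - s) * R) atTop atTop :=
      tendsto_natCast_atTop_atTop.const_mul_atTop (by linarith)
    filter_upwards [h1.eventually_gt_atTop (δ * D - Real.log c), eventually_gt_atTop 0,
      eventually_ge_atTop D] with R hR hR0 hRD
    obtain ⟨k, rfl⟩ := Nat.exists_eq_add_of_le hRD
    have hR0' : (0 : ℝ) < ((D + k : ℕ) : ℝ) := Nat.cast_pos.2 hR0
    have h2 := Real.log_le_log (by positivity) (hlow' k)
    rw [Real.log_mul hc.ne' (Real.exp_pos _).ne', Real.log_exp] at h2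
    rw [one_div, inv_mul_eq_div, lt_div_iff₀ hR0']
    push_cast at *
    linarith
  · obtain ⟨s', hs', hss⟩ := exists_between hs
    obtain ⟨K, hK, hKR⟩ := hup s' hs'
    have h1 : Tendsto (fun R : ℕ => (s - s') * R) atTop atTop :=
      tendsto_natCast_atTop_atTop.const_mul_atTop (by linarith)
    filter_upwards [h1.eventually_gt_atTop (Real.log K), eventually_gt_atTop 0,
      eventually_ge_atTop D] with R hR hR0 hRD
    obtain ⟨k, rfl⟩ := Nat.exists_eq_add_of_le hRD
    have hR0' : (0 : ℝ) < ((D + k : ℕ) : ℝ) := Nat.cast_pos.2 hR0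
    have h3 : (0 : ℝ) < orbitCount Γ x₀ x (D + k) :=
      lt_of_lt_of_le (by positivity) (hlow' k)
    have h2 := Real.log_le_log h3 (hKR _)
    rw [Real.log_mul hK.ne' (Real.exp_pos _).ne', Real.log_exp] at h2
    rw [one_div, inv_mul_eq_div, div_lt_iff₀ hR0']
    linarith

end IsUniformLattice

end OrbitSums

/-! ### Poincaré series near the critical exponent -/

section Poincare

open scoped ENNReal

variable {V : Type u} {G : SimpleGraph V} {Γ : Subgroup (G ≃g G)}

namespace IsUniformLattice

/-- The Poincaré series of the orbit of `x` over the shadow of `d`, as seen from the origin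
of `d`. -/
noncomputable def poincare (Γ : Subgroup (G ≃g G)) (x : V) (s : ℝ) (d : G.Dart) : ℝ :=
  (shadowSum (vertexOrbit Γ x) (expWeight s) d).toReal

/-- The Poincaré series of the orbit of `x`, as seen from `x₀`. -/
noncomputable def poincareTotal (Γ : Subgroup (G ≃g G)) (x₀ x : V) (s : ℝ) : ℝ :=
  (∑' y, (vertexOrbit Γ x).indicator (fun y => expWeight s (G.dist x₀ y)) y).toReal

theorem poincare_nonneg (x : V) (s : ℝ) (d : G.Dart) : 0 ≤ poincare Γ x s d :=
  ENNReal.toReal_nonneg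

theorem poincare_mapDart {γ : G ≃g G} (hγ : γ ∈ Γ) (x : V) (s : ℝ) (d : G.Dart) :
    poincare Γ x s (mapDart γ d) = poincare Γ x s d := by
  rw [poincare, shadowSum_mapDart hγ, poincare]

variable {hU : IsUniformLattice Γ} {δ : ℝ} {h : G.Dart → ℝ}

theorem IsEigenfunction.shadowSum_ne_top (hh : hU.IsEigenfunction δ h) (O : Set V) {s : ℝ}
    (hs : δ < s) (d : G.Dart) : shadowSum O (expWeight s) d ≠ ∞ := by
  obtain ⟨K, hK⟩ := hh.shadowSum_le O hs
  exact ne_top_of_le_ne_top ENNReal.ofReal_ne_top (hK d)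

theorem IsEigenfunction.poincare_eq (hh : hU.IsEigenfunction δ h) (x : V) {s : ℝ}
    (hs : δ < s) (d : G.Dart) :
    poincare Γ x s d = Real.exp (-s) * ((vertexOrbit Γ x).indicator (fun _ => 1) d.snd +
      ∑ e ∈ succs hU.tree d, poincare Γ x s e) := by
  classical
  rw [poincare, hU.shadowSum_expWeight_eq, ENNReal.toReal_mul,
    ENNReal.toReal_ofReal (Real.exp_pos _).le, ENNReal.toReal_add,
    ENNReal.toReal_sum fun e _ => hh.shadowSum_ne_top _ hs e]
  · congr 2
    rw [Set.indicator_apply, Set.indicator_apply]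
    split_ifs <;> simp
  · rw [Set.indicator_apply]
    split_ifs <;> simp
  · exact ENNReal.sum_ne_top.2 fun e _ => hh.shadowSum_ne_top _ hs e

theorem IsEigenfunction.tsum_ne_top (hh : hU.IsEigenfunction δ h) (x₀ x : V) {s : ℝ}
    (hs : δ < s) :
    ∑' y, (vertexOrbit Γ x).indicator (fun y => expWeight s (G.dist x₀ y)) y ≠ ∞ := by
  classical
  rw [tsum_orbit_eq hU.tree _ (expWeight s)]
  refine ENNReal.add_ne_top.2 ⟨?_, ENNReal.sum_ne_top.2 fun e _ => hh.shadowSum_ne_top _ hs e⟩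
  rw [Set.indicator_apply]
  split_ifs <;> simp [expWeight]

theorem IsEigenfunction.poincareTotal_eq (hh : hU.IsEigenfunction δ h) (x₀ x : V) {s : ℝ}
    (hs : δ < s) :
    poincareTotal Γ x₀ x s = (vertexOrbit Γ x).indicator (fun _ => 1) x₀ +
      ∑ e ∈ outDarts hU.tree x₀, poincare Γ x s e := by
  classical
  rw [poincareTotal, tsum_orbit_eq hU.tree _ (expWeight s), ENNReal.toReal_add,
    ENNReal.toReal_sum fun e _ => hh.shadowSum_ne_top _ hs e]
  · congr 1
    rw [Set.indicator_apply, Set.indicator_apply]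
    split_ifs <;> simp [expWeight]
  · rw [Set.indicator_apply]
    split_ifs <;> simp [expWeight]
  · exact ENNReal.sum_ne_top.2 fun e _ => hh.shadowSum_ne_top _ hs e

theorem indicator_one_nonneg (O : Set V) (z : V) : 0 ≤ O.indicator (fun _ => (1 : ℝ)) z :=
  Set.indicator_nonneg (fun _ _ => zero_le_one) z

/-- Each Poincaré series over a shadow is dominated by the Poincaré series of the whole orbit. -/
theorem IsEigenfunction.exists_le_poincareTotal (hh : hU.IsEigenfunction δ h) (x₀ x : V)
    (d : G.Dart) :
    ∃ n : ℕ, ∀ s, δ < s → Real.exp (-s * n) * poincare Γ x s d ≤ poincareTotal Γ x₀ x s := by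
  obtain ⟨y, hy⟩ := (hU.tree.nontrivial_neighbors x₀).nonempty
  let d₀ : G.Dart := ⟨(x₀, y), hy⟩
  obtain ⟨γ, hγ, hsub⟩ := hU.reaches d₀ d
  have key : ∃ n : ℕ, ∀ s, δ < s →
      Real.exp (-s * n) * poincare Γ x s (mapDart γ d) ≤ poincare Γ x s d₀ := by
    refine shadow_induction hU.tree.isTree (P := fun e => ∃ n : ℕ, ∀ s, δ < s →
      Real.exp (-s * n) * poincare Γ x s e ≤ poincare Γ x s d₀) ⟨0, fun s _ => by simp⟩ ?_ hsub
    rintro e f ⟨n, hn⟩ hef -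
    refine ⟨n + 1, fun s hs => le_trans ?_ (hn s hs)⟩
    rw [hh.poincare_eq x hs e]
    have h1 : poincare Γ x s f ≤ ∑ e ∈ succs hU.tree e, poincare Γ x s e :=
      Finset.single_le_sum (fun e _ => poincare_nonneg x s e) (mem_succs.2 hef)
    have h2 := indicator_one_nonneg (vertexOrbit Γ x) e.snd
    push_cast
    rw [mul_add, Real.exp_add, mul_one, mul_assoc]
    gcongr
    linarith
  obtain ⟨n, hn⟩ := key
  refine ⟨n, fun s hs => ?_⟩
  rw [← poincare_mapDart hγ]
  refine (hn s hs).trans ?_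
  rw [hh.poincareTotal_eq x₀ x hs]
  have h1 : poincare Γ x s d₀ ≤ ∑ e ∈ outDarts hU.tree x₀, poincare Γ x s e :=
    Finset.single_le_sum (fun e _ => poincare_nonneg x s e) (mem_outDarts.2 rfl)
  have h2 := indicator_one_nonneg (vertexOrbit Γ x) x₀
  linarith

theorem exists_dart_snd_eq (hU : IsUniformLattice Γ) (x : V) : ∃ d : G.Dart, d.snd = x := by
  obtain ⟨y, hy⟩ := (hU.tree.nontrivial_neighbors x).nonempty
  exact ⟨⟨(y, x), hy.symm⟩, rfl⟩

theorem mem_vertexOrbit_self (x : V) : x ∈ vertexOrbit Γ x := ⟨1, Γ.one_mem, rfl⟩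

theorem IsEigenfunction.exists_exp_le_poincareTotal (hh : hU.IsEigenfunction δ h) (x₀ x : V) :
    ∃ n : ℕ, ∀ s, δ < s → Real.exp (-s * n) ≤ poincareTotal Γ x₀ x s := by
  obtain ⟨d, hd⟩ := hU.exists_dart_snd_eq x
  obtain ⟨n, hn⟩ := hh.exists_le_poincareTotal x₀ x d
  refine ⟨n + 1, fun s hs => le_trans ?_ (hn s hs)⟩
  rw [hh.poincare_eq x hs d, hd, Set.indicator_of_mem (mem_vertexOrbit_self x)]
  have h1 : 0 ≤ ∑ e ∈ succs hU.tree d, poincare Γ x s e :=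
    Finset.sum_nonneg fun e _ => poincare_nonneg x s e
  push_cast
  rw [mul_add, Real.exp_add, mul_one]
  gcongr
  nlinarith [Real.exp_pos (-s)]

theorem IsEigenfunction.poincareTotal_pos (hh : hU.IsEigenfunction δ h) (x₀ x : V) {s : ℝ}
    (hs : δ < s) : 0 < poincareTotal Γ x₀ x s := by
  obtain ⟨n, hn⟩ := hh.exists_exp_le_poincareTotal x₀ x
  exact (Real.exp_pos _).trans_le (hn s hs)

/-- As `s` decreases to the critical exponent, the Poincaré series diverges, and its shadow parts
become proportional to the eigenfunction: by compactness it suffices to look at limit points, and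
these are superharmonic, so that the minimum principle applies. -/
theorem IsEigenfunction.tendsto_poincare (hh : hU.IsEigenfunction δ h) (x₀ x : V) :
    Tendsto (fun s => (poincareTotal Γ x₀ x s)⁻¹) (𝓝[>] δ) (𝓝 0) ∧
      ∀ d, Tendsto (fun s => poincare Γ x s d / poincareTotal Γ x₀ x s) (𝓝[>] δ)
        (𝓝 (h d / ∑ e ∈ outDarts hU.tree x₀, h e)) := by
  set O := vertexOrbit Γ x with hO
  set Z := ∑ e ∈ outDarts hU.tree x₀, h e with hZ
  have hδ := hh.exponent_pos
  have hpos : ∀ᶠ s in 𝓝[>] δ, δ < s := eventually_mem_nhdsWithin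
  have hlt : ∀ᶠ s in 𝓝[>] δ, s < δ + 1 :=
    eventually_nhdsWithin_of_eventually_nhds (eventually_lt_nhds (by linarith))
  choose n hn using hh.exists_le_poincareTotal x₀ x
  obtain ⟨m, hm⟩ := hh.exists_exp_le_poincareTotal x₀ x
  let p : ℝ → ℝ × (G.Dart → ℝ) := fun s =>
    ((poincareTotal Γ x₀ x s)⁻¹, fun d => poincare Γ x s d / poincareTotal Γ x₀ x s)
  let K : Set (ℝ × (G.Dart → ℝ)) := Set.Icc 0 (Real.exp ((δ + 1) * m)) ×ˢ
    Set.pi Set.univ fun d => Set.Icc 0 (Real.exp ((δ + 1) * n d))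
  have hexp : ∀ {s : ℝ} (k : ℕ), s < δ + 1 → 1 ≤ Real.exp (-s * k) * Real.exp ((δ + 1) * k) := by
    intro s k hs
    rw [← Real.exp_add]
    have : (0 : ℝ) ≤ k := Nat.cast_nonneg k
    exact Real.one_le_exp (by nlinarith)
  have hpK : ∀ᶠ s in 𝓝[>] δ, p s ∈ K := by
    filter_upwards [hpos, hlt] with s hs hs1
    have hT := hh.poincareTotal_pos x₀ x hs
    refine ⟨⟨(inv_pos.2 hT).le, ?_⟩, fun d _ => ⟨div_nonneg (poincare_nonneg x s d) hT.le, ?_⟩⟩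
    · rw [inv_le_iff_one_le_mul₀ hT]
      have h1 := mul_le_mul_of_nonneg_right (hm s hs) (Real.exp_pos ((δ + 1) * m)).le
      linarith [hexp m hs1]
    · rw [div_le_iff₀ hT]
      have h1 := mul_le_mul_of_nonneg_left (hn d s hs) (Real.exp_pos ((δ + 1) * n d)).le
      have h2 := mul_le_mul_of_nonneg_right (hexp (n d) hs1) (poincare_nonneg (Γ := Γ) x s d)
      linarith
  have hlim : Tendsto p (𝓝[>] δ) (𝓝 (0, fun d => h d / Z)) := by
    have hK : IsCompact K := isCompact_Icc.prod (isCompact_univ_pi fun _ => isCompact_Icc)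
    refine hK.tendsto_nhds_of_unique_mapClusterPt hpK ?_
    rintro ⟨τ, g⟩ hτg hcl
    obtain ⟨U, hUle, hUp⟩ := mapClusterPt_iff_ultrafilter.1 hcl
    have hU1 : Tendsto (fun s => (poincareTotal Γ x₀ x s)⁻¹) U (𝓝 τ) :=
      (continuous_fst.tendsto _).comp hUp
    have hU2 : ∀ d, Tendsto (fun s => poincare Γ x s d / poincareTotal Γ x₀ x s) U (𝓝 (g d)) :=
      fun d => (((continuous_apply d).comp continuous_snd).tendsto _).comp hUp
    have hUs : Tendsto (fun s : ℝ => s) U (𝓝 δ) :=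
      tendsto_id.mono_left (hUle.trans nhdsWithin_le_nhds)
    have hτ : 0 ≤ τ := hτg.1.1
    have hrec : ∀ d, g d = Real.exp (-δ) * (O.indicator (fun _ => 1) d.snd * τ +
        ∑ e ∈ succs hU.tree d, g e) := by
      intro d
      refine tendsto_nhds_unique (hU2 d) ?_
      have h1 : Tendsto (fun s => Real.exp (-s) * (O.indicator (fun _ => 1) d.snd *
          (poincareTotal Γ x₀ x s)⁻¹ + ∑ e ∈ succs hU.tree d,
            poincare Γ x s e / poincareTotal Γ x₀ x s)) U
          (𝓝 (Real.exp (-δ) * (O.indicator (fun _ => 1) d.snd * τ +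
            ∑ e ∈ succs hU.tree d, g e))) :=
        ((Real.continuous_exp.tendsto _).comp hUs.neg).mul
          ((hU1.const_mul _).add (tendsto_finsetSum _ fun e _ => hU2 e))
      refine h1.congr' ?_
      filter_upwards [hUle hpos] with s hs
      rw [hh.poincare_eq x hs d, ← Finset.sum_div, div_eq_mul_inv, div_eq_mul_inv]
      ring
    have htot : O.indicator (fun _ => 1) x₀ * τ + ∑ e ∈ outDarts hU.tree x₀, g e = 1 := by
      refine tendsto_nhds_unique ((hU1.const_mul _).add
        (tendsto_finsetSum _ fun e _ => hU2 e)) ?_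
      refine tendsto_const_nhds.congr' ?_
      filter_upwards [hUle hpos] with s hs
      have hT := (hh.poincareTotal_pos x₀ x hs).ne'
      rw [← Finset.sum_div, ← div_eq_mul_inv, ← add_div, eq_div_iff hT, one_mul,
        hh.poincareTotal_eq x₀ x hs]
    have hginv : IsInvariantFun Γ g := fun γ hγ d => by
      refine tendsto_nhds_unique (hU2 _) ((hU2 d).congr fun s => ?_)
      rw [poincare_mapDart hγ]
    have hind : ∀ z, 0 ≤ O.indicator (fun _ => (1 : ℝ)) z := indicator_one_nonneg O
    obtain ⟨c, hc⟩ := hU.eq_mul_of_superharmonic (Real.exp_pos (-δ)) hh.invariant hginv hh.pos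
      hh.harmonic (fun d => by
        rw [hrec d, transfer_apply]
        have := mul_nonneg (hind d.snd) hτ
        have := Real.exp_pos (-δ)
        nlinarith)
    have hτ0 : τ = 0 := by
      obtain ⟨d, hd⟩ := hU.exists_dart_snd_eq x
      have h1 := hrec d
      have h2 := hh.harmonic d
      rw [hd, hO, Set.indicator_of_mem (mem_vertexOrbit_self x), hc d,
        Finset.sum_congr rfl fun e _ => hc e, ← Finset.mul_sum] at h1
      rw [transfer_apply] at h2
      have h3 : c * h d = c * (Real.exp (-δ) * ∑ e ∈ succs hU.tree d, h e) := by rw [← h2]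
      have h4 : Real.exp (-δ) * τ = 0 := by linarith
      exact (mul_eq_zero.1 h4).resolve_left (Real.exp_pos _).ne'
    have hcZ : c * Z = 1 := by
      rw [hτ0, mul_zero, zero_add, Finset.sum_congr rfl fun e _ => hc e, ← Finset.mul_sum] at htot
      exact htot
    have hZ0 : Z ≠ 0 := right_ne_zero_of_mul_eq_one hcZ
    refine Prod.ext hτ0 (funext fun d => ?_)
    change g d = h d / Z
    rw [hc d, eq_div_iff hZ0]
    linear_combination h d * hcZ
  exact ⟨(continuous_fst.tendsto _).comp hlim,
    fun d => (((continuous_apply d).comp continuous_snd).tendsto _).comp hlim⟩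

end IsUniformLattice

end Poincare

/-! ### Visual measures -/

section Visual

open scoped ENNReal

variable {V : Type u} {W : Type v} {G : SimpleGraph V} {H : SimpleGraph W}
  {Γ : Subgroup (G ≃g G)}

/-- The measure `μ` on the boundary is the visual measure with base vertex `x`, dimension `δ` and
density `h`: its value on `U(d)`, for `d` pointing away from `x`, decays exponentially with the
distance of `d` from `x`. -/
def IsVisual (δ : ℝ) (h : G.Dart → ℝ) (x : V) (μ : Measure (Boundary G)) : Prop :=
  ∀ d : G.Dart, x ∉ shadow d →
    μ (endShadow d) = ENNReal.ofReal (Real.exp (-δ * G.dist x d.fst) * h d)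

theorem notMem_of_subset {x : V} {d e : G.Dart} (hx : x ∉ shadow d) (h : shadow e ⊆ shadow d) :
    x ∉ shadow e := fun hxe => hx (h hxe)

theorem dist_fst_of_shadow_subset (hG : G.IsTree) {x : V} {d e : G.Dart} (hx : x ∉ shadow d)
    (h : shadow e ⊆ shadow d) : G.dist x e.fst = G.dist x d.fst + G.dist d.fst e.fst := by
  have h1 := dist_snd_of_notMem hG (notMem_of_subset hx h)
  have h2 := dist_snd_of_notMem hG (notMem_of_subset (fst_notMem_shadow d) h)
  have h3 := dist_of_mem_of_notMem hG (h (snd_mem_shadow e)) hx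
  omega

theorem exists_notMem_shadow_dart (hG : G.IsTree) (r : Ray G) (x : V) :
    ∃ N, ∀ n, N ≤ n → x ∉ shadow (r.dart n) := by
  refine ⟨G.dist (r.toFun 0) x + 1, fun n hn h => ?_⟩
  have h1 := dist_of_mem_of_notMem hG h (r.notMem_shadow (Nat.zero_le n))
  have h2 : G.dist (r.toFun 0) (r.dart n).fst = n := r.dist_eq 0 n (Nat.zero_le n)
  omega

theorem exists_dart_away (hG : G.IsTree) (x y : V) (ξ : Boundary G) :
    ∃ d : G.Dart, ξ ∈ endShadow d ∧ x ∉ shadow d ∧ y ∉ shadow d := by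
  obtain ⟨r, hr⟩ := _root_.Quotient.exists_rep ξ
  obtain ⟨N, hN⟩ := exists_notMem_shadow_dart hG r x
  obtain ⟨M, hM⟩ := exists_notMem_shadow_dart hG r y
  exact ⟨r.dart (max N M), Ray.Represents.mem_endShadow hr _, hN _ (le_max_left _ _),
    hM _ (le_max_right _ _)⟩

/-- Visual measures with proportional densities are locally proportional, with the factor by which
the base vertices are at different distances. -/
theorem IsVisual.measure_eq (hT : IsLocallyFiniteLeaflessTree G) {δ c : ℝ} (hc : 0 ≤ c)
    {h k : G.Dart → ℝ} (hk : ∀ d, k d = c * h d) {x y : V} {μ ν : Measure (Boundary G)}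
    [IsFiniteMeasure μ] (hμ : IsVisual δ h x μ) (hν : IsVisual δ k y ν) [IsFiniteMeasure ν]
    {d : G.Dart} (hx : x ∉ shadow d) (hy : y ∉ shadow d) {B : Set (Boundary G)}
    (hB : MeasurableSet B) (hBd : B ⊆ endShadow d) :
    ν B = ENNReal.ofReal (c * Real.exp (δ * (G.dist x d.fst - G.dist y d.fst))) * μ B := by
  rw [← smul_eq_mul, ← Measure.smul_apply]
  refine measure_eq_of_subset_endShadow hT (fun e he => ?_) hB hBd
  rw [Measure.smul_apply, smul_eq_mul, hμ e (notMem_of_subset hx he),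
    hν e (notMem_of_subset hy he), ← ENNReal.ofReal_mul (by positivity), hk,
    dist_fst_of_shadow_subset hT.isTree hx he, dist_fst_of_shadow_subset hT.isTree hy he]
  congr 1
  push_cast
  rw [mul_assoc c, ← mul_assoc (Real.exp _) (Real.exp _), ← Real.exp_add, mul_left_comm]
  ring_nf

theorem IsVisual.map {δ : ℝ} {h : H.Dart → ℝ} {y : W} {μ : Measure (Boundary H)}
    (hμ : IsVisual δ h y μ) (F : G ≃g H) :
    IsVisual δ (fun d => h (mapDart F d)) (F.symm y) (μ.map (boundaryMapIso F.symm)) := by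
  intro d hd
  have hmeas : Measurable (boundaryMapIso F.symm) := (boundaryHomeo F).symm.continuous.measurable
  rw [Measure.map_apply hmeas (measurableSet_endShadow d)]
  have h1 : boundaryMapIso F.symm ⁻¹' endShadow d = endShadow (mapDart F d) := by
    ext ξ
    rw [Set.mem_preimage, ← mem_endShadow_mapDart F, boundaryMapIso_apply_symm]
  rw [h1, hμ _ (fun h' => hd ((mem_shadow_mapDart' F).1 h'))]
  congr 4
  rw [mapDart_fst, ← iso_dist F, F.apply_symm_apply]

/-! ### Projections and the dilatation -/

theorem exists_isProjection (hG : G.IsTree) (a b : V) (ξ : Boundary G) :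
    ∃ p, IsProjection G a b ξ p := by
  classical
  have hr := rayTo_represents hG a ξ
  have h0 := rayTo_zero hG a ξ
  generalize rayTo hG a ξ = r at hr h0
  have hdist : ∀ n, G.dist a (r.toFun n) = n := fun n => by
    rw [← h0, r.dist_eq 0 n (Nat.zero_le n), Nat.sub_zero]
  let P : ℕ → Prop := fun n => G.dist a (r.toFun n) + G.dist (r.toFun n) b = G.dist a b
  have hP : P (Nat.findGreatest P (G.dist a b)) := by
    refine Nat.findGreatest_spec (Nat.zero_le _) ?_
    change G.dist a (r.toFun 0) + G.dist (r.toFun 0) b = G.dist a b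
    rw [h0, SimpleGraph.dist_self, zero_add]
  refine ⟨r.toFun (Nat.findGreatest P (G.dist a b)), hP,
    r.drop (Nat.findGreatest P (G.dist a b)), hr.drop (Nat.findGreatest P (G.dist a b)), ?_, ?_⟩
  · simp [Ray.drop]
  · intro n hn
    by_contra hne
    refine Nat.findGreatest_is_greatest (P := P)
      (show Nat.findGreatest P (G.dist a b) < n + Nat.findGreatest P (G.dist a b) by omega) ?_ hn
    have h1 : G.dist a ((r.drop (Nat.findGreatest P (G.dist a b))).toFun n) = _ := hdist _
    omega

theorem IsProjection.dist_sub (hG : G.IsTree) {a b p : V} {ξ : Boundary G}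
    (hp : IsProjection G a b ξ p) {d : G.Dart} (hξ : ξ ∈ endShadow d) (ha : a ∉ shadow d)
    (hb : b ∉ shadow d) :
    (G.dist a p : ℝ) - G.dist p b = G.dist a d.fst - G.dist b d.fst := by
  obtain ⟨hseg, r, hr, h0, honly⟩ := hp
  have hstep : G.dist (r.toFun 0) (r.toFun 1) = 1 := r.dist_eq 0 1 zero_le_one
  have haway : a ∉ shadow (r.dart 0) ∧ b ∉ shadow (r.dart 0) := by
    have h1 : G.dist a b ≤ G.dist a (r.toFun 1) + G.dist (r.toFun 1) b :=
      hG.connected.dist_triangle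
    have h2 : G.dist a (r.toFun 1) ≤ G.dist a (r.toFun 0) + G.dist (r.toFun 0) (r.toFun 1) :=
      hG.connected.dist_triangle
    have h3 : G.dist (r.toFun 1) b ≤ G.dist (r.toFun 1) (r.toFun 0) + G.dist (r.toFun 0) b :=
      hG.connected.dist_triangle
    have h4 : G.dist a (r.toFun 1) + G.dist (r.toFun 1) b ≠ G.dist a b :=
      fun h => one_ne_zero (honly 1 h)
    rw [G.dist_comm (u := r.toFun 1) (v := r.toFun 0)] at h3
    rw [← h0] at hseg
    constructor
    · intro h
      have h5 : G.dist a (r.toFun 0) = G.dist a (r.toFun 1) + 1 :=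
        dist_eq_of_mem_basicSet hG (r.adj 0) h
      omega
    · intro h
      have h5 : G.dist b (r.toFun 0) = G.dist b (r.toFun 1) + 1 :=
        dist_eq_of_mem_basicSet hG (r.adj 0) h
      rw [G.dist_comm (u := b) (v := r.toFun 0), G.dist_comm (u := b) (v := r.toFun 1)] at h5
      omega
  obtain ⟨N, hN⟩ := hr.eventually_mem_shadow hξ
  have hz := hN (N + 1) (Nat.le_succ N)
  have hz' : r.toFun (N + 1) ∈ shadow (r.dart 0) := r.mem_shadow (Nat.succ_pos N)
  have e1 := dist_of_mem_of_notMem hG hz ha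
  have e2 := dist_of_mem_of_notMem hG hz hb
  have e3 := dist_of_mem_of_notMem hG hz' haway.1
  have e4 := dist_of_mem_of_notMem hG hz' haway.2
  rw [show (r.dart 0).fst = p from h0] at e3 e4
  rw [G.dist_comm (u := p) (v := b), sub_eq_sub_iff_add_eq_add]
  norm_cast
  omega

theorem dilatation_eq (hG : G.IsTree) (x₀ : V) (γ : G ≃g G) {ξ : Boundary G} {d : G.Dart}
    (hξ : ξ ∈ endShadow d) (h1 : x₀ ∉ shadow d) (h2 : γ.symm x₀ ∉ shadow d) :
    dilatation x₀ γ ξ = Real.exp (G.dist x₀ d.fst - G.dist (γ.symm x₀) d.fst) := by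
  have hp : IsProjection G x₀ (γ.symm x₀) ξ (projection G x₀ (γ.symm x₀) ξ) :=
    Classical.epsilon_spec (exists_isProjection hG x₀ (γ.symm x₀) ξ)
  rw [dilatation, hp.dist_sub hG hξ h1 h2]

theorem IsVisual.measure_image (hT : IsLocallyFiniteLeaflessTree G) {δ : ℝ} {h : G.Dart → ℝ}
    (hh : IsInvariantFun Γ h) {x₀ : V} {μ : Measure (Boundary G)} [IsFiniteMeasure μ]
    (hμ : IsVisual δ h x₀ μ) {γ : G ≃g G} (hγ : γ ∈ Γ) {d : G.Dart} (h1 : x₀ ∉ shadow d)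
    (h2 : γ.symm x₀ ∉ shadow d) {B : Set (Boundary G)} (hB : MeasurableSet B)
    (hBd : B ⊆ endShadow d) :
    μ (boundaryMap γ '' B) =
      ENNReal.ofReal (Real.exp (δ * (G.dist x₀ d.fst - G.dist (γ.symm x₀) d.fst))) * μ B := by
  have hmeas := measurable_boundaryMap γ.symm
  rw [boundaryMap_image, ← Measure.map_apply hmeas hB]
  have h3 := hμ.measure_eq hT zero_le_one (k := fun d => h (mapDart γ d)) (fun d => by
    rw [hh γ hγ d, one_mul]) (hμ.map γ) h1 h2 hB hBd
  rwa [one_mul] at h3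

/-- A visual measure with invariant density is conformal. -/
theorem IsVisual.isConformal (hT : IsLocallyFiniteLeaflessTree G) {δ : ℝ} {h : G.Dart → ℝ}
    (hh : IsInvariantFun Γ h) {x₀ : V} {μ : Measure (Boundary G)} [IsFiniteMeasure μ]
    (hμ : IsVisual δ h x₀ μ) : IsConformal Γ x₀ δ μ := by
  intro γ hγ A hA
  have hcount := countable_darts hT
  have hmeas := measurable_boundaryMap γ.symm
  rw [boundaryMap_image, ← Measure.map_apply hmeas hA, ← withDensity_apply _ hA]
  congr 1
  refine Measure.ext_of_iUnion_eq_univ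
    (s := fun d : {d : G.Dart // x₀ ∉ shadow d ∧ γ.symm x₀ ∉ shadow d} => endShadow d.1) ?_ ?_
  · refine Set.eq_univ_of_forall fun ξ => Set.mem_iUnion.2 ?_
    obtain ⟨d, hξ, hd⟩ := exists_dart_away hT.isTree x₀ (γ.symm x₀) ξ
    exact ⟨⟨d, hd⟩, hξ⟩
  · rintro ⟨d, hd1, hd2⟩
    ext B hB
    rw [Measure.restrict_apply hB, Measure.restrict_apply hB]
    have hBm : MeasurableSet (B ∩ endShadow d) := hB.inter (measurableSet_endShadow d)
    rw [withDensity_apply _ hBm, Measure.map_apply hmeas hBm, ← boundaryMap_image,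
      hμ.measure_image hT hh hγ hd1 hd2 hBm Set.inter_subset_right, ← setLIntegral_const]
    refine setLIntegral_congr_fun hBm fun ξ hξ => ?_
    rw [dilatation_eq hT.isTree x₀ γ hξ.2 hd1 hd2, ← Real.exp_mul, mul_comm δ]

/-! ### Existence of the visual measure -/

theorem tsum_shadow_expWeight (hG : G.IsTree) {O : Set V} {x₀ : V} {d : G.Dart}
    (hd : x₀ ∉ shadow d) (s : ℝ) :
    ∑' y, (shadow d).indicator
      (O.indicator fun y => IsUniformLattice.expWeight s (G.dist x₀ y)) y =
      ENNReal.ofReal (Real.exp (-s * G.dist x₀ d.fst)) *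
        shadowSum O (IsUniformLattice.expWeight s) d := by
  classical
  rw [shadowSum, ← ENNReal.tsum_mul_left]
  refine tsum_congr fun y => ?_
  by_cases hy : y ∈ shadow d
  · rw [Set.indicator_of_mem hy, Set.indicator_of_mem hy, Set.indicator_apply, Set.indicator_apply]
    split_ifs
    · rw [IsUniformLattice.expWeight, IsUniformLattice.expWeight,
        ← ENNReal.ofReal_mul (Real.exp_pos _).le, ← Real.exp_add,
        dist_of_mem_of_notMem hG hy hd]
      push_cast
      ring_nf
    · simp
  · rw [Set.indicator_of_notMem hy, Set.indicator_of_notMem hy, mul_zero]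

namespace IsUniformLattice

variable {hU : IsUniformLattice Γ} {δ : ℝ} {h : G.Dart → ℝ}

/-- Every vertex can be moved to a boundary point behind it, compatibly with the half-trees that do
not contain `x₀`. -/
theorem exists_boundary_projection (hT : IsLocallyFiniteLeaflessTree G) (x₀ : V) :
    ∃ b : V → Boundary G, ∀ d : G.Dart, x₀ ∉ shadow d →
      (∀ y ∈ shadow d, b y ∈ endShadow d) ∧
      ∀ y, b y ∈ endShadow d → y ∉ shadow d → G.dist y x₀ ≤ G.dist d.snd x₀ := by
  have hG := hT.isTree
  have key : ∀ y, ∃ ξ : Boundary G, ∀ d : G.Dart, x₀ ∉ shadow d →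
      (y ∈ shadow d → ξ ∈ endShadow d) ∧
      (ξ ∈ endShadow d → y ∉ shadow d → G.dist y x₀ ≤ G.dist d.snd x₀) := by
    intro y
    by_cases hy : y = x₀
    · obtain ⟨z, hz⟩ := (hT.nontrivial_neighbors x₀).nonempty
      obtain ⟨ξ, -⟩ := endShadow_nonempty hT ⟨(x₀, z), hz⟩
      refine ⟨ξ, fun d hd => ⟨fun h => absurd (hy ▸ h) hd, fun _ _ => ?_⟩⟩
      rw [hy, SimpleGraph.dist_self]
      exact Nat.zero_le _
    · obtain ⟨p, hp, hxp⟩ := exists_dart_to hG hy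
      obtain ⟨ξ, hξ⟩ := endShadow_nonempty hT p
      refine ⟨ξ, fun d hd => ⟨fun h => ?_, fun h hyd => ?_⟩⟩
      · rcases shadow_trichotomy hG hd hxp with h1 | h1 | h1
        · exact endShadow_mono h1 hξ
        · by_cases h2 : d = p
          · exact h2 ▸ hξ
          · exfalso
            have h3 := dist_snd_of_notMem hG hxp
            have h4 := dist_snd_of_notMem hG hd
            have h5 := dist_of_mem_of_notMem hG (hp ▸ h : p.snd ∈ shadow d) hd
            have h6 := dist_fst_of_shadow_subset hG hxp h1
            have h7 : d.fst = p.fst := by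
              have h8 : G.dist p.fst d.fst + G.dist d.fst p.snd = 1 := by omega
              have h9 : G.dist d.fst p.snd ≠ 0 := fun h9 => by
                rw [hG.connected.dist_eq_zero_iff] at h9
                exact fst_notMem_shadow d (h9 ▸ hp ▸ h)
              exact (hG.connected.dist_eq_zero_iff.1 (by omega)).symm
            exact Set.disjoint_left.1 (shadow_disjoint_of_ne hG h7 h2)
              (hp ▸ h : p.snd ∈ shadow d) (snd_mem_shadow p)
        · exact absurd (snd_mem_shadow p) (Set.disjoint_left.1 h1 (hp ▸ h))
      · rcases shadow_trichotomy hG hd hxp with h1 | h1 | h1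
        · exact absurd (h1 (snd_mem_shadow p)) (hp ▸ hyd)
        · have h2 := dist_of_mem_of_notMem hG (h1 (snd_mem_shadow d)) hxp
          have h3 := dist_snd_of_notMem hG hxp
          have h4 : G.dist p.fst d.snd ≠ 0 := fun h4 => by
            rw [hG.connected.dist_eq_zero_iff] at h4
            exact fst_notMem_shadow p (h4 ▸ h1 (snd_mem_shadow d))
          rw [← hp, G.dist_comm, G.dist_comm (u := d.snd)]
          omega
        · exact absurd h (Set.disjoint_right.1 (endShadow_disjoint h1) hξ)
  choose b hb using key
  exact ⟨b, fun d hd => ⟨fun y hy => (hb y d hd).1 hy, fun y h1 h2 => (hb y d hd).2 h1 h2⟩⟩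

/-- The normalized orbital sum, pushed to the boundary. -/
noncomputable def orbitMeasure (Γ : Subgroup (G ≃g G)) (x₀ x : V) (b : V → Boundary G) (s : ℝ) :
    Measure (Boundary G) :=
  (∑' y, (vertexOrbit Γ x).indicator (fun y => expWeight s (G.dist x₀ y)) y)⁻¹ •
    Measure.sum fun y =>
      (vertexOrbit Γ x).indicator (fun y => expWeight s (G.dist x₀ y)) y • Measure.dirac (b y)

theorem orbitMeasure_apply (x₀ x : V) (b : V → Boundary G) (s : ℝ) {S : Set (Boundary G)}
    (hS : MeasurableSet S) :
    orbitMeasure Γ x₀ x b s S =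
      (∑' y, (vertexOrbit Γ x).indicator (fun y => expWeight s (G.dist x₀ y)) y)⁻¹ *
      ∑' y, (b ⁻¹' S).indicator
        ((vertexOrbit Γ x).indicator fun y => expWeight s (G.dist x₀ y)) y := by
  classical
  rw [orbitMeasure, Measure.smul_apply, smul_eq_mul, Measure.sum_apply _ hS]
  congr 1
  refine tsum_congr fun y => ?_
  rw [Measure.smul_apply, smul_eq_mul, Measure.dirac_apply' _ hS]
  by_cases h : b y ∈ S
  · rw [Set.indicator_of_mem h, Set.indicator_of_mem (show y ∈ b ⁻¹' S from h), Pi.one_apply,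
      mul_one]
  · rw [Set.indicator_of_notMem h, Set.indicator_of_notMem (show y ∉ b ⁻¹' S from h), mul_zero]

theorem IsEigenfunction.isProbabilityMeasure_orbitMeasure (hh : hU.IsEigenfunction δ h)
    (x₀ x : V) (b : V → Boundary G) {s : ℝ} (hs : δ < s) :
    IsProbabilityMeasure (orbitMeasure Γ x₀ x b s) := by
  refine ⟨?_⟩
  rw [orbitMeasure_apply x₀ x b s MeasurableSet.univ, Set.preimage_univ, Set.indicator_univ]
  refine ENNReal.inv_mul_cancel (fun h0 => ?_) (hh.tsum_ne_top x₀ x hs)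
  have := hh.poincareTotal_pos x₀ x hs
  rw [poincareTotal, h0] at this
  simp at this

theorem expWeight_le_one {s : ℝ} (hs : 0 ≤ s) (n : ℕ) : expWeight s n ≤ 1 := by
  rw [expWeight, ENNReal.ofReal_le_one, Real.exp_le_one_iff]
  have : (0 : ℝ) ≤ n := Nat.cast_nonneg n
  nlinarith

/-- Up to a bounded error, the mass of `U(d)` is the part of the Poincaré series over the shadow
of `d`. -/
theorem IsEigenfunction.exists_orbitMeasure_bound (hh : hU.IsEigenfunction δ h) (x₀ x : V)
    {b : V → Boundary G} {d : G.Dart} (hd : x₀ ∉ shadow d)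
    (h1 : ∀ y ∈ shadow d, b y ∈ endShadow d)
    (h2 : ∀ y, b y ∈ endShadow d → y ∉ shadow d → G.dist y x₀ ≤ G.dist d.snd x₀) :
    ∃ N : ℝ, ∀ s, δ < s →
      Real.exp (-s * G.dist x₀ d.fst) * (poincare Γ x s d / poincareTotal Γ x₀ x s) ≤
        (orbitMeasure Γ x₀ x b s (endShadow d)).toReal ∧
      (orbitMeasure Γ x₀ x b s (endShadow d)).toReal ≤
        Real.exp (-s * G.dist x₀ d.fst) * (poincare Γ x s d / poincareTotal Γ x₀ x s) +
          N * (poincareTotal Γ x₀ x s)⁻¹ := by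
  classical
  set O := vertexOrbit Γ x with hO
  have hfin := finite_closedBall hU.tree x₀ (G.dist d.snd x₀)
  refine ⟨(hfin.toFinset.card : ℝ), fun s hs => ?_⟩
  have hs0 : 0 ≤ s := (hh.exponent_pos.trans hs).le
  have hT := hh.poincareTotal_pos x₀ x hs
  set a : V → ℝ≥0∞ := O.indicator fun y => expWeight s (G.dist x₀ y) with ha
  have hshadow := tsum_shadow_expWeight hU.tree.isTree (O := O) hd s
  have hne := hh.shadowSum_ne_top O hs d
  have hlow : ∑' y, (shadow d).indicator a y ≤ ∑' y, (b ⁻¹' endShadow d).indicator a y :=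
    ENNReal.tsum_le_tsum fun y => Set.indicator_le_indicator_of_subset
      (fun y hy => h1 y hy) (fun _ => zero_le) y
  have hup : ∑' y, (b ⁻¹' endShadow d).indicator a y ≤
      ∑' y, (shadow d).indicator a y + hfin.toFinset.card := by
    have h3 : ∑' y, (hfin.toFinset : Set V).indicator (fun _ => (1 : ℝ≥0∞)) y =
        hfin.toFinset.card := by
      rw [← tsum_subtype]
      simp
    rw [← h3, ← ENNReal.tsum_add]
    refine ENNReal.tsum_le_tsum fun y => ?_
    by_cases hy : y ∈ shadow d
    · rw [Set.indicator_of_mem hy, Set.indicator_of_mem (show y ∈ b ⁻¹' endShadow d from h1 y hy)]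
      exact le_self_add
    · by_cases hy' : b y ∈ endShadow d
      · have h4 : y ∈ (hfin.toFinset : Set V) := by simpa using h2 y hy' hy
        rw [Set.indicator_of_notMem hy, zero_add, Set.indicator_of_mem h4,
          Set.indicator_of_mem (show y ∈ b ⁻¹' endShadow d from hy')]
        rw [ha, Set.indicator_apply]
        split_ifs
        · exact expWeight_le_one hs0 _
        · exact zero_le
      · rw [Set.indicator_of_notMem (show y ∉ b ⁻¹' endShadow d from hy')]
        exact zero_le
  have hreal : (∑' y, (shadow d).indicator a y).toReal =
      Real.exp (-s * G.dist x₀ d.fst) * poincare Γ x s d := by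
    rw [hshadow, ENNReal.toReal_mul, ENNReal.toReal_ofReal (Real.exp_pos _).le]
    rfl
  have hne' : ∑' y, (shadow d).indicator a y ≠ ∞ := by
    rw [hshadow]
    exact ENNReal.mul_ne_top ENNReal.ofReal_ne_top hne
  have hne'' : ∑' y, (shadow d).indicator a y + (hfin.toFinset.card : ℝ≥0∞) ≠ ∞ :=
    ENNReal.add_ne_top.2 ⟨hne', ENNReal.natCast_ne_top _⟩
  rw [orbitMeasure_apply x₀ x b s (measurableSet_endShadow d), ENNReal.toReal_mul,
    ENNReal.toReal_inv]
  change _ ≤ (poincareTotal Γ x₀ x s)⁻¹ * _ ∧ (poincareTotal Γ x₀ x s)⁻¹ * _ ≤ _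
  have hlow' := ENNReal.toReal_mono (ne_top_of_le_ne_top hne'' hup) hlow
  have hup' := ENNReal.toReal_mono hne'' hup
  rw [hreal] at hlow'
  rw [ENNReal.toReal_add hne' (ENNReal.natCast_ne_top _), hreal, ENNReal.toReal_natCast] at hup'
  have hTinv := (inv_pos.2 hT).le
  rw [div_eq_inv_mul]
  constructor
  · have := mul_le_mul_of_nonneg_left hlow' hTinv
    linarith
  · have := mul_le_mul_of_nonneg_left hup' hTinv
    linarith

/-- The visual measure exists: it is a limit point of the orbital sums, pushed to the boundary. -/
theorem IsEigenfunction.exists_isVisual (hh : hU.IsEigenfunction δ h) (x₀ : V) :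
    ∃ μ : Measure (Boundary G), IsProbabilityMeasure μ ∧
      IsVisual δ (fun d => h d / ∑ e ∈ outDarts hU.tree x₀, h e) x₀ μ := by
  have hT := hU.tree
  have := compactSpace_boundary hT
  have := t2Space_boundary hT.isTree
  have := secondCountable_boundary hT
  have := TopologicalSpace.metrizableSpace_of_t3_secondCountable (Boundary G)
  let _ := TopologicalSpace.metrizableSpaceMetric (Boundary G)
  obtain ⟨b, hb⟩ := exists_boundary_projection hT x₀
  obtain ⟨hlim0, hlim⟩ := hh.tendsto_poincare x₀ x₀
  let t : ℕ → ℝ := fun n => δ + 1 / ((n : ℝ) + 1)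
  have ht : ∀ n, δ < t n := fun n => by
    have : (0 : ℝ) < 1 / ((n : ℝ) + 1) := by positivity
    simp only [t]
    linarith
  have htlim : Tendsto t atTop (𝓝[>] δ) := by
    refine tendsto_nhdsWithin_iff.2 ⟨?_, Eventually.of_forall ht⟩
    simpa [t] using tendsto_one_div_add_atTop_nhds_zero_nat.const_add δ
  have htid : Tendsto t atTop (𝓝 δ) := htlim.mono_right nhdsWithin_le_nhds
  let ν : ℕ → ProbabilityMeasure (Boundary G) := fun n =>
    ⟨orbitMeasure Γ x₀ x₀ b (t n), hh.isProbabilityMeasure_orbitMeasure x₀ x₀ b (ht n)⟩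
  let U : Ultrafilter ℕ := Filter.hyperfilter ℕ
  have hU : (U : Filter ℕ) ≤ atTop := Nat.hyperfilter_le_atTop
  obtain ⟨μ, -, hμ⟩ := (isCompact_univ (X := ProbabilityMeasure (Boundary G))).ultrafilter_le_nhds
    (U.map ν) (by simp)
  have hμ : Tendsto ν U (𝓝 μ) := hμ
  refine ⟨(μ : Measure (Boundary G)), inferInstance, fun d hd => ?_⟩
  have h1 := ProbabilityMeasure.tendsto_measure_of_null_frontier_of_tendsto' hμ
    (E := endShadow d) (by
      rw [(isClopen_endShadow hT.isTree d).frontier_eq]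
      exact measure_empty)
  have h2 := (ENNReal.tendsto_toReal (measure_ne_top (μ : Measure (Boundary G)) _)).comp h1
  obtain ⟨N, hN⟩ := hh.exists_orbitMeasure_bound x₀ x₀ hd (hb d hd).1 (hb d hd).2
  have h3 : Tendsto (fun n => Real.exp (-t n * G.dist x₀ d.fst) *
      (poincare Γ x₀ (t n) d / poincareTotal Γ x₀ x₀ (t n))) U
      (𝓝 (Real.exp (-δ * G.dist x₀ d.fst) * (h d / ∑ e ∈ outDarts hT x₀, h e))) :=
    (((Real.continuous_exp.tendsto _).comp (htid.neg.mul_const _)).mul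
      ((hlim d).comp htlim)).mono_left hU
  have h4 : Tendsto (fun n => Real.exp (-t n * G.dist x₀ d.fst) *
      (poincare Γ x₀ (t n) d / poincareTotal Γ x₀ x₀ (t n)) +
        N * (poincareTotal Γ x₀ x₀ (t n))⁻¹) U
      (𝓝 (Real.exp (-δ * G.dist x₀ d.fst) * (h d / ∑ e ∈ outDarts hT x₀, h e))) := by
    have := h3.add (((hlim0.comp htlim).const_mul N).mono_left hU)
    simpa using this
  have h5 := tendsto_of_tendsto_of_tendsto_of_le_of_le h3 h4 (fun n => (hN (t n) (ht n)).1)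
    (fun n => (hN (t n) (ht n)).2)
  rw [← tendsto_nhds_unique h2 h5, ENNReal.ofReal_toReal (measure_ne_top _ _)]

end IsUniformLattice

end Visual

/-! ### Weak convergence of the orbital sums -/

section WeakConvergence

open scoped ENNReal

variable {V : Type u} {G : SimpleGraph V} {Γ : Subgroup (G ≃g G)}

theorem tsum_indicator_shadow (hT : IsLocallyFiniteLeaflessTree G) {φ : V → ℝ}
    (hφ : Summable φ) (d : G.Dart) :
    ∑' y, (shadow d).indicator φ y =
      φ d.snd + ∑ e ∈ succs hT d, ∑' y, (shadow e).indicator φ y := by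
  classical
  rw [tsum_congr (indicator_shadow hT d φ), Summable.tsum_add (hφ.indicator _)
    (summable_sum fun e _ => hφ.indicator _), Summable.tsum_finsetSum fun e _ => hφ.indicator _,
    tsum_eq_single d.snd fun y hy => Set.indicator_of_notMem (by simpa using hy) _,
    Set.indicator_of_mem (Set.mem_singleton _)]

theorem tsum_eq_add_sum_outDarts (hT : IsLocallyFiniteLeaflessTree G) {φ : V → ℝ}
    (hφ : Summable φ) (x : V) :
    ∑' y, φ y = φ x + ∑ e ∈ outDarts hT x, ∑' y, (shadow e).indicator φ y := by
  classical
  rw [tsum_congr (eq_indicator_add_sum_outDarts hT x φ), Summable.tsum_add (hφ.indicator _)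
    (summable_sum fun e _ => hφ.indicator _), Summable.tsum_finsetSum fun e _ => hφ.indicator _,
    tsum_eq_single x fun y hy => Set.indicator_of_notMem (by simpa using hy) _,
    Set.indicator_of_mem (Set.mem_singleton _)]

/-- The weight of a vertex in the Poincaré series of the orbit of `x`, as seen from `x₀`. -/
noncomputable def orbitWeight (Γ : Subgroup (G ≃g G)) (x₀ x : V) (s : ℝ) : V → ℝ :=
  (vertexOrbit Γ x).indicator fun y => Real.exp (-s * G.dist x₀ y)

theorem orbitWeight_nonneg (x₀ x : V) (s : ℝ) (y : V) : 0 ≤ orbitWeight Γ x₀ x s y :=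
  Set.indicator_nonneg (fun _ _ => (Real.exp_pos _).le) y

theorem toReal_expWeight (x₀ x : V) (s : ℝ) (y : V) :
    ((vertexOrbit Γ x).indicator (fun y => IsUniformLattice.expWeight s (G.dist x₀ y)) y).toReal =
      orbitWeight Γ x₀ x s y := by
  classical
  rw [orbitWeight, Set.indicator_apply, Set.indicator_apply]
  split_ifs
  · rw [IsUniformLattice.expWeight, ENNReal.toReal_ofReal (Real.exp_pos _).le]
  · rfl

theorem orbitWeight_le_one (x₀ x : V) {s : ℝ} (hs : 0 ≤ s) (y : V) :
    orbitWeight Γ x₀ x s y ≤ 1 := by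
  classical
  rw [orbitWeight, Set.indicator_apply]
  split_ifs
  · rw [Real.exp_le_one_iff]
    have : (0 : ℝ) ≤ G.dist x₀ y := Nat.cast_nonneg _
    nlinarith
  · exact zero_le_one

namespace IsUniformLattice

variable {hU : IsUniformLattice Γ} {δ : ℝ} {h : G.Dart → ℝ}

theorem IsEigenfunction.summable_orbitWeight (hh : hU.IsEigenfunction δ h) (x₀ x : V) {s : ℝ}
    (hs : δ < s) : Summable (orbitWeight Γ x₀ x s) :=
  (ENNReal.summable_toReal (hh.tsum_ne_top x₀ x hs)).congr fun y => toReal_expWeight x₀ x s y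

theorem IsEigenfunction.tsum_orbitWeight (hh : hU.IsEigenfunction δ h) (x₀ x : V) {s : ℝ}
    (hs : δ < s) : ∑' y, orbitWeight Γ x₀ x s y = poincareTotal Γ x₀ x s := by
  rw [poincareTotal, ENNReal.tsum_toReal_eq
    (ENNReal.ne_top_of_tsum_ne_top (hh.tsum_ne_top x₀ x hs))]
  exact (tsum_congr fun y => toReal_expWeight x₀ x s y).symm

theorem IsEigenfunction.tsum_shadow_orbitWeight (hh : hU.IsEigenfunction δ h) {x₀ : V} (x : V)
    {s : ℝ} (hs : δ < s) {d : G.Dart} (hd : x₀ ∉ shadow d) :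
    ∑' y, (shadow d).indicator (orbitWeight Γ x₀ x s) y =
      Real.exp (-s * G.dist x₀ d.fst) * poincare Γ x s d := by
  classical
  have h1 := tsum_shadow_expWeight hU.tree.isTree (O := vertexOrbit Γ x) hd s
  have h2 : ∑' y, (shadow d).indicator ((vertexOrbit Γ x).indicator
      fun y => expWeight s (G.dist x₀ y)) y ≠ ∞ := by
    rw [h1]
    exact ENNReal.mul_ne_top ENNReal.ofReal_ne_top (hh.shadowSum_ne_top _ hs d)
  have h3 := congrArg ENNReal.toReal h1
  rw [ENNReal.tsum_toReal_eq (ENNReal.ne_top_of_tsum_ne_top h2), ENNReal.toReal_mul,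
    ENNReal.toReal_ofReal (Real.exp_pos _).le] at h3
  rw [poincare, ← h3]
  refine tsum_congr fun y => ?_
  rw [Set.indicator_apply, Set.indicator_apply]
  split_ifs
  · exact (toReal_expWeight x₀ x s y).symm
  · rfl

variable {x₀ : V} {μ : Measure (Boundary G)}

theorem IsEigenfunction.tendsto_shadow_orbitWeight (hh : hU.IsEigenfunction δ h) (x : V)
    (hμ : IsVisual δ (fun d => h d / ∑ e ∈ outDarts hU.tree x₀, h e) x₀ μ)
    {d : G.Dart} (hd : x₀ ∉ shadow d) :
    Tendsto (fun s => (∑' y, (shadow d).indicator (orbitWeight Γ x₀ x s) y) /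
      poincareTotal Γ x₀ x s) (𝓝[>] δ) (𝓝 (μ.real (endShadow d))) := by
  have h1 := (hh.tendsto_poincare x₀ x).2 d
  have hid : Tendsto (fun s : ℝ => s) (𝓝[>] δ) (𝓝 δ) := tendsto_id.mono_left nhdsWithin_le_nhds
  have h2 : Tendsto (fun s => Real.exp (-s * G.dist x₀ d.fst)) (𝓝[>] δ)
      (𝓝 (Real.exp (-δ * G.dist x₀ d.fst))) :=
    (Real.continuous_exp.tendsto _).comp (hid.neg.mul_const _)
  have h3 : μ.real (endShadow d) =
      Real.exp (-δ * G.dist x₀ d.fst) * (h d / ∑ e ∈ outDarts hU.tree x₀, h e) := by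
    rw [Measure.real, hμ d hd, ENNReal.toReal_ofReal]
    have := hh.pos d
    have : 0 ≤ ∑ e ∈ outDarts hU.tree x₀, h e := Finset.sum_nonneg fun e _ => (hh.pos e).le
    positivity
  rw [h3]
  refine (h2.mul h1).congr' ?_
  filter_upwards [self_mem_nhdsWithin] with s hs
  rw [hh.tsum_shadow_orbitWeight x hs hd, mul_div_assoc]

theorem IsEigenfunction.summable_orbitWeight_mul (hh : hU.IsEigenfunction δ h) (x₀ x : V) {s : ℝ}
    (hs : δ < s) (f : Compactification G →ᵇ ℝ) :
    Summable fun y => orbitWeight Γ x₀ x s y * f (.vertex y) := by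
  refine Summable.of_norm_bounded ((hh.summable_orbitWeight x₀ x hs).mul_right ‖f‖) fun y => ?_
  rw [norm_mul, Real.norm_of_nonneg (orbitWeight_nonneg x₀ x s y)]
  exact mul_le_mul_of_nonneg_left (f.norm_coe_le_norm _) (orbitWeight_nonneg x₀ x s y)

theorem IsEigenfunction.eventually_vertex_le (hh : hU.IsEigenfunction δ h) (x₀ x : V)
    (f : Compactification G →ᵇ ℝ) (z : V) {η : ℝ} (hη : 0 < η) :
    ∀ᶠ s in 𝓝[>] δ,
      |orbitWeight Γ x₀ x s z * f (.vertex z) / poincareTotal Γ x₀ x s| ≤ η := by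
  have h1 := ((hh.tendsto_poincare x₀ x).1.const_mul ‖f‖)
  rw [mul_zero] at h1
  filter_upwards [self_mem_nhdsWithin, h1.eventually (eventually_le_nhds hη)] with s hs h2
  have hT := hh.poincareTotal_pos x₀ x hs
  refine le_trans ?_ h2
  rw [abs_div, abs_mul, abs_of_pos hT, abs_of_nonneg (orbitWeight_nonneg x₀ x s z),
    div_eq_mul_inv]
  refine mul_le_mul_of_nonneg_right ?_ (inv_pos.2 hT).le
  have h3 : |f (.vertex z)| ≤ ‖f‖ := f.norm_coe_le_norm _
  have h4 := orbitWeight_le_one (Γ := Γ) x₀ x (hh.exponent_pos.trans hs).le z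
  have h5 := orbitWeight_nonneg (Γ := Γ) x₀ x s z
  nlinarith [abs_nonneg (f (.vertex z))]

theorem integrable_boundary [IsFiniteMeasure μ] (f : Compactification G →ᵇ ℝ) :
    Integrable (fun ξ => f (.boundary ξ)) μ :=
  (f.compContinuous ⟨_, continuous_boundary⟩).integrable μ

/-- Bar induction shows that the normalized orbital sums over a shadow approximate the integral
over the ends of the shadow: a bounded continuous function is nearly constant on small
half-spaces. -/
theorem IsEigenfunction.eventually_shadow_le (hh : hU.IsEigenfunction δ h) (x : V)
    [IsFiniteMeasure μ]
    (hμ : IsVisual δ (fun d => h d / ∑ e ∈ outDarts hU.tree x₀, h e) x₀ μ)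
    (f : Compactification G →ᵇ ℝ) {ε : ℝ} (hε : 0 < ε) (d : G.Dart) :
    x₀ ∉ shadow d → ∀ η : ℝ, 0 < η → ∀ᶠ s in 𝓝[>] δ,
      |(∑' y, (shadow d).indicator (fun y => orbitWeight Γ x₀ x s y * f (.vertex y)) y) /
        poincareTotal Γ x₀ x s - ∫ ξ in endShadow d, f (.boundary ξ) ∂μ| ≤
          2 * ε * μ.real (endShadow d) + η := by
  classical
  have hT := hU.tree
  have hG := hT.isTree
  refine bar_induction hG (P := fun d => x₀ ∉ shadow d → ∀ η : ℝ, 0 < η → ∀ᶠ s in 𝓝[>] δ,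
      |(∑' y, (shadow d).indicator (fun y => orbitWeight Γ x₀ x s y * f (.vertex y)) y) /
        poincareTotal Γ x₀ x s - ∫ ξ in endShadow d, f (.boundary ξ) ∂μ| ≤
          2 * ε * μ.real (endShadow d) + η) (fun d ih hd η hη => ?_) (fun r => ?_) d
  · set n : ℝ := ((succs hT d).card : ℝ) with hn
    have hn0 : 0 ≤ n := Nat.cast_nonneg _
    set η' := η / (n + 1) with hη'
    have hη'0 : 0 < η' := by positivity
    have h1 : ∀ e ∈ succs hT d, ∀ᶠ s in 𝓝[>] δ,
        |(∑' y, (shadow e).indicator (fun y => orbitWeight Γ x₀ x s y * f (.vertex y)) y) /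
          poincareTotal Γ x₀ x s - ∫ ξ in endShadow e, f (.boundary ξ) ∂μ| ≤
            2 * ε * μ.real (endShadow e) + η' := fun e he =>
      ih e (mem_succs.1 he) (notMem_of_subset hd ((mem_succs.1 he).shadow_subset hG)) η' hη'0
    filter_upwards [self_mem_nhdsWithin, (eventually_all_finset _).2 h1,
      hh.eventually_vertex_le x₀ x f d.snd hη'0] with s hs h2 h3
    rw [tsum_indicator_shadow hT (hh.summable_orbitWeight_mul x₀ x hs f),
      setIntegral_endShadow_eq_sum hT (integrable_boundary f), add_div, Finset.sum_div,
      add_sub_assoc, ← Finset.sum_sub_distrib, measureReal_endShadow_eq_sum hT μ d]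
    refine (abs_add_le _ _).trans ((add_le_add h3 ((Finset.abs_sum_le_sum_abs _ _).trans
      (Finset.sum_le_sum h2))).trans (le_of_eq ?_))
    rw [Finset.sum_add_distrib, ← Finset.mul_sum, Finset.sum_const, nsmul_eq_mul, ← hn, hη']
    field_simp
    ring
  · let ξ : Boundary G := _root_.Quotient.mk _ r
    have hr : r.Represents ξ := rfl
    set c := f (.boundary ξ) with hc
    let O : Set (Compactification G) := f ⁻¹' Metric.ball c ε
    have hO : IsOpen O := Metric.isOpen_ball.preimage f.continuous
    obtain ⟨N, hN⟩ := hr.exists_halfSpace_subset hG hO (Metric.mem_ball_self hε)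
    refine ⟨N, fun hd η hη => ?_⟩
    have hsub := hN N le_rfl
    generalize r.dart N = d at hd hsub
    set m := μ.real (endShadow d) with hm
    have hm0 : 0 ≤ m := measureReal_nonneg
    have hint : |∫ ξ in endShadow d, f (.boundary ξ) ∂μ - c * m| ≤ ε * m := by
      have h1 : ∫ ξ in endShadow d, (f (.boundary ξ) - c) ∂μ =
          ∫ ξ in endShadow d, f (.boundary ξ) ∂μ - c * m := by
        rw [integral_sub (integrable_boundary f).integrableOn (integrable_const c),
          setIntegral_const, smul_eq_mul, mul_comm c]
      rw [← h1, ← Real.norm_eq_abs]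
      refine norm_setIntegral_le_of_norm_le_const (measure_lt_top μ _) fun ξ hξ => ?_
      exact (Metric.mem_ball.1 (hsub (boundary_mem_halfSpace.2 hξ))).le
    have hlim := hh.tendsto_shadow_orbitWeight x hμ hd
    rw [← hm] at hlim
    have hlim' : Tendsto (fun s => ε * ((∑' y, (shadow d).indicator (orbitWeight Γ x₀ x s) y) /
        poincareTotal Γ x₀ x s) + |c| * |(∑' y, (shadow d).indicator (orbitWeight Γ x₀ x s) y) /
        poincareTotal Γ x₀ x s - m|) (𝓝[>] δ) (𝓝 (ε * m + |c| * |m - m|)) :=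
      (hlim.const_mul ε).add ((hlim.sub_const m).abs.const_mul |c|)
    rw [sub_self, abs_zero, mul_zero, add_zero] at hlim'
    filter_upwards [self_mem_nhdsWithin, hlim'.eventually (eventually_le_nhds
      (show ε * m < ε * m + η by linarith))] with s hs h1
    have hT0 := hh.poincareTotal_pos x₀ x hs
    set M := ∑' y, (shadow d).indicator (orbitWeight Γ x₀ x s) y with hM
    set I := ∑' y, (shadow d).indicator (fun y => orbitWeight Γ x₀ x s y * f (.vertex y)) y
      with hI
    set T := poincareTotal Γ x₀ x s with hTdef
    have hIM : |I - c * M| ≤ ε * M := by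
      have hs1 : Summable ((shadow d).indicator (orbitWeight Γ x₀ x s)) :=
        (hh.summable_orbitWeight x₀ x hs).indicator _
      have hs2 : Summable ((shadow d).indicator
          fun y => orbitWeight Γ x₀ x s y * f (.vertex y)) :=
        (hh.summable_orbitWeight_mul x₀ x hs f).indicator _
      rw [hI, hM, ← tsum_mul_left, ← tsum_mul_left,
        ← Summable.tsum_sub hs2 (hs1.mul_left c), ← Real.norm_eq_abs]
      refine tsum_of_norm_bounded (hs1.mul_left ε).hasSum fun y => ?_
      by_cases hy : y ∈ shadow d
      · rw [Set.indicator_of_mem hy, Set.indicator_of_mem hy,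
          show orbitWeight Γ x₀ x s y * f (.vertex y) - c * orbitWeight Γ x₀ x s y =
            (f (.vertex y) - c) * orbitWeight Γ x₀ x s y by ring, norm_mul,
          Real.norm_of_nonneg (orbitWeight_nonneg x₀ x s y)]
        refine mul_le_mul_of_nonneg_right ?_ (orbitWeight_nonneg x₀ x s y)
        exact (Metric.mem_ball.1 (hsub (vertex_mem_halfSpace.2 hy))).le
      · rw [Set.indicator_of_notMem hy, Set.indicator_of_notMem hy]
        simp
    have h2 : |I / T - c * (M / T)| ≤ ε * (M / T) := by
      rw [← mul_div_assoc, ← mul_div_assoc, ← sub_div, abs_div, abs_of_pos hT0]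
      exact div_le_div_of_nonneg_right hIM hT0.le
    have h3 : I / T - ∫ ξ in endShadow d, f (.boundary ξ) ∂μ =
        (I / T - c * (M / T)) + c * (M / T - m) -
          (∫ ξ in endShadow d, f (.boundary ξ) ∂μ - c * m) := by ring
    rw [h3]
    refine (abs_sub _ _).trans ?_
    have h4 := abs_add_le (I / T - c * (M / T)) (c * (M / T - m))
    rw [abs_mul] at h4
    linarith

theorem IsEigenfunction.isPattersonSullivan (hh : hU.IsEigenfunction δ h) (x : V)
    [hprob : IsProbabilityMeasure μ]
    (hμ : IsVisual δ (fun d => h d / ∑ e ∈ outDarts hU.tree x₀, h e) x₀ μ) :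
    IsPattersonSullivan Γ x₀ x μ := by
  classical
  have hT := hU.tree
  refine ⟨hprob, fun f => ?_⟩
  rw [hh.criticalExponent_eq x₀ x]
  have hlim : Tendsto (fun s => (∑' y, orbitWeight Γ x₀ x s y * f (.vertex y)) /
      poincareTotal Γ x₀ x s) (𝓝[>] δ) (𝓝 (∫ ξ, f (.boundary ξ) ∂μ)) := by
    rw [Metric.tendsto_nhds]
    intro ε hε
    set n : ℝ := ((outDarts hT x₀).card : ℝ) with hn
    have hn0 : 0 ≤ n := Nat.cast_nonneg _
    set η := ε / (4 * (n + 1)) with hη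
    have hη0 : 0 < η := by positivity
    have h1 : ∀ e ∈ outDarts hT x₀, ∀ᶠ s in 𝓝[>] δ,
        |(∑' y, (shadow e).indicator (fun y => orbitWeight Γ x₀ x s y * f (.vertex y)) y) /
          poincareTotal Γ x₀ x s - ∫ ξ in endShadow e, f (.boundary ξ) ∂μ| ≤
            2 * (ε / 4) * μ.real (endShadow e) + η := fun e he =>
      hh.eventually_shadow_le x hμ f (by positivity) e
        (mem_outDarts.1 he ▸ fst_notMem_shadow e) η hη0
    filter_upwards [self_mem_nhdsWithin, (eventually_all_finset _).2 h1,
      hh.eventually_vertex_le x₀ x f x₀ hη0] with s hs h2 h3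
    rw [Real.dist_eq, tsum_eq_add_sum_outDarts hT (hh.summable_orbitWeight_mul x₀ x hs f) x₀,
      integral_eq_sum_outDarts hT (integrable_boundary f) x₀, add_div, Finset.sum_div,
      add_sub_assoc, ← Finset.sum_sub_distrib]
    refine (abs_add_le _ _).trans_lt ((add_le_add h3 ((Finset.abs_sum_le_sum_abs _ _).trans
      (Finset.sum_le_sum h2))).trans_lt ?_)
    rw [Finset.sum_add_distrib, ← Finset.mul_sum, Finset.sum_const, nsmul_eq_mul, ← hn,
      ← measureReal_univ_eq_sum hT μ x₀, probReal_univ]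
    have h5 : (n + 1) * η = ε / 4 := by
      rw [hη]
      field_simp
    linarith
  refine hlim.congr' ?_
  filter_upwards [self_mem_nhdsWithin] with s hs
  congr 1
  · rw [tsum_subtype (vertexOrbit Γ x) fun y => Real.exp (-s * (G.dist y x₀ : ℝ)) *
      f (.vertex y)]
    refine tsum_congr fun y => ?_
    rw [orbitWeight, Set.indicator_apply, Set.indicator_apply, G.dist_comm (u := x₀)]
    split_ifs
    · rfl
    · rw [zero_mul]
  · rw [tsum_subtype (vertexOrbit Γ x) fun y => Real.exp (-s * (G.dist y x₀ : ℝ)),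
      ← hh.tsum_orbitWeight x₀ x hs]
    refine tsum_congr fun y => ?_
    rw [orbitWeight, Set.indicator_apply, Set.indicator_apply, G.dist_comm (u := x₀)]

theorem IsEigenfunction.div_const (hh : hU.IsEigenfunction δ h) {Z : ℝ} (hZ : 0 < Z) :
    hU.IsEigenfunction δ fun d => h d / Z where
  invariant γ hγ d := congrArg (· / Z) (hh.invariant γ hγ d)
  pos d := div_pos (hh.pos d) hZ
  eigen d := by rw [← Finset.sum_div, hh.eigen d, mul_div_assoc]

/-- The Patterson–Sullivan measure exists, it is conformal, and it is the visual measure of a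
positive eigenfunction of the transfer operator. -/
theorem exists_measure (hU : IsUniformLattice Γ) (x₀ x : V) :
    ∃ (h : G.Dart → ℝ) (μ : Measure (Boundary G)),
      hU.IsEigenfunction (criticalExponent Γ x₀ x) h ∧ IsPattersonSullivan Γ x₀ x μ ∧
      IsConformal Γ x₀ (criticalExponent Γ x₀ x) μ ∧
      IsVisual (criticalExponent Γ x₀ x) h x₀ μ := by
  obtain ⟨δ, h, hh⟩ := hU.exists_isEigenfunction
  obtain ⟨μ, hprob, hμ⟩ := hh.exists_isVisual x₀
  have hZ : 0 < ∑ e ∈ outDarts hU.tree x₀, h e := by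
    obtain ⟨y, hy⟩ := (hU.tree.nontrivial_neighbors x₀).nonempty
    exact Finset.sum_pos (fun e _ => hh.pos e) ⟨⟨(x₀, y), hy⟩, mem_outDarts.2 rfl⟩
  have hh' := hh.div_const hZ
  rw [hh.criticalExponent_eq x₀ x]
  exact ⟨_, μ, hh', hh.isPattersonSullivan x hμ, hμ.isConformal hU.tree hh'.invariant, hμ⟩

end IsUniformLattice

end WeakConvergence

/-! ### Gromov products and Busemann cocycles -/

section Gromov

variable {V : Type u} {G : SimpleGraph V}

theorem dist_rayTo (hG : G.IsTree) (v : V) (ξ : Boundary G) (n : ℕ) :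
    G.dist v ((rayTo hG v ξ).toFun n) = n := by
  have h := (rayTo hG v ξ).dist_eq 0 n (Nat.zero_le n)
  rwa [rayTo_zero, Nat.sub_zero] at h

theorem rayTo_of_mem_endShadow (hG : G.IsTree) {v : V} {ξ : Boundary G} {d : G.Dart}
    (hv : v ∉ shadow d) (hξ : ξ ∈ endShadow d) :
    (rayTo hG v ξ).toFun (G.dist v d.fst + 1) = d.snd := by
  induction hn : G.dist v d.fst generalizing d with
  | zero =>
    rw [hG.connected.dist_eq_zero_iff] at hn
    rw [hn]
    exact (mem_endShadow_iff hG).1 hξ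
  | succ n ih =>
    have hne : d.fst ≠ v := fun e => by
      rw [e, SimpleGraph.dist_self] at hn
      omega
    obtain ⟨p, hp, hvp⟩ := exists_dart_to hG hne
    have hsucc : IsSucc p d := by
      refine ⟨hp.symm, fun e => ?_⟩
      have h1 : d = p.symm := Dart.ext' hp.symm e
      rw [h1, ← notMem_shadow_iff hG] at hv
      exact hv hvp
    have h2 := dist_snd_of_notMem hG hvp
    rw [hp] at h2
    have h3 := ih hvp (endShadow_mono (hsucc.shadow_subset hG) hξ) (by omega)
    have h4 := rayTo_toFun_add hG v ξ (n + 1) 1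
    rw [h3, hp, (mem_endShadow_iff hG).1 hξ] at h4
    rw [h4, add_comm]

theorem rayTo_eq_of_succ_eq (hG : G.IsTree) {v : V} {ξ η : Boundary G} {n : ℕ}
    (h : (rayTo hG v ξ).toFun (n + 1) = (rayTo hG v η).toFun (n + 1)) :
    (rayTo hG v ξ).toFun n = (rayTo hG v η).toFun n := by
  have key : ∀ ζ : Boundary G,
      v ∈ basicSet G ((rayTo hG v ζ).toFun (n + 1)) ((rayTo hG v ζ).toFun n) := fun ζ => by
    change G.dist v _ < G.dist v _
    rw [dist_rayTo, dist_rayTo]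
    exact Nat.lt_succ_self n
  refine eq_of_mem_basicSet hG ((rayTo hG v ξ).adj n).symm ?_ (key ξ) ?_
  · rw [h]
    exact ((rayTo hG v η).adj n).symm
  · rw [h]
    exact key η

theorem rayTo_eq_of_le (hG : G.IsTree) {v : V} {ξ η : Boundary G} {m n : ℕ} (hmn : m ≤ n)
    (h : (rayTo hG v ξ).toFun n = (rayTo hG v η).toFun n) :
    (rayTo hG v ξ).toFun m = (rayTo hG v η).toFun m := by
  induction n, hmn using Nat.le_induction with
  | base => exact h
  | succ n _ ih => exact ih (rayTo_eq_of_succ_eq hG h)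

theorem exists_rayTo_ne (hG : G.IsTree) (v : V) {ξ η : Boundary G} (h : ξ ≠ η) :
    ∃ n, (rayTo hG v ξ).toFun n ≠ (rayTo hG v η).toFun n := by
  by_contra hc
  push Not at hc
  have h1 := Ray.ext' hc
  have h2 := rayTo_represents hG v ξ
  rw [h1] at h2
  exact h (h2.symm.trans (rayTo_represents hG v η))

open Classical in
/-- The Gromov product of two boundary points: the length of the common part of the rays from `v`
to them. Equal boundary points have the junk value `0`. -/
noncomputable def gromovProduct (hG : G.IsTree) (v : V) (ξ η : Boundary G) : ℕ :=
  if h : ∃ n, (rayTo hG v ξ).toFun n ≠ (rayTo hG v η).toFun n then Nat.find h - 1 else 0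

theorem rayTo_eq_iff (hG : G.IsTree) {v : V} {ξ η : Boundary G} (h : ξ ≠ η) {n : ℕ} :
    (rayTo hG v ξ).toFun n = (rayTo hG v η).toFun n ↔ n ≤ gromovProduct hG v ξ η := by
  classical
  have hex := exists_rayTo_ne hG v h
  rw [gromovProduct, dif_pos hex]
  have hpos : 0 < Nat.find hex := by
    rw [Nat.find_pos, not_not, rayTo_zero, rayTo_zero]
  constructor
  · intro hn
    by_contra hlt
    exact Nat.find_spec hex (rayTo_eq_of_le hG (by omega) hn)
  · intro hn
    exact not_not.1 (Nat.find_min hex (by omega))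

theorem gromovProduct_eq (hG : G.IsTree) {v : V} {ξ η : Boundary G} {k : ℕ}
    (h : (rayTo hG v ξ).toFun k = (rayTo hG v η).toFun k)
    (h' : (rayTo hG v ξ).toFun (k + 1) ≠ (rayTo hG v η).toFun (k + 1)) :
    gromovProduct hG v ξ η = k := by
  have hne : ξ ≠ η := fun e => h' (by rw [e])
  have h1 := (rayTo_eq_iff hG hne).1 h
  have h2 := mt (rayTo_eq_iff hG hne).2 h'
  omega

theorem gromovProduct_comm (hG : G.IsTree) (v : V) (ξ η : Boundary G) :
    gromovProduct hG v ξ η = gromovProduct hG v η ξ := by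
  by_cases h : ξ = η
  · rw [h]
  · refine gromovProduct_eq hG ((rayTo_eq_iff hG (Ne.symm h)).2 le_rfl).symm fun h1 => ?_
    have := (rayTo_eq_iff hG (Ne.symm h)).1 h1.symm
    omega

theorem dist_rayTo_rayTo (hG : G.IsTree) {v : V} {ξ η : Boundary G} {k m n : ℕ}
    (h : (rayTo hG v ξ).toFun k = (rayTo hG v η).toFun k)
    (h' : (rayTo hG v ξ).toFun (k + 1) ≠ (rayTo hG v η).toFun (k + 1)) (hm : k ≤ m)
    (hn : k ≤ n) :
    G.dist ((rayTo hG v ξ).toFun m) ((rayTo hG v η).toFun n) + 2 * k = m + n := by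
  set r := rayTo hG v ξ
  set s := rayTo hG v η
  have h2 : G.dist (s.toFun k) (s.toFun n) = n - k := s.dist_eq k n hn
  have h3 : G.dist (r.toFun k) (r.toFun m) = m - k := r.dist_eq k m hm
  rcases hm.eq_or_lt with rfl | hm'
  · rw [h, h2]
    omega
  · have hout : s.toFun n ∉ shadow (r.dart k) := by
      rcases hn.eq_or_lt with rfl | hn'
      · rw [← h]
        exact fst_notMem_shadow (r.dart k)
      · refine Set.disjoint_right.1 (shadow_disjoint_of_ne hG (e := s.dart k) h fun e => h' ?_)
          (s.mem_shadow hn')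
        exact congrArg (fun d : G.Dart => d.snd) e
    have h1 := dist_of_mem_of_notMem hG (r.mem_shadow hm') hout
    rw [show (r.dart k).fst = r.toFun k from rfl, h3, h, G.dist_comm (u := s.toFun n)
      (v := s.toFun k), h2] at h1
    rw [G.dist_comm]
    omega

theorem dist_rayTo_of_le (hG : G.IsTree) {v : V} {ξ η : Boundary G} {m n : ℕ} (hmn : m ≤ n)
    (h : (rayTo hG v ξ).toFun m = (rayTo hG v η).toFun m) :
    G.dist ((rayTo hG v ξ).toFun m) ((rayTo hG v η).toFun n) = n - m := by
  rw [h]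
  exact (rayTo hG v η).dist_eq m n hmn

theorem exists_busemann (hG : G.IsTree) (ξ : Boundary G) (v w : V) :
    ∃ p : ℕ × ℕ, ∀ n, (rayTo hG v ξ).toFun (n + p.1) = (rayTo hG w ξ).toFun (n + p.2) := by
  obtain ⟨a, b, h⟩ := (rayTo_represents hG v ξ).exists_shift (rayTo_represents hG w ξ)
  exact ⟨(a, b), h⟩

/-- The Busemann cocycle: the limit of `d(v, z) - d(w, z)`, for vertices `z` tending to `ξ` along a
ray. -/
noncomputable def busemann (hG : G.IsTree) (ξ : Boundary G) (v w : V) : ℤ :=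
  ((exists_busemann hG ξ v w).choose.1 : ℤ) - (exists_busemann hG ξ v w).choose.2

theorem busemann_eq_of_shift (hG : G.IsTree) {ξ : Boundary G} {v w : V} {a b : ℕ}
    (h : ∀ n, (rayTo hG v ξ).toFun (n + a) = (rayTo hG w ξ).toFun (n + b)) :
    busemann hG ξ v w = a - b := by
  have h' := (exists_busemann hG ξ v w).choose_spec
  rw [busemann]
  set p := (exists_busemann hG ξ v w).choose
  have h1 := h p.1
  have h2 := h' a
  rw [add_comm a p.1, h1] at h2
  have h3 := congrArg (G.dist w) h2
  rw [dist_rayTo, dist_rayTo] at h3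
  omega

/-- Far vertices on the rays to `ξ` from `v` and from `w` agree. -/
theorem exists_common_vertex (hG : G.IsTree) (ξ : Boundary G) (v w : V) (N : ℕ) :
    ∃ m n, N ≤ m ∧ N ≤ n ∧ (rayTo hG v ξ).toFun m = (rayTo hG w ξ).toFun n ∧
      busemann hG ξ v w = m - n := by
  obtain ⟨⟨a, b⟩, h⟩ := exists_busemann hG ξ v w
  refine ⟨N + a, N + b, Nat.le_add_right _ _, Nat.le_add_right _ _, h N, ?_⟩
  rw [busemann_eq_of_shift hG h]
  push_cast
  ring

theorem busemann_eq (hG : G.IsTree) {ξ : Boundary G} {v w : V} {d : G.Dart} (hξ : ξ ∈ endShadow d)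
    (hv : v ∉ shadow d) (hw : w ∉ shadow d) :
    busemann hG ξ v w = G.dist v d.fst - G.dist w d.fst := by
  obtain ⟨N, hN⟩ := (rayTo_represents hG v ξ).eventually_mem_shadow hξ
  obtain ⟨m, n, hm, -, h, hb⟩ := exists_common_vertex hG ξ v w N
  have h1 := dist_of_mem_of_notMem hG (hN m hm) hv
  have h2 := dist_of_mem_of_notMem hG (hN m hm) hw
  rw [dist_rayTo] at h1
  rw [h, dist_rayTo, ← h] at h2
  omega

theorem busemann_le_dist (hG : G.IsTree) (ξ : Boundary G) (v w : V) :
    busemann hG ξ v w ≤ G.dist v w := by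
  obtain ⟨d, hd, hv, hw⟩ := exists_dart_away hG v w ξ
  rw [busemann_eq hG hd hv hw]
  have : G.dist v d.fst ≤ G.dist v w + G.dist w d.fst := hG.connected.dist_triangle
  omega

theorem busemann_rayTo (hG : G.IsTree) (ξ : Boundary G) (v : V) (k : ℕ) :
    busemann hG ξ ((rayTo hG v ξ).toFun k) v = -k := by
  rw [busemann_eq_of_shift hG (a := 0) (b := k) fun n => rayTo_toFun_add hG v ξ k (n + 0)]
  simp

theorem gromovProduct_sub (hG : G.IsTree) {ξ η : Boundary G} (hne : ξ ≠ η) (v w : V) :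
    2 * (gromovProduct hG v ξ η : ℤ) - 2 * gromovProduct hG w ξ η =
      busemann hG ξ v w + busemann hG η v w := by
  set k := gromovProduct hG v ξ η with hk
  set l := gromovProduct hG w ξ η with hl
  obtain ⟨m, n, hm, hn, h, hb⟩ := exists_common_vertex hG ξ v w (k + l)
  obtain ⟨m', n', hm', hn', h', hb'⟩ := exists_common_vertex hG η v w (k + l)
  have h1 := dist_rayTo_rayTo hG (v := v) (k := k) (m := m) (n := m')
    ((rayTo_eq_iff hG hne).2 hk.le) (fun e => by have := (rayTo_eq_iff hG hne).1 e; omega)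
    (by omega) (by omega)
  have h2 := dist_rayTo_rayTo hG (v := w) (k := l) (m := n) (n := n')
    ((rayTo_eq_iff hG hne).2 hl.le) (fun e => by have := (rayTo_eq_iff hG hne).1 e; omega)
    (by omega) (by omega)
  rw [h, h'] at h1
  omega

/-- The Gromov product is locally constant off the diagonal. -/
theorem exists_gromovProduct_eq (hG : G.IsTree) {ξ η : Boundary G} (hne : ξ ≠ η) (v : V) :
    ∃ d e : G.Dart, ξ ∈ endShadow d ∧ η ∈ endShadow e ∧ Disjoint (shadow d) (shadow e) ∧
      ∀ ξ' ∈ endShadow d, ∀ η' ∈ endShadow e,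
        gromovProduct hG v ξ' η' = gromovProduct hG v ξ η := by
  set k := gromovProduct hG v ξ η with hk
  have h0 : (rayTo hG v ξ).toFun k = (rayTo hG v η).toFun k := (rayTo_eq_iff hG hne).2 le_rfl
  have h1 : (rayTo hG v ξ).toFun (k + 1) ≠ (rayTo hG v η).toFun (k + 1) := fun e => by
    have := (rayTo_eq_iff hG hne).1 e
    omega
  have key : ∀ ζ : Boundary G, ∀ ζ' ∈ endShadow ((rayTo hG v ζ).dart k),
      (rayTo hG v ζ').toFun (k + 1) = (rayTo hG v ζ).toFun (k + 1) := by
    intro ζ ζ' hζ'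
    have hv : v ∉ shadow ((rayTo hG v ζ).dart k) := by
      have := (rayTo hG v ζ).notMem_shadow (Nat.zero_le k)
      rwa [rayTo_zero] at this
    have h2 := rayTo_of_mem_endShadow hG hv hζ'
    rwa [show ((rayTo hG v ζ).dart k).fst = (rayTo hG v ζ).toFun k from rfl, dist_rayTo] at h2
  refine ⟨(rayTo hG v ξ).dart k, (rayTo hG v η).dart k,
    (rayTo_represents hG v ξ).mem_endShadow k, (rayTo_represents hG v η).mem_endShadow k,
    shadow_disjoint_of_ne hG h0 fun e => h1 (congrArg (fun d : G.Dart => d.snd) e),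
    fun ξ' hξ' η' hη' => gromovProduct_eq hG ?_ ?_⟩
  · rw [rayTo_eq_of_succ_eq hG (key ξ ξ' hξ'), rayTo_eq_of_succ_eq hG (key η η' hη'), h0]
  · rw [key ξ ξ' hξ', key η η' hη']
    exact h1

theorem gromovProduct_mapIso {W : Type v} {H : SimpleGraph W} (hG : G.IsTree) (hH : H.IsTree)
    (F : G ≃g H) (v : V) {ξ η : Boundary G} (hne : ξ ≠ η) :
    gromovProduct hH (F v) (boundaryMapIso F ξ) (boundaryMapIso F η) =
      gromovProduct hG v ξ η := by
  refine gromovProduct_eq hH ?_ ?_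
  · rw [rayTo_mapIso hG hH, rayTo_mapIso hG hH, (rayTo_eq_iff hG hne).2 le_rfl]
  · rw [rayTo_mapIso hG hH, rayTo_mapIso hG hH]
    intro e
    have := (rayTo_eq_iff hG hne).1 (F.injective e)
    omega

/-- The vertex `v` is the center of the triple `a`, `b`, `c` of boundary points. -/
def IsCenter (hG : G.IsTree) (v : V) (a b c : Boundary G) : Prop :=
  gromovProduct hG v a b = 0 ∧ gromovProduct hG v b c = 0 ∧ gromovProduct hG v a c = 0

/-- The center of a triple minimizes the sum of the Gromov products. -/
theorem exists_isCenter (hG : G.IsTree) {a b c : Boundary G} (hab : a ≠ b) (hbc : b ≠ c)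
    (hac : a ≠ c) : ∃ v, IsCenter hG v a b c := by
  let s : V → ℕ := fun v => gromovProduct hG v a b + gromovProduct hG v b c +
    gromovProduct hG v a c
  have := hG.connected.nonempty
  obtain ⟨v, hv⟩ : ∃ v, ∀ w, s v ≤ s w :=
    ⟨Function.argmin s, fun w => Function.argmin_le s w⟩
  -- a common first step towards two of the points would decrease the sum
  have key : ∀ {x y z : Boundary G}, x ≠ y → y ≠ z → x ≠ z →
      (∀ w, gromovProduct hG w x y + gromovProduct hG w y z + gromovProduct hG w x z = s w) →
      gromovProduct hG v x y = 0 := by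
    intro x y z hxy hyz hxz hs
    by_contra hpos
    have hstep : (rayTo hG v x).toFun 1 = (rayTo hG v y).toFun 1 :=
      (rayTo_eq_iff hG hxy).2 (Nat.one_le_iff_ne_zero.2 hpos)
    set w := (rayTo hG v x).toFun 1 with hw
    have hx : busemann hG x w v = -1 := busemann_rayTo hG x v 1
    have hy : busemann hG y w v = -1 := by
      rw [hstep]
      exact busemann_rayTo hG y v 1
    have hz : busemann hG z w v ≤ 1 := by
      refine (busemann_le_dist hG z w v).trans ?_
      rw [G.dist_comm, hw, dist_rayTo]
      rfl
    have h1 := gromovProduct_sub hG hxy w v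
    have h2 := gromovProduct_sub hG hyz w v
    have h3 := gromovProduct_sub hG hxz w v
    have h4 := hv w
    rw [← hs v, ← hs w] at h4
    omega
  refine ⟨v, key hab hbc hac fun w => rfl, key hbc hac.symm hab.symm fun w => ?_,
    key hac hbc.symm hab fun w => ?_⟩
  · simp only [s]
    rw [gromovProduct_comm hG w c a, gromovProduct_comm hG w b a]
    ring
  · simp only [s]
    rw [gromovProduct_comm hG w c b]
    ring

theorem gromovProduct_pos_trans (hG : G.IsTree) {v : V} {a b c : Boundary G} (hac : a ≠ c)
    (h1 : gromovProduct hG v a b ≠ 0) (h2 : gromovProduct hG v b c ≠ 0) :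
    gromovProduct hG v a c ≠ 0 := by
  have hab : a ≠ b := fun e => h1 (by simp [e, gromovProduct])
  have hbc : b ≠ c := fun e => h2 (by simp [e, gromovProduct])
  have h3 := (rayTo_eq_iff hG hab).2 (Nat.one_le_iff_ne_zero.2 h1)
  have h4 := (rayTo_eq_iff hG hbc).2 (Nat.one_le_iff_ne_zero.2 h2)
  exact Nat.one_le_iff_ne_zero.1 ((rayTo_eq_iff hG hac).1 (h3.trans h4))

end Gromov

/-! ### Isometries from boundary maps -/

section Reconstruction

variable {V : Type u} {W : Type v} {G : SimpleGraph V} {H : SimpleGraph W}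

theorem nonempty_boundary (hT : IsLocallyFiniteLeaflessTree G) : Nonempty (Boundary G) := by
  obtain ⟨x⟩ := hT.isTree.connected.nonempty
  obtain ⟨y, hy⟩ := (hT.nontrivial_neighbors x).nonempty
  exact (endShadow_nonempty hT ⟨(x, y), hy⟩).to_type

theorem exists_rayTo_eq (hT : IsLocallyFiniteLeaflessTree G) (v z : V) :
    ∃ ξ, (rayTo hT.isTree v ξ).toFun (G.dist v z) = z := by
  by_cases h : z = v
  · obtain ⟨ξ⟩ := nonempty_boundary hT
    exact ⟨ξ, by rw [h, SimpleGraph.dist_self, rayTo_zero]⟩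
  · obtain ⟨p, hp, hv⟩ := exists_dart_to hT.isTree h
    obtain ⟨ξ, hξ⟩ := endShadow_nonempty hT p
    refine ⟨ξ, ?_⟩
    rw [← hp, dist_snd_of_notMem hT.isTree hv]
    exact rayTo_of_mem_endShadow hT.isTree hv hξ

theorem exists_three_boundary_points (hT : IsLocallyFiniteLeaflessTree G)
    (hb : ∃ d e f : G.Dart, IsSucc d e ∧ IsSucc d f ∧ e ≠ f) :
    ∃ a b c : Boundary G, a ≠ b ∧ b ≠ c ∧ a ≠ c := by
  obtain ⟨d, e, f, he, hf, hef⟩ := hb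
  have hG := hT.isTree
  obtain ⟨a, ha⟩ := endShadow_nonempty hT e
  obtain ⟨b, hb⟩ := endShadow_nonempty hT f
  obtain ⟨c, hc⟩ := endShadow_nonempty hT d.symm
  have h1 := endShadow_disjoint (he.shadow_disjoint hG hf hef)
  have h2 := endShadow_disjoint (shadow_disjoint_symm hG d)
  exact ⟨a, b, c, fun h => Set.disjoint_left.1 h1 ha (h ▸ hb),
    fun h => Set.disjoint_left.1 h2 (endShadow_mono (hf.shadow_subset hG) hb) (h ▸ hc),
    fun h => Set.disjoint_left.1 h2 (endShadow_mono (he.shadow_subset hG) ha) (h ▸ hc)⟩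

/-- An isometry between the vertex sets of trees, as an isomorphism of graphs. -/
noncomputable def isoOfDist (F : V → W) (hF : Function.Bijective F)
    (hdist : ∀ a b, H.dist (F a) (F b) = G.dist a b) : G ≃g H :=
  ⟨Equiv.ofBijective F hF, fun {a b} => by
    rw [← SimpleGraph.dist_eq_one_iff_adj, ← SimpleGraph.dist_eq_one_iff_adj]
    exact Eq.congr_left (hdist a b)⟩

/-- A bijection of the boundaries that preserves the Gromov products is induced by an isomorphism
of trees, which maps the rays from one base vertex to rays from the other. -/
theorem exists_iso_of_gromovProduct_eq (hT : IsLocallyFiniteLeaflessTree G)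
    (hS : IsLocallyFiniteLeaflessTree H) (φ : Boundary G ≃ Boundary H) (v : V) (w : W)
    (h : ∀ ξ η, ξ ≠ η → gromovProduct hS.isTree w (φ ξ) (φ η) = gromovProduct hT.isTree v ξ η) :
    ∃ F : G ≃g H, ∀ ξ, boundaryMapIso F ξ = φ ξ := by
  have hG := hT.isTree
  have hH := hS.isTree
  have heq : ∀ ξ η n, (rayTo hG v ξ).toFun n = (rayTo hG v η).toFun n ↔
      (rayTo hH w (φ ξ)).toFun n = (rayTo hH w (φ η)).toFun n := by
    intro ξ η n
    by_cases hne : ξ = η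
    · simp [hne]
    · rw [rayTo_eq_iff hG hne, rayTo_eq_iff hH (φ.injective.ne hne), h ξ η hne]
  have hdist : ∀ ξ η m n, H.dist ((rayTo hH w (φ ξ)).toFun m) ((rayTo hH w (φ η)).toFun n) =
      G.dist ((rayTo hG v ξ).toFun m) ((rayTo hG v η).toFun n) := by
    intro ξ η m n
    wlog hmn : m ≤ n generalizing ξ η m n
    · rw [H.dist_comm, G.dist_comm]
      exact this η ξ n m (le_of_not_ge hmn)
    by_cases hm : (rayTo hG v ξ).toFun m = (rayTo hG v η).toFun m
    · rw [dist_rayTo_of_le hG hmn hm, dist_rayTo_of_le hH hmn ((heq ξ η m).1 hm)]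
    · have hne : ξ ≠ η := fun e => hm (by rw [e])
      set k := gromovProduct hG v ξ η with hk
      have h0 := (rayTo_eq_iff hG (v := v) hne).2 hk.le
      have h1 : (rayTo hG v ξ).toFun (k + 1) ≠ (rayTo hG v η).toFun (k + 1) := fun e => by
        have := (rayTo_eq_iff hG hne).1 e
        omega
      have hkm : k ≤ m := by
        by_contra hlt
        exact hm ((rayTo_eq_iff hG hne).2 (by omega))
      have h2 := dist_rayTo_rayTo hG h0 h1 hkm (hkm.trans hmn)
      have h3 := dist_rayTo_rayTo hH ((heq ξ η k).1 h0) (mt (heq ξ η (k + 1)).2 h1) hkm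
        (hkm.trans hmn)
      omega
  choose e he using exists_rayTo_eq hT v
  let F : V → W := fun z => (rayTo hH w (φ (e z))).toFun (G.dist v z)
  have hF : ∀ ξ n, F ((rayTo hG v ξ).toFun n) = (rayTo hH w (φ ξ)).toFun n := by
    intro ξ n
    rw [← hH.connected.dist_eq_zero_iff]
    simp only [F]
    rw [hdist, he, SimpleGraph.dist_self]
  have hFdist : ∀ y z, H.dist (F y) (F z) = G.dist y z := by
    intro y z
    simp only [F]
    rw [hdist, he, he]
  have hbij : Function.Bijective F := by
    constructor
    · intro y z hyz
      rw [← hG.connected.dist_eq_zero_iff, ← hFdist, hyz, SimpleGraph.dist_self]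
    · intro z
      obtain ⟨η, hη⟩ := exists_rayTo_eq hS w z
      refine ⟨(rayTo hG v (φ.symm η)).toFun (H.dist w z), ?_⟩
      rw [hF, φ.apply_symm_apply, hη]
  let F' : G ≃g H := isoOfDist F hbij hFdist
  refine ⟨F', fun ξ => ?_⟩
  have h1 := (rayTo_represents hG v ξ).mapIso F'
  have h2 := rayTo_represents hH w (φ ξ)
  have h3 : (rayTo hG v ξ).mapIso F' = rayTo hH w (φ ξ) := Ray.ext' (hF ξ)
  rw [h3] at h1
  exact h1.symm.trans h2

/-- A bijection of the boundaries that changes the Gromov products by a coboundary is induced by an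
isomorphism of trees: with the centers of a triple and of its image as base vertices, the
coboundary vanishes. -/
theorem exists_iso_of_gromovProduct_sub (hT : IsLocallyFiniteLeaflessTree G)
    (hS : IsLocallyFiniteLeaflessTree H) (φ : Boundary G ≃ Boundary H) (x : V) (y : W)
    (h3 : ∃ a b c : Boundary G, a ≠ b ∧ b ≠ c ∧ a ≠ c) (u : Boundary G → ℝ)
    (h : ∀ ξ η, ξ ≠ η → 2 * (gromovProduct hS.isTree y (φ ξ) (φ η) : ℝ) -
      2 * gromovProduct hT.isTree x ξ η = u ξ + u η) :
    ∃ F : G ≃g H, ∀ ξ, boundaryMapIso F ξ = φ ξ := by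
  have hG := hT.isTree
  have hH := hS.isTree
  obtain ⟨a, b, c, hab, hbc, hac⟩ := h3
  obtain ⟨v, hv1, hv2, hv3⟩ := exists_isCenter hG hab hbc hac
  obtain ⟨w, hw1, hw2, hw3⟩ := exists_isCenter hH (φ.injective.ne hab) (φ.injective.ne hbc)
    (φ.injective.ne hac)
  let t : Boundary G → ℝ := fun ξ =>
    u ξ + busemann hH (φ ξ) w y - busemann hG ξ v x
  have ht : ∀ ξ η, ξ ≠ η → 2 * (gromovProduct hH w (φ ξ) (φ η) : ℝ) -
      2 * gromovProduct hG v ξ η = t ξ + t η := by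
    intro ξ η hne
    have h1 : (2 * (gromovProduct hG v ξ η : ℝ) - 2 * gromovProduct hG x ξ η) =
      busemann hG ξ v x + busemann hG η v x := by
      exact_mod_cast gromovProduct_sub hG hne v x
    have h2 : (2 * (gromovProduct hH w (φ ξ) (φ η) : ℝ) - 2 * gromovProduct hH y (φ ξ) (φ η)) =
        busemann hH (φ ξ) w y + busemann hH (φ η) w y := by
      exact_mod_cast gromovProduct_sub hH (φ.injective.ne hne) w y
    have h3 := h ξ η hne
    simp only [t]
    linarith
  have hta := ht a b hab
  have htb := ht b c hbc
  have htc := ht a c hac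
  rw [hv1, hw1] at hta
  rw [hv2, hw2] at htb
  rw [hv3, hw3] at htc
  have ha0 : t a = 0 := by push_cast at *; linarith
  have hb0 : t b = 0 := by push_cast at *; linarith
  have hc0 : t c = 0 := by push_cast at *; linarith
  -- each point shares its direction at a center with at most one point of the triple
  have key : ∀ ξ z, t z = 0 → ξ ≠ z → gromovProduct hG v ξ z = 0 →
      gromovProduct hH w (φ ξ) (φ z) = 0 → t ξ = 0 := by
    intro ξ z hz hne h1 h2
    have h3 := ht ξ z hne
    rw [h1, h2, hz] at h3
    push_cast at h3
    linarith
  have ht0 : ∀ ξ, t ξ = 0 := by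
    intro ξ
    by_cases hξa : ξ = a
    · rw [hξa, ha0]
    by_cases hξb : ξ = b
    · rw [hξb, hb0]
    by_cases hξc : ξ = c
    · rw [hξc, hc0]
    by_contra hξ
    have hor : ∀ z, t z = 0 → ξ ≠ z → gromovProduct hG v z ξ ≠ 0 ∨
        gromovProduct hH w (φ z) (φ ξ) ≠ 0 := fun z hz hne => by
      by_contra hcon
      push Not at hcon
      rw [gromovProduct_comm hG v z, gromovProduct_comm hH w (φ z)] at hcon
      exact hξ (key ξ z hz hne hcon.1 hcon.2)
    have e1 : ∀ {z z' : Boundary G}, z ≠ z' → gromovProduct hG v z z' = 0 →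
        gromovProduct hG v z ξ ≠ 0 → ¬ gromovProduct hG v z' ξ ≠ 0 := fun hne h0 h1 h2 =>
      gromovProduct_pos_trans hG hne h1 (gromovProduct_comm hG v ξ _ ▸ h2) h0
    have e2 : ∀ {z z' : Boundary G}, z ≠ z' → gromovProduct hH w (φ z) (φ z') = 0 →
        gromovProduct hH w (φ z) (φ ξ) ≠ 0 → ¬ gromovProduct hH w (φ z') (φ ξ) ≠ 0 :=
      fun hne h0 h1 h2 => gromovProduct_pos_trans hH (φ.injective.ne hne) h1
        (gromovProduct_comm hH w (φ ξ) _ ▸ h2) h0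
    rcases hor a ha0 hξa with h1 | h1 <;> rcases hor b hb0 hξb with h2 | h2 <;>
      rcases hor c hc0 hξc with h3 | h3
    · exact e1 hab hv1 h1 h2
    · exact e1 hab hv1 h1 h2
    · exact e1 hac hv3 h1 h3
    · exact e2 hbc hw2 h2 h3
    · exact e1 hbc hv2 h2 h3
    · exact e2 hac hw3 h1 h3
    · exact e2 hab hw1 h1 h2
    · exact e2 hab hw1 h1 h2
  refine exists_iso_of_gromovProduct_eq hT hS φ v w fun ξ η hne => ?_
  have h4 := ht ξ η hne
  rw [ht0, ht0] at h4
  exact_mod_cast (by linarith :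
    (gromovProduct hH w (φ ξ) (φ η) : ℝ) = gromovProduct hG v ξ η)

/-- An automorphism of a tree with at least three ends that fixes all ends is trivial. -/
theorem apply_eq_of_boundaryMapIso_eq (hT : IsLocallyFiniteLeaflessTree G)
    (h3 : ∃ a b c : Boundary G, a ≠ b ∧ b ≠ c ∧ a ≠ c) (σ : G ≃g G)
    (hσ : ∀ ξ, boundaryMapIso σ ξ = ξ) (z : V) : σ z = z := by
  have hG := hT.isTree
  obtain ⟨a, b, c, hab, hbc, hac⟩ := h3
  obtain ⟨v, hv1, hv2, hv3⟩ := exists_isCenter hG hab hbc hac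
  have hgp : ∀ {ξ η : Boundary G}, ξ ≠ η →
      gromovProduct hG (σ v) ξ η = gromovProduct hG v ξ η := by
    intro ξ η hne
    have := gromovProduct_mapIso hG hG σ v hne
    rwa [hσ, hσ] at this
  have h1 := gromovProduct_sub hG hab v (σ v)
  have h2 := gromovProduct_sub hG hbc v (σ v)
  have h3 := gromovProduct_sub hG hac v (σ v)
  rw [hgp hab] at h1
  rw [hgp hbc] at h2
  rw [hgp hac] at h3
  have key : ∀ (d : G.Dart) (ξ : Boundary G), d.fst = v → σ v ∈ shadow d →
      busemann hG ξ v (σ v) = 0 → ξ ∈ endShadow d := by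
    intro d ξ hd hmem h0
    by_contra hξ
    obtain ⟨f, hf, hξf⟩ := exists_dart_mem_endShadow hG v ξ
    have hdf : d ≠ f := fun e => hξ (e ▸ hξf)
    have hout : σ v ∉ shadow f :=
      Set.disjoint_left.1 (shadow_disjoint_of_ne hG (hd.trans hf.symm) hdf) hmem
    rw [busemann_eq hG hξf (hf ▸ fst_notMem_shadow f) hout, hf, SimpleGraph.dist_self] at h0
    have h5 : G.dist (σ v) v = 0 := by omega
    rw [hG.connected.dist_eq_zero_iff] at h5
    rw [h5, ← hd] at hmem
    exact fst_notMem_shadow d hmem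
  have hv : σ v = v := by
    by_contra hne
    obtain ⟨d, hd, hmem⟩ := exists_dart_of_ne hG hne
    have ha := (mem_endShadow_iff hG).1 (key d a hd hmem (by omega))
    have hb := (mem_endShadow_iff hG).1 (key d b hd hmem (by omega))
    rw [hd] at ha hb
    have := (rayTo_eq_iff hG hab).1 (ha.trans hb.symm)
    omega
  obtain ⟨ξ, hξ⟩ := exists_rayTo_eq hT v z
  have h4 := rayTo_mapIso hG hG σ v ξ (G.dist v z)
  rwa [hσ, hv, hξ, eq_comm] at h4

/-- Two isomorphisms of trees with at least three ends agree if they induce the same map of the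
boundaries. -/
theorem eq_of_boundaryMapIso_eq (hT : IsLocallyFiniteLeaflessTree G)
    (h3 : ∃ a b c : Boundary G, a ≠ b ∧ b ≠ c ∧ a ≠ c) (F F' : G ≃g H)
    (h : ∀ ξ, boundaryMapIso F ξ = boundaryMapIso F' ξ) (z : V) : F z = F' z := by
  have h1 := apply_eq_of_boundaryMapIso_eq hT h3 (F.trans F'.symm) (fun ξ => ?_) z
  · exact F'.symm_apply_eq.1 h1
  · rw [boundaryMapIso_trans, h, boundaryMapIso_symm_apply]

end Reconstruction

/-! ### Densities at small scales -/

section Density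

variable {V : Type u} {G : SimpleGraph V}

/-- If `μ` has a density with respect to `ν`, then `μ` is nearly a multiple of `ν` on some `U(d)`.
Otherwise bar induction shows that no continuous function is close to the density in the mean. -/
theorem exists_endShadow_approx (hT : IsLocallyFiniteLeaflessTree G) {μ ν : Measure (Boundary G)}
    [IsFiniteMeasure μ] [IsFiniteMeasure ν] (hac : μ ≪ ν) (hμ : μ ≠ 0) (x : V) {ε : ℝ}
    (hε : 0 < ε) :
    ∃ d : G.Dart, x ∉ shadow d ∧ ∃ c : ℝ, ∀ B, MeasurableSet B → B ⊆ endShadow d →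
      |μ.real B - c * ν.real B| ≤ ε * μ.real (endShadow d) := by
  have hG := hT.isTree
  have := compactSpace_boundary hT
  have := t2Space_boundary hG
  have := secondCountable_boundary hT
  have := TopologicalSpace.metrizableSpace_of_t3_secondCountable (Boundary G)
  let _ := TopologicalSpace.metrizableSpaceMetric (Boundary G)
  by_contra hcon
  push Not at hcon
  set ψ : Boundary G → ℝ := fun ξ => (μ.rnDeriv ν ξ).toReal with hψ
  have hint : Integrable ψ ν := Measure.integrable_toReal_rnDeriv
  have hlow : ∀ d : G.Dart, x ∉ shadow d → ∀ c : ℝ,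
      ε * μ.real (endShadow d) ≤ ∫ ξ in endShadow d, |ψ ξ - c| ∂ν := by
    intro d hd c
    obtain ⟨B, hB, hBd, h1⟩ := hcon d hd c
    refine h1.le.trans ?_
    have hi : Integrable (fun ξ => ψ ξ - c) ν := hint.sub (integrable_const c)
    have h2 : μ.real B - c * ν.real B = ∫ ξ in B, (ψ ξ - c) ∂ν := by
      rw [integral_sub hint.integrableOn (integrable_const c), setIntegral_const, smul_eq_mul,
        mul_comm c, hψ, Measure.setIntegral_toReal_rnDeriv hac]
    rw [h2]
    refine (abs_integral_le_integral_abs).trans ?_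
    exact setIntegral_mono_set hi.abs.integrableOn
      (Eventually.of_forall fun ξ => abs_nonneg _) (Eventually.of_forall hBd)
  have hm : 0 < μ.real Set.univ := by
    rw [measureReal_def]
    exact ENNReal.toReal_pos (Measure.measure_univ_ne_zero.2 hμ) (measure_ne_top μ _)
  set m := μ.real Set.univ with hmdef
  set n := ν.real Set.univ with hndef
  have hn : 0 ≤ n := measureReal_nonneg
  obtain ⟨g, hg, hgint⟩ := hint.exists_boundedContinuous_integral_sub_le
    (show 0 < ε * m / 4 by positivity)
  set η := ε * m / (4 * (n + 1)) with hη
  have hη0 : 0 < η := by positivity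
  have hi : Integrable (fun ξ => |ψ ξ - g ξ|) ν := (hint.sub hgint).abs
  have hbar : ∀ d : G.Dart, x ∉ shadow d →
      ε * μ.real (endShadow d) - η * ν.real (endShadow d) ≤
        ∫ ξ in endShadow d, |ψ ξ - g ξ| ∂ν := by
    refine bar_induction hG (fun d ih hd => ?_) (fun r => ?_)
    · rw [measureReal_endShadow_eq_sum hT μ, measureReal_endShadow_eq_sum hT ν,
        setIntegral_endShadow_eq_sum hT hi, Finset.mul_sum, Finset.mul_sum,
        ← Finset.sum_sub_distrib]
      exact Finset.sum_le_sum fun e he => ih e (mem_succs.1 he)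
        (notMem_of_subset hd ((mem_succs.1 he).shadow_subset hG))
    · let ξ₀ : Boundary G := _root_.Quotient.mk _ r
      have hr : r.Represents ξ₀ := rfl
      obtain ⟨N, hN⟩ := hr.exists_endShadow_subset hG
        (Metric.isOpen_ball.preimage g.continuous) (Metric.mem_ball_self hη0)
      refine ⟨N, fun hd => ?_⟩
      have hsub := hN N le_rfl
      have h1 := hlow _ hd (g ξ₀)
      have h2 : ∫ ξ in endShadow (r.dart N), |ψ ξ - g ξ₀| ∂ν ≤
          ∫ ξ in endShadow (r.dart N), (|ψ ξ - g ξ| + η) ∂ν := by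
        refine setIntegral_mono_on (hint.sub (integrable_const _)).abs.integrableOn
          (hi.add (integrable_const η)).integrableOn (measurableSet_endShadow _) fun ξ hξ => ?_
        have h3 : |g ξ - g ξ₀| < η := Metric.mem_ball.1 (hsub hξ)
        have h4 := abs_sub_le (ψ ξ) (g ξ) (g ξ₀)
        linarith
      rw [integral_add hi.integrableOn (integrable_const η), setIntegral_const, smul_eq_mul] at h2
      linarith
  have htot : ε * m - η * n ≤ ∫ ξ, |ψ ξ - g ξ| ∂ν := by
    rw [hmdef, hndef, measureReal_univ_eq_sum hT μ x, measureReal_univ_eq_sum hT ν x,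
      integral_eq_sum_outDarts hT hi x, Finset.mul_sum, Finset.mul_sum, ← Finset.sum_sub_distrib]
    exact Finset.sum_le_sum fun e he => hbar e (mem_outDarts.1 he ▸ fst_notMem_shadow e)
  have hg' : ∫ ξ, |ψ ξ - g ξ| ∂ν ≤ ε * m / 4 := hg
  have hηn : η * n ≤ ε * m / 4 := by
    rw [hη, div_mul_eq_mul_div, div_le_div_iff₀ (by positivity) (by norm_num)]
    have : 0 < ε * m := by positivity
    nlinarith
  have : 0 < ε * m := by positivity
  linarith

end Density

/-! ### Equivariant homeomorphisms between visual measures -/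

section Conjugacy

variable {V : Type u} {W : Type v} {G : SimpleGraph V} {H : SimpleGraph W}
  {Γ : Subgroup (G ≃g G)} {Γ' : Subgroup (H ≃g H)} {δ : ℝ} {x₀ : V} {y₀ : W}
  {μ : Measure (Boundary G)} {μ' : Measure (Boundary H)} {α : Γ ≃* Γ'}
  {φ : Boundary G ≃ₜ Boundary H}

/-- The measure `μ` is a finite visual measure of the lattice `Γ` with a positive invariant
density. -/
structure IsVisualPair (Γ : Subgroup (G ≃g G)) (δ : ℝ) (x₀ : V) (μ : Measure (Boundary G)) :
    Prop where
  lattice : IsUniformLattice Γ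
  finite : IsFiniteMeasure μ
  visual : ∃ h : G.Dart → ℝ, IsInvariantFun Γ h ∧ (∀ d, 0 < h d) ∧ IsVisual δ h x₀ μ

theorem IsVisualPair.measureReal_image (hμ : IsVisualPair Γ δ x₀ μ) {γ : G ≃g G} (hγ : γ ∈ Γ)
    {d : G.Dart} (h1 : x₀ ∉ shadow d) (h2 : γ.symm x₀ ∉ shadow d) {ξ : Boundary G}
    (hξ : ξ ∈ endShadow d) {B : Set (Boundary G)} (hB : MeasurableSet B)
    (hBd : B ⊆ endShadow d) :
    μ.real (boundaryMap γ '' B) =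
      Real.exp (δ * busemann hμ.lattice.tree.isTree ξ x₀ (γ.symm x₀)) * μ.real B := by
  have := hμ.finite
  obtain ⟨h, hh, -, hv⟩ := hμ.visual
  rw [measureReal_def, hv.measure_image hμ.lattice.tree hh hγ h1 h2 hB hBd, ENNReal.toReal_mul,
    ENNReal.toReal_ofReal (Real.exp_pos _).le, busemann_eq _ hξ h1 h2, measureReal_def]
  push_cast
  rfl

theorem IsVisualPair.endShadow_pos (hμ : IsVisualPair Γ δ x₀ μ) {d : G.Dart}
    (hd : x₀ ∉ shadow d) : 0 < μ.real (endShadow d) := by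
  obtain ⟨h, -, hpos, hv⟩ := hμ.visual
  have := hpos d
  rw [measureReal_def, hv d hd, ENNReal.toReal_ofReal (by positivity)]
  positivity

theorem exists_dart_subset (hG : G.IsTree) {O : Set (Boundary G)} (hO : IsOpen O)
    {ξ : Boundary G} (hξ : ξ ∈ O) (x y : V) :
    ∃ d : G.Dart, ξ ∈ endShadow d ∧ x ∉ shadow d ∧ y ∉ shadow d ∧ endShadow d ⊆ O := by
  obtain ⟨r, hr⟩ := _root_.Quotient.exists_rep ξ
  have hr : r.Represents ξ := hr
  obtain ⟨N, hN⟩ := exists_notMem_shadow_dart hG r x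
  obtain ⟨M, hM⟩ := exists_notMem_shadow_dart hG r y
  obtain ⟨K, hK⟩ := hr.exists_endShadow_subset hG hO hξ
  exact ⟨r.dart (N + M + K), hr.mem_endShadow _, hN _ (by omega), hM _ (by omega),
    hK _ (by omega)⟩

theorem IsVisualPair.pos_of_isOpen (hμ : IsVisualPair Γ δ x₀ μ) {O : Set (Boundary G)}
    (hO : IsOpen O) (hne : O.Nonempty) : 0 < μ.real O := by
  have := hμ.finite
  obtain ⟨ξ, hξ⟩ := hne
  obtain ⟨d, -, hd, -, hsub⟩ := exists_dart_subset hμ.lattice.tree.isTree hO hξ x₀ x₀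
  exact (hμ.endShadow_pos hd).trans_le (measureReal_mono hsub)

/-- The homeomorphism `φ` of the boundaries is equivariant. -/
def IsEquivariant (α : Γ ≃* Γ') (φ : Boundary G ≃ₜ Boundary H) : Prop :=
  ∀ (γ : Γ) (ξ : Boundary G),
    φ (boundaryMap (γ : G ≃g G) ξ) = boundaryMap (α γ : H ≃g H) (φ ξ)

theorem IsEquivariant.image_image (hφ : IsEquivariant α φ) (γ : Γ) (B : Set (Boundary G)) :
    φ '' (boundaryMap (γ : G ≃g G) '' B) = boundaryMap (α γ : H ≃g H) '' (φ '' B) := by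
  rw [Set.image_image, Set.image_image]
  exact Set.image_congr fun ξ _ => hφ γ ξ

theorem measurableSet_image_homeo {B : Set (Boundary G)} (hB : MeasurableSet B) :
    MeasurableSet (φ '' B) :=
  φ.toMeasurableEquiv.measurableSet_image.2 hB

theorem measurableSet_boundaryMap_image (γ : G ≃g G) {B : Set (Boundary G)}
    (hB : MeasurableSet B) : MeasurableSet (boundaryMap γ '' B) := by
  rw [boundaryMap_image]
  exact measurable_boundaryMap γ.symm hB

theorem boundaryMap_image_endShadow (γ : G ≃g G) (d : G.Dart) :
    boundaryMap γ '' endShadow d = endShadow (mapDart γ d) :=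
  boundaryMapIso_image_endShadow γ d

theorem IsUniformLattice.exists_mapDart_subset (hU : IsUniformLattice Γ) (d e : G.Dart) :
    ∃ γ : Γ, shadow (mapDart (γ : G ≃g G) e) ⊆ shadow d := by
  obtain ⟨γ, hγ, h⟩ := hU.reaches d e
  exact ⟨⟨γ, hγ⟩, h⟩

/-- There are finitely many representatives of the oriented edges, all pointing away from a given
vertex. -/
theorem IsUniformLattice.exists_finite_representatives_away (hU : IsUniformLattice Γ) (x : V) :
    ∃ R : Finset G.Dart, (∀ d ∈ R, x ∉ shadow d) ∧ ∀ d, ∃ γ : Γ, mapDart (γ : G ≃g G) d ∈ R := by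
  classical
  obtain ⟨R, hR⟩ := hU.finite
  obtain ⟨y, hy⟩ := (hU.tree.nontrivial_neighbors x).nonempty
  let d₀ : G.Dart := ⟨(x, y), hy⟩
  choose γ hγ using fun e => hU.exists_mapDart_subset d₀ e
  refine ⟨R.image fun e => mapDart (γ e : G ≃g G) e, fun d hd => ?_, fun d => ?_⟩
  · obtain ⟨e, -, rfl⟩ := Finset.mem_image.1 hd
    exact notMem_of_subset (fst_notMem_shadow d₀) (hγ e)
  · obtain ⟨β, hβ, hd⟩ := hR d
    refine ⟨γ (mapDart β d) * ⟨β, hβ⟩, Finset.mem_image.2 ⟨_, hd, ?_⟩⟩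
    exact (mapDart_mul _ _ d).symm

theorem IsUniformLattice.exists_disjoint (hU : IsUniformLattice Γ) (d : G.Dart) :
    ∃ e f : G.Dart, shadow e ⊆ shadow d ∧ shadow f ⊆ shadow d ∧
      Disjoint (shadow e) (shadow f) := by
  have hG := hU.tree.isTree
  obtain ⟨b, e, f, he, hf, hne⟩ := hU.branching
  obtain ⟨γ, hγ⟩ := hU.exists_mapDart_subset d b
  exact ⟨_, _, ((he.map (γ : G ≃g G)).shadow_subset hG).trans hγ,
    ((hf.map (γ : G ≃g G)).shadow_subset hG).trans hγ,
    (he.map (γ : G ≃g G)).shadow_disjoint hG (hf.map (γ : G ≃g G))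
      fun h => hne (mapDart_injective _ h)⟩

/-- An equivariant, absolutely continuous homeomorphism multiplies the visual measure by a constant
on some open set. On small sets the measures are nearly proportional; moving these to a fixed size
by elements of the groups does not change the ratios of measures. -/
theorem exists_eq_mul (hμ : IsVisualPair Γ δ x₀ μ) (hμ' : IsVisualPair Γ' δ y₀ μ')
    (hφ : IsEquivariant α φ) (hac : IsAbsolutelyContinuousMap φ μ μ') :
    ∃ (e : G.Dart) (s : ℝ), ∀ B, MeasurableSet B → B ⊆ endShadow e →
      μ'.real (φ '' B) = s * μ.real B := by
  have hfin := hμ.finite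
  have hfin' := hμ'.finite
  have hT := hμ.lattice.tree
  have hS := hμ'.lattice.tree
  set ν : Measure (Boundary H) := μ.map φ with hν
  have hφm : Measurable φ := φ.continuous.measurable
  have hνfin : IsFiniteMeasure ν := Measure.isFiniteMeasure_map μ φ
  have habs : μ' ≪ ν := Measure.AbsolutelyContinuous.mk fun A hA h0 => by
    rw [hν, Measure.map_apply hφm hA] at h0
    have := hac _ (hφm hA) h0
    rwa [Set.image_preimage_eq _ φ.surjective] at this
  have hμ'0 : μ' ≠ 0 := by
    rintro rfl
    obtain ⟨z, hz⟩ := (hS.nontrivial_neighbors y₀).nonempty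
    have := hμ'.endShadow_pos (d := ⟨(y₀, z), hz⟩) (fst_notMem_shadow _)
    simp at this
  obtain ⟨R, hRy, hR⟩ := hμ'.lattice.exists_finite_representatives_away y₀
  choose d hdy c hc using fun k : ℕ => exists_endShadow_approx hS habs hμ'0 y₀
    (show (0 : ℝ) < 1 / ((k : ℝ) + 1) by positivity)
  choose g hg using fun k => hR (d k)
  let U : Ultrafilter ℕ := Filter.hyperfilter ℕ
  have hU : (U : Filter ℕ) ≤ atTop := Nat.hyperfilter_le_atTop
  obtain ⟨r, hr, hgr⟩ : ∃ r ∈ R, ∀ᶠ k in U, mapDart (g k : H ≃g H) (d k) = r := by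
    have h1 : ∀ᶠ k in U, ∃ r ∈ (R : Set H.Dart), mapDart (g k : H ≃g H) (d k) = r :=
      Eventually.of_forall fun k => ⟨_, hg k, rfl⟩
    exact (Ultrafilter.eventually_exists_mem_iff R.finite_toSet).1 h1
  have hry := hRy r hr
  have hO : IsOpen (φ ⁻¹' endShadow r) := (isOpen_endShadow r).preimage φ.continuous
  obtain ⟨η, hη⟩ := endShadow_nonempty hS r
  obtain ⟨d₀, -, hd₀, -, hd₀O⟩ := exists_dart_subset hT.isTree hO
    (show φ.symm η ∈ φ ⁻¹' endShadow r by simpa using hη) x₀ x₀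
  obtain ⟨e₁, e₂, he₁, he₂, hdisj⟩ := hμ.lattice.exists_disjoint d₀
  obtain ⟨e, he, hge⟩ : ∃ e : G.Dart, shadow e ⊆ shadow d₀ ∧
      ∀ᶠ k in U, ((α.symm (g k) : Γ) : G ≃g G) x₀ ∉ shadow e := by
    have h1 : ∀ᶠ k in U, ((α.symm (g k) : Γ) : G ≃g G) x₀ ∉ shadow e₁ ∨
        ((α.symm (g k) : Γ) : G ≃g G) x₀ ∉ shadow e₂ := Eventually.of_forall fun k => by
      by_contra hcon
      push Not at hcon
      exact Set.disjoint_left.1 hdisj hcon.1 hcon.2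
    rcases Ultrafilter.eventually_or.1 h1 with h2 | h2
    · exact ⟨e₁, he₁, h2⟩
    · exact ⟨e₂, he₂, h2⟩
  have hex : x₀ ∉ shadow e := notMem_of_subset hd₀ he
  have heO : endShadow e ⊆ φ ⁻¹' endShadow r := (endShadow_mono he).trans hd₀O
  obtain ⟨ξ₀, hξ₀⟩ := endShadow_nonempty hT e
  -- the factors by which the group elements change the measures
  have key : ∃ s : ℕ → ℝ, ∀ᶠ k in U, ∀ B, MeasurableSet B → B ⊆ endShadow e →
      |μ'.real (φ '' B) - s k * μ.real B| ≤ 1 / ((k : ℝ) + 1) * μ'.real (endShadow r) := by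
    let β : ℕ → Γ := fun k => (α.symm (g k))⁻¹
    have hαβ : ∀ k, α (β k) = (g k)⁻¹ := fun k => by simp [β]
    let t : ℕ → ℝ := fun k => Real.exp (δ * busemann hT.isTree ξ₀ x₀ ((β k : G ≃g G).symm x₀))
    let t' : ℕ → ℝ := fun k => Real.exp
      (δ * busemann hS.isTree η y₀ ((((g k)⁻¹ : Γ') : H ≃g H).symm y₀))
    refine ⟨fun k => c k * t k / t' k, ?_⟩
    filter_upwards [hgr, hge] with k hk1 hk2 B hB hBe
    have ht' : 0 < t' k := Real.exp_pos _
    have hgy : (((g k)⁻¹ : Γ') : H ≃g H).symm y₀ ∉ shadow r := by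
      rw [← hk1, mem_shadow_mapDart']
      have h1 : (g k : H ≃g H).symm ((((g k)⁻¹ : Γ') : H ≃g H).symm y₀) = y₀ :=
        (g k : H ≃g H).symm_apply_apply y₀
      rw [h1]
      exact hdy k
    have hA : ∀ A, MeasurableSet A → A ⊆ endShadow r →
        μ'.real (boundaryMap (((g k)⁻¹ : Γ') : H ≃g H) '' A) = t' k * μ'.real A :=
      fun A hA hAr => hμ'.measureReal_image ((g k)⁻¹).2 hry hgy hη hA hAr
    have hB' : μ.real (boundaryMap (β k : G ≃g G) '' B) = t k * μ.real B :=
      hμ.measureReal_image (β k).2 hex hk2 hξ₀ hB hBe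
    have hd : endShadow (d k) = boundaryMap (((g k)⁻¹ : Γ') : H ≃g H) '' endShadow r := by
      rw [boundaryMap_image_endShadow, ← hk1]
      congr 1
      exact (mapDart_symm_mapDart (g k : H ≃g H) (d k)).symm
    have hφB : φ '' B ⊆ endShadow r := Set.image_subset_iff.2 (hBe.trans heO)
    have himg : φ '' (boundaryMap (β k : G ≃g G) '' B) =
        boundaryMap (((g k)⁻¹ : Γ') : H ≃g H) '' (φ '' B) := by
      rw [hφ.image_image, hαβ]
    have h1 := hc k (φ '' (boundaryMap (β k : G ≃g G) '' B))
      (measurableSet_image_homeo (measurableSet_boundaryMap_image _ hB)) (by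
        rw [himg, hd]
        exact Set.image_mono hφB)
    have h2 : ν.real (φ '' (boundaryMap (β k : G ≃g G) '' B)) = t k * μ.real B := by
      rw [← hB', hν, map_measureReal_apply hφm
        (measurableSet_image_homeo (measurableSet_boundaryMap_image _ hB)),
        Set.preimage_image_eq _ φ.injective]
    rw [h2, himg, hd, hA _ (measurableSet_image_homeo hB) hφB,
      hA _ (measurableSet_endShadow r) subset_rfl] at h1
    have h3 : t' k * μ'.real (φ '' B) - c k * (t k * μ.real B) =
        t' k * (μ'.real (φ '' B) - c k * t k / t' k * μ.real B) := by
      field_simp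
    rw [h3, abs_mul, abs_of_pos ht', mul_left_comm] at h1
    exact le_of_mul_le_mul_left h1 ht'
  obtain ⟨s, hs⟩ := key
  have hepos := hμ.endShadow_pos hex
  have herr : Tendsto (fun k : ℕ => 1 / ((k : ℝ) + 1) * μ'.real (endShadow r)) U (𝓝 0) := by
    have := (tendsto_one_div_add_atTop_nhds_zero_nat (𝕜 := ℝ)).mul_const (μ'.real (endShadow r))
    rw [zero_mul] at this
    exact this.mono_left hU
  have hlim : ∀ B, MeasurableSet B → B ⊆ endShadow e →
      Tendsto (fun k => s k * μ.real B) U (𝓝 (μ'.real (φ '' B))) := by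
    intro B hB hBe
    rw [tendsto_iff_norm_sub_tendsto_zero]
    refine squeeze_zero' (Eventually.of_forall fun k => norm_nonneg _) ?_ herr
    filter_upwards [hs] with k hk
    rw [norm_sub_rev]
    exact hk B hB hBe
  have hslim : Tendsto s U (𝓝 (μ'.real (φ '' endShadow e) / μ.real (endShadow e))) := by
    refine ((hlim _ (measurableSet_endShadow e) subset_rfl).div_const (μ.real (endShadow e))).congr
      fun k => ?_
    rw [mul_div_cancel_right₀ _ hepos.ne']
  exact ⟨e, _, fun B hB hBe => tendsto_nhds_unique (hlim B hB hBe) (hslim.mul_const _)⟩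

end Conjugacy

/-! ### The rigidity of equivariant homeomorphisms -/

section Rigidity

variable {V : Type u} {W : Type v} {G : SimpleGraph V} {H : SimpleGraph W}
  {Γ : Subgroup (G ≃g G)} {Γ' : Subgroup (H ≃g H)} {δ : ℝ} {x₀ : V} {y₀ : W}
  {μ : Measure (Boundary G)} {μ' : Measure (Boundary H)} {α : Γ ≃* Γ'}
  {φ : Boundary G ≃ₜ Boundary H}

/-- Near `ξ`, the homeomorphism `φ` multiplies the measures by the constant `c`. -/
def HasLocalFactor (φ : Boundary G ≃ₜ Boundary H) (μ : Measure (Boundary G))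
    (μ' : Measure (Boundary H)) (ξ : Boundary G) (c : ℝ) : Prop :=
  ∃ d : G.Dart, ξ ∈ endShadow d ∧ ∀ B, MeasurableSet B → B ⊆ endShadow d →
    μ'.real (φ '' B) = c * μ.real B

theorem HasLocalFactor.unique (hμ : IsVisualPair Γ δ x₀ μ) {ξ : Boundary G} {c c' : ℝ}
    (h : HasLocalFactor φ μ μ' ξ c) (h' : HasLocalFactor φ μ μ' ξ c') : c = c' := by
  obtain ⟨d, hξ, hd⟩ := h
  obtain ⟨d', hξ', hd'⟩ := h'
  have hO : IsOpen (endShadow d ∩ endShadow d') := (isOpen_endShadow d).inter (isOpen_endShadow d')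
  have h1 := hd _ hO.measurableSet Set.inter_subset_left
  rw [hd' _ hO.measurableSet Set.inter_subset_right] at h1
  exact (mul_right_cancel₀ (hμ.pos_of_isOpen hO ⟨ξ, hξ, hξ'⟩).ne' h1).symm

theorem HasLocalFactor.pos (hμ : IsVisualPair Γ δ x₀ μ) (hμ' : IsVisualPair Γ' δ y₀ μ')
    {ξ : Boundary G} {c : ℝ} (h : HasLocalFactor φ μ μ' ξ c) : 0 < c := by
  obtain ⟨d, hξ, hd⟩ := h
  have h1 := hd _ (measurableSet_endShadow d) subset_rfl
  have h2 := hμ.pos_of_isOpen (isOpen_endShadow d) ⟨ξ, hξ⟩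
  have h3 := hμ'.pos_of_isOpen (φ.isOpenMap _ (isOpen_endShadow d)) ⟨φ ξ, ξ, hξ, rfl⟩
  rw [h1] at h3
  exact pos_of_mul_pos_left h3 h2.le

/-- The factors at `ξ` and `γ ξ` differ by the conformal factors of `γ` and `α γ`. -/
theorem HasLocalFactor.map (hμ : IsVisualPair Γ δ x₀ μ) (hμ' : IsVisualPair Γ' δ y₀ μ')
    (hφ : IsEquivariant α φ) {ξ : Boundary G} {c : ℝ} (h : HasLocalFactor φ μ μ' ξ c) (γ : Γ) :
    HasLocalFactor φ μ μ' (boundaryMap (γ : G ≃g G) ξ)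
      (c * Real.exp (δ * (busemann hμ'.lattice.tree.isTree (φ ξ) y₀ ((α γ : H ≃g H).symm y₀) -
        busemann hμ.lattice.tree.isTree ξ x₀ ((γ : G ≃g G).symm x₀)))) := by
  have hG := hμ.lattice.tree.isTree
  have hH := hμ'.lattice.tree.isTree
  obtain ⟨d₀, hξ₀, hd₀⟩ := h
  obtain ⟨f, hf, hf1, hf2⟩ := exists_dart_away hH y₀ ((α γ : H ≃g H).symm y₀) (φ ξ)
  obtain ⟨d, hξ, hd1, hd2, hsub⟩ := exists_dart_subset hG
    ((isOpen_endShadow d₀).inter ((isOpen_endShadow f).preimage φ.continuous))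
    (show ξ ∈ endShadow d₀ ∩ φ ⁻¹' endShadow f from ⟨hξ₀, hf⟩) x₀ ((γ : G ≃g G).symm x₀)
  refine ⟨mapDart (γ : G ≃g G) d, (mem_endShadow_mapDart (γ : G ≃g G)).2 hξ, fun B hB hBd => ?_⟩
  rw [← boundaryMap_image_endShadow] at hBd
  have hBimg : B = boundaryMap (γ : G ≃g G) '' (boundaryMap (γ : G ≃g G) ⁻¹' B) :=
    (Set.image_preimage_eq_of_subset (hBd.trans (Set.image_subset_range _ _))).symm
  set A := boundaryMap (γ : G ≃g G) ⁻¹' B with hA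
  have hAm : MeasurableSet A := measurable_boundaryMap (γ : G ≃g G) hB
  have hAd : A ⊆ endShadow d := by
    intro ζ hζ
    have h1 : boundaryMap (γ : G ≃g G) ζ ∈ endShadow (mapDart (γ : G ≃g G) d) := by
      rw [← boundaryMap_image_endShadow]
      exact hBd hζ
    exact (mem_endShadow_mapDart (γ : G ≃g G)).1 h1
  have h1 := hμ.measureReal_image γ.2 hd1 hd2 hξ hAm hAd
  have h2 := hμ'.measureReal_image (α γ).2 hf1 hf2 hf (measurableSet_image_homeo hAm)
    (Set.image_subset_iff.2 fun ζ hζ => (hsub (hAd hζ)).2)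
  rw [hBimg, hφ.image_image, h2, h1, hd₀ A hAm fun ζ hζ => (hsub (hAd hζ)).1, mul_sub, Real.exp_sub]
  field_simp

theorem exists_hasLocalFactor (hμ : IsVisualPair Γ δ x₀ μ) (hμ' : IsVisualPair Γ' δ y₀ μ')
    (hφ : IsEquivariant α φ) (hac : IsAbsolutelyContinuousMap φ μ μ') (ξ : Boundary G) :
    ∃ c, HasLocalFactor φ μ μ' ξ c := by
  have hG := hμ.lattice.tree.isTree
  obtain ⟨e, s, he⟩ := exists_eq_mul hμ hμ' hφ hac
  obtain ⟨d, -, hξ⟩ := exists_dart_mem_endShadow hG x₀ ξ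
  obtain ⟨γ, hγ⟩ := hμ.lattice.exists_mapDart_subset e d
  have h1 : HasLocalFactor φ μ μ' (boundaryMap (γ : G ≃g G) ξ) s :=
    ⟨e, endShadow_mono hγ ((mem_endShadow_mapDart (γ : G ≃g G)).2 hξ), he⟩
  have h2 := h1.map hμ hμ' hφ γ⁻¹
  have h3 : boundaryMap ((γ⁻¹ : Γ) : G ≃g G) (boundaryMap (γ : G ≃g G) ξ) = ξ :=
    boundaryMapIso_symm_apply (γ : G ≃g G) ξ
  rw [h3] at h2
  exact ⟨_, h2⟩

/-- A function of pairs of distinct boundary points which is locally constant and invariant is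
constant, by topological transitivity. -/
theorem IsUniformLattice.eq_of_invariant (hU : IsUniformLattice Γ)
    {E : Boundary G → Boundary G → ℝ}
    (hinv : ∀ (γ : Γ) ξ η, ξ ≠ η →
      E (boundaryMap (γ : G ≃g G) ξ) (boundaryMap (γ : G ≃g G) η) = E ξ η)
    (hloc : ∀ ξ η, ξ ≠ η → ∃ d e : G.Dart, ξ ∈ endShadow d ∧ η ∈ endShadow e ∧
      Disjoint (shadow d) (shadow e) ∧ ∀ ξ' ∈ endShadow d, ∀ η' ∈ endShadow e, E ξ' η' = E ξ η)
    {ξ η ξ' η' : Boundary G} (h : ξ ≠ η) (h' : ξ' ≠ η') : E ξ η = E ξ' η' := by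
  have hG := hU.tree.isTree
  obtain ⟨a, b, ha, hb, hab, hE⟩ := hloc ξ η h
  obtain ⟨a', b', ha', hb', hab', hE'⟩ := hloc ξ' η' h'
  have hdisj : ∀ {d e : G.Dart}, Disjoint (shadow d) (shadow e) → shadow d ⊆ shadow e.symm :=
    fun hde z hz => (notMem_shadow_iff hG).1 (Set.disjoint_left.1 hde hz)
  -- one element maps the complement of `U(b)` into `U(a')`
  obtain ⟨γ, hγ⟩ := hU.exists_mapDart_subset a' b.symm
  have h1 : boundaryMap (γ : G ≃g G) ξ ∈ endShadow a' :=
    endShadow_mono hγ ((mem_endShadow_mapDart (γ : G ≃g G)).2 (endShadow_mono (hdisj hab) ha))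
  have h2 : η' ∈ endShadow (mapDart (γ : G ≃g G) b) := by
    have h3 := shadow_symm_subset_symm hG hγ
    rw [mapDart_symm_dart, SimpleGraph.Dart.symm_symm] at h3
    exact endShadow_mono ((hdisj hab'.symm).trans h3) hb'
  obtain ⟨ζ, hζ, rfl⟩ : ∃ ζ ∈ endShadow b, boundaryMap (γ : G ≃g G) ζ = η' := by
    rw [← boundaryMap_image_endShadow] at h2
    exact h2
  have hne : ξ ≠ ζ := fun e => Set.disjoint_left.1 (endShadow_disjoint hab) ha (e ▸ hζ)
  rw [← hE ξ ha ζ hζ, ← hE' _ h1 _ hb', hinv γ ξ ζ hne]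

/-- If an equivariant homeomorphism of the boundaries is absolutely continuous for visual measures
of the same dimension, then it is induced by an isomorphism of the trees. The local factors of the
measures form a coboundary, by which the Gromov products change up to a constant. -/
theorem exists_iso_of_absolutelyContinuous (hδ : 0 < δ) (hμ : IsVisualPair Γ δ x₀ μ)
    (hμ' : IsVisualPair Γ' δ y₀ μ') (hφ : IsEquivariant α φ)
    (hac : IsAbsolutelyContinuousMap φ μ μ') :
    ∃ F : G ≃g H, ∀ ξ, boundaryMapIso F ξ = φ ξ := by
  have hG := hμ.lattice.tree.isTree
  have hH := hμ'.lattice.tree.isTree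
  choose c hc using exists_hasLocalFactor hμ hμ' hφ hac
  have hcpos : ∀ ξ, 0 < c ξ := fun ξ => (hc ξ).pos hμ hμ'
  let u : Boundary G → ℝ := fun ξ => Real.log (c ξ) / δ
  have hu : ∀ (γ : Γ) ξ, u (boundaryMap (γ : G ≃g G) ξ) = u ξ +
      (busemann hH (φ ξ) y₀ ((α γ : H ≃g H).symm y₀) -
        busemann hG ξ x₀ ((γ : G ≃g G).symm x₀)) := by
    intro γ ξ
    have h1 := (hc (boundaryMap (γ : G ≃g G) ξ)).unique hμ ((hc ξ).map hμ hμ' hφ γ)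
    simp only [u]
    rw [h1, Real.log_mul (hcpos ξ).ne' (Real.exp_pos _).ne', Real.log_exp]
    field_simp
  have huloc : ∀ ξ, ∃ d : G.Dart, ξ ∈ endShadow d ∧ ∀ ξ' ∈ endShadow d, u ξ' = u ξ := by
    intro ξ
    obtain ⟨d, hξ, hd⟩ := hc ξ
    refine ⟨d, hξ, fun ξ' hξ' => ?_⟩
    have h1 : c ξ' = c ξ := (hc ξ').unique hμ ⟨d, hξ', hd⟩
    simp only [u, h1]
  let E : Boundary G → Boundary G → ℝ := fun ξ η =>
    2 * (gromovProduct hH y₀ (φ ξ) (φ η) : ℝ) - 2 * gromovProduct hG x₀ ξ η + u ξ + u η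
  have hinv : ∀ (γ : Γ) ξ η, ξ ≠ η →
      E (boundaryMap (γ : G ≃g G) ξ) (boundaryMap (γ : G ≃g G) η) = E ξ η := by
    intro γ ξ η hne
    have hne' : φ ξ ≠ φ η := φ.injective.ne hne
    have h1 := gromovProduct_mapIso hG hG (γ : G ≃g G) ((γ : G ≃g G).symm x₀) hne
    have h2 := gromovProduct_mapIso hH hH (α γ : H ≃g H) ((α γ : H ≃g H).symm y₀) hne'
    rw [RelIso.apply_symm_apply, boundaryMapIso_eq_boundaryMap] at h1 h2
    have h3 : 2 * (gromovProduct hG x₀ ξ η : ℝ) -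
        2 * gromovProduct hG ((γ : G ≃g G).symm x₀) ξ η =
        busemann hG ξ x₀ ((γ : G ≃g G).symm x₀) + busemann hG η x₀ ((γ : G ≃g G).symm x₀) := by
      exact_mod_cast gromovProduct_sub hG hne x₀ ((γ : G ≃g G).symm x₀)
    have h4 : 2 * (gromovProduct hH y₀ (φ ξ) (φ η) : ℝ) -
        2 * gromovProduct hH ((α γ : H ≃g H).symm y₀) (φ ξ) (φ η) =
        busemann hH (φ ξ) y₀ ((α γ : H ≃g H).symm y₀) +
          busemann hH (φ η) y₀ ((α γ : H ≃g H).symm y₀) := by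
      exact_mod_cast gromovProduct_sub hH hne' y₀ ((α γ : H ≃g H).symm y₀)
    simp only [E]
    rw [hφ γ ξ, hφ γ η, h1, h2, hu γ ξ, hu γ η]
    linarith
  have hloc : ∀ ξ η, ξ ≠ η → ∃ d e : G.Dart, ξ ∈ endShadow d ∧ η ∈ endShadow e ∧
      Disjoint (shadow d) (shadow e) ∧
      ∀ ξ' ∈ endShadow d, ∀ η' ∈ endShadow e, E ξ' η' = E ξ η := by
    intro ξ η hne
    obtain ⟨d₁, e₁, hd₁, he₁, hdis, h1⟩ := exists_gromovProduct_eq hG hne x₀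
    obtain ⟨d₂, e₂, hd₂, he₂, -, h2⟩ := exists_gromovProduct_eq hH (φ.injective.ne hne) y₀
    obtain ⟨d₃, hd₃, h3⟩ := huloc ξ
    obtain ⟨e₃, he₃, h4⟩ := huloc η
    have key : ∀ {ζ : Boundary G} {a₁ a₃ : G.Dart} {a₂ : H.Dart}, ζ ∈ endShadow a₁ →
        φ ζ ∈ endShadow a₂ → ζ ∈ endShadow a₃ → ∃ a : G.Dart, ζ ∈ endShadow a ∧
          shadow a ⊆ shadow a₁ ∧ endShadow a ⊆ φ ⁻¹' endShadow a₂ ∩ endShadow a₃ := by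
      intro ζ a₁ a₃ a₂ k1 k2 k3
      obtain ⟨r, hr⟩ := _root_.Quotient.exists_rep ζ
      have hr : r.Represents ζ := hr
      obtain ⟨N, hN⟩ := hr.exists_shadow_subset hG k1
      obtain ⟨M, hM⟩ := hr.exists_endShadow_subset hG
        (((isOpen_endShadow a₂).preimage φ.continuous).inter (isOpen_endShadow a₃))
        (show ζ ∈ φ ⁻¹' endShadow a₂ ∩ endShadow a₃ from ⟨k2, k3⟩)
      exact ⟨r.dart (N + M), hr.mem_endShadow _, hN _ (by omega), hM _ (by omega)⟩
    obtain ⟨d, hd, hd1, hd2⟩ := key hd₁ hd₂ hd₃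
    obtain ⟨e, he, he1, he2⟩ := key he₁ he₂ he₃
    refine ⟨d, e, hd, he, hdis.mono hd1 he1, fun ξ' hξ' η' hη' => ?_⟩
    simp only [E]
    rw [h1 ξ' (endShadow_mono hd1 hξ') η' (endShadow_mono he1 hη'),
      h2 _ (hd2 hξ').1 _ (he2 hη').1, h3 ξ' (hd2 hξ').2, h4 η' (he2 hη').2]
  have h3 := exists_three_boundary_points hμ.lattice.tree hμ.lattice.branching
  obtain ⟨a, b, -, hab, -, -⟩ := h3
  refine exists_iso_of_gromovProduct_sub hμ.lattice.tree hμ'.lattice.tree φ.toEquiv x₀ y₀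
    (exists_three_boundary_points hμ.lattice.tree hμ.lattice.branching)
    (fun ξ => E a b / 2 - u ξ) fun ξ η hne => ?_
  have h5 := hμ.lattice.eq_of_invariant hinv hloc hab hne
  have h6 : E ξ η = 2 * (gromovProduct hH y₀ (φ ξ) (φ η) : ℝ) -
    2 * gromovProduct hG x₀ ξ η + u ξ + u η := rfl
  change 2 * (gromovProduct hH y₀ (φ ξ) (φ η) : ℝ) - 2 * gromovProduct hG x₀ ξ η = _
  linarith

/-- An isomorphism that induces an equivariant map of the boundaries is equivariant. -/
theorem IsEquivariant.apply_eq (hU : IsUniformLattice Γ) (hφ : IsEquivariant α φ) {F : G ≃g H}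
    (hF : ∀ ξ, boundaryMapIso F ξ = φ ξ) (γ : Γ) (z : V) :
    F ((γ : G ≃g G) z) = (α γ : H ≃g H) (F z) := by
  refine eq_of_boundaryMapIso_eq hU.tree (exists_three_boundary_points hU.tree hU.branching)
    ((γ : G ≃g G).trans F) (F.trans (α γ : H ≃g H)) (fun ξ => ?_) z
  rw [boundaryMapIso_trans, boundaryMapIso_trans, hF, hF, boundaryMapIso_eq_boundaryMap, boundaryMapIso_eq_boundaryMap]
  exact hφ γ ξ

end Rigidity

/-! ### Isomorphisms of quotient graphs -/

section QuotientGraphs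

variable {V : Type u} {W : Type v} {G : SimpleGraph V} {H : SimpleGraph W}
  {Γ : Subgroup (G ≃g G)} {Γ' : Subgroup (H ≃g H)}
  {hΓ : ∀ γ ∈ Γ, ActsWithoutInversion γ} {hΓ' : ∀ γ ∈ Γ', ActsWithoutInversion γ}

/-- The vertex of the quotient graph below a vertex of the tree. -/
def vertClass (hΓ : ∀ γ ∈ Γ, ActsWithoutInversion γ) (z : V) : (quotientGraph Γ hΓ).Vert :=
  _root_.Quotient.mk (vertSetoid Γ) z

/-- The edge of the quotient graph below an oriented edge of the tree. -/
def dartClass (hΓ : ∀ γ ∈ Γ, ActsWithoutInversion γ) (d : G.Dart) : (quotientGraph Γ hΓ).Edge :=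
  _root_.Quotient.mk (dartSetoid Γ) d

theorem vertClass_eq_iff {z w : V} : vertClass hΓ z = vertClass hΓ w ↔ ∃ γ ∈ Γ, γ z = w :=
  ⟨fun h => _root_.Quotient.exact h, fun h => _root_.Quotient.sound h⟩

theorem dartClass_eq_iff {d e : G.Dart} :
    dartClass hΓ d = dartClass hΓ e ↔ ∃ γ ∈ Γ, mapDart γ d = e := by
  constructor
  · intro h
    obtain ⟨γ, hγ, h1, h2⟩ := _root_.Quotient.exact h
    exact ⟨γ, hγ, Dart.ext' h1 h2⟩
  · rintro ⟨γ, hγ, rfl⟩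
    exact _root_.Quotient.sound ⟨γ, hγ, rfl, rfl⟩

theorem exists_dartClass_eq (q : (quotientGraph Γ hΓ).Edge) : ∃ d, dartClass hΓ d = q :=
  _root_.Quotient.exists_rep q

theorem src_dartClass (d : G.Dart) :
    (quotientGraph Γ hΓ).src (dartClass hΓ d) = vertClass hΓ d.fst := rfl

theorem tgt_dartClass (d : G.Dart) :
    (quotientGraph Γ hΓ).tgt (dartClass hΓ d) = vertClass hΓ d.snd := rfl

theorem rev_dartClass (d : G.Dart) :
    (quotientGraph Γ hΓ).rev (dartClass hΓ d) = dartClass hΓ d.symm := rfl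

/-- The group acts freely on the vertices. -/
def ActsFreely (Γ : Subgroup (G ≃g G)) : Prop := ∀ γ ∈ Γ, ∀ x, γ x = x → γ = 1

/-- An oriented edge is determined by its class and its origin. -/
theorem ActsFreely.eq_of_dartClass_eq (hf : ActsFreely Γ) {d e : G.Dart} (h : d.fst = e.fst)
    (h' : dartClass hΓ d = dartClass hΓ e) : d = e := by
  obtain ⟨γ, hγ, rfl⟩ := dartClass_eq_iff.1 h'
  rw [hf γ hγ d.fst h.symm]
  rfl

theorem exists_dart_of_src {q : (quotientGraph Γ hΓ).Edge} {z : V}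
    (h : (quotientGraph Γ hΓ).src q = vertClass hΓ z) :
    ∃ d : G.Dart, d.fst = z ∧ dartClass hΓ d = q := by
  obtain ⟨d, rfl⟩ := exists_dartClass_eq q
  rw [src_dartClass] at h
  obtain ⟨γ, hγ, h1⟩ := vertClass_eq_iff.1 h
  exact ⟨mapDart γ d, h1, (dartClass_eq_iff.2 ⟨γ, hγ, rfl⟩).symm⟩

/-- The vertex map `F` lifts the isomorphism `ι` of the quotient graphs. -/
def IsLift (ι : SerreGraph.Iso (quotientGraph Γ hΓ) (quotientGraph Γ' hΓ')) (F : V → W) : Prop :=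
  (∀ z, vertClass hΓ' (F z) = ι.vert (vertClass hΓ z)) ∧
    ∀ d : G.Dart, ∃ e : H.Dart, e.fst = F d.fst ∧ e.snd = F d.snd ∧
      dartClass hΓ' e = ι.edge (dartClass hΓ d)

variable {ι : SerreGraph.Iso (quotientGraph Γ hΓ) (quotientGraph Γ' hΓ')}

/-- The lift is constructed by recursion on the distance from a base vertex. -/
theorem exists_isLift (hG : G.IsTree)
    (ι : SerreGraph.Iso (quotientGraph Γ hΓ) (quotientGraph Γ' hΓ')) : ∃ F, IsLift ι F := by
  classical
  obtain ⟨x⟩ := hG.connected.nonempty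
  obtain ⟨y, hy⟩ : ∃ y, vertClass hΓ' y = ι.vert (vertClass hΓ x) := _root_.Quotient.exists_rep _
  have hlift : ∀ (d : G.Dart) (w : W), ∃ e : H.Dart,
      vertClass hΓ' w = ι.vert (vertClass hΓ d.fst) →
        e.fst = w ∧ dartClass hΓ' e = ι.edge (dartClass hΓ d) := by
    intro d w
    by_cases h : vertClass hΓ' w = ι.vert (vertClass hΓ d.fst)
    · obtain ⟨e, he⟩ := exists_dart_of_src (hΓ := hΓ') (q := ι.edge (dartClass hΓ d)) (z := w) (by
        rw [ι.src_edge, h, src_dartClass])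
      exact ⟨e, fun _ => he⟩
    · obtain ⟨e, -⟩ := exists_dartClass_eq (ι.edge (dartClass hΓ d))
      exact ⟨e, fun h' => absurd h' h⟩
  choose L hL using hlift
  choose p hp hpx using fun (z : V) (h : z ≠ x) => exists_dart_to hG h
  let f : ℕ → V → W := fun n => Nat.rec (fun _ => y)
    (fun _ f z => if h : z = x then y else (L (p z h) (f (p z h).fst)).snd) n
  let F : V → W := fun z => f (G.dist x z) z
  have hFx : F x = y := by
    simp only [F, SimpleGraph.dist_self]
    rfl
  have hF : ∀ d : G.Dart, x ∉ shadow d → F d.snd = (L d (F d.fst)).snd := by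
    intro d hd
    have hne : d.snd ≠ x := fun e => hd (e ▸ snd_mem_shadow d)
    have h1 : p d.snd hne = d := dart_eq_of_snd_eq hG (hpx _ hne) hd (hp _ hne)
    have h2 : F d.snd = (L (p d.snd hne) (f (G.dist x d.fst) (p d.snd hne).fst)).snd := by
      simp only [F]
      rw [dist_snd_of_notMem hG hd]
      simp only [f]
      rw [dif_neg hne]
    rw [h2, h1]
  have hclass : ∀ n z, G.dist x z = n → vertClass hΓ' (F z) = ι.vert (vertClass hΓ z) := by
    intro n
    induction n with
    | zero =>
      intro z hz
      rw [hG.connected.dist_eq_zero_iff] at hz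
      rw [← hz, hFx, hy]
    | succ n ih =>
      intro z hz
      have hne : z ≠ x := fun e => by
        rw [e, SimpleGraph.dist_self] at hz
        omega
      obtain ⟨d, rfl, hd⟩ := exists_dart_to hG hne
      rw [dist_snd_of_notMem hG hd] at hz
      rw [hF d hd, ← tgt_dartClass, (hL d _ (ih d.fst (by omega))).2, ι.tgt_edge, tgt_dartClass]
  refine ⟨F, fun z => hclass _ z rfl, fun d => ?_⟩
  by_cases hd : x ∈ shadow d
  · have hd' : x ∉ shadow d.symm := (notMem_shadow_iff hG).2 hd
    have h1 := hL d.symm _ (hclass _ d.symm.fst rfl)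
    refine ⟨(L d.symm (F d.symm.fst)).symm, (hF d.symm hd').symm, h1.1, ?_⟩
    rw [← rev_dartClass, h1.2, ι.rev_edge, rev_dartClass, SimpleGraph.Dart.symm_symm]
  · have h1 := hL d _ (hclass _ d.fst rfl)
    exact ⟨L d (F d.fst), h1.1, (hF d hd).symm, h1.2⟩

theorem IsLift.adj {F : V → W} (hF : IsLift ι F) {x y : V} (h : G.Adj x y) :
    H.Adj (F x) (F y) := by
  obtain ⟨e, h1, h2, -⟩ := hF.2 ⟨(x, y), h⟩
  have := e.adj
  rwa [h1, h2] at this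

/-- A lift is locally injective. -/
theorem IsLift.snd_eq {F : V → W} (hF : IsLift ι F) (hf : ActsFreely Γ) {d e : G.Dart}
    (h : d.fst = e.fst) (h' : F d.snd = F e.snd) : d = e := by
  obtain ⟨d', h1, h2, h3⟩ := hF.2 d
  obtain ⟨e', h4, h5, h6⟩ := hF.2 e
  have h7 : d' = e' := Dart.ext' (by rw [h1, h4, h]) (by rw [h2, h5, h'])
  rw [h7, h6] at h3
  exact hf.eq_of_dartClass_eq h (ι.edge.injective h3).symm

theorem IsLift.dist_eq {F : V → W} (hF : IsLift ι F) (hf : ActsFreely Γ)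
    (hT : IsLocallyFiniteLeaflessTree G) (hH : H.IsTree) (a b : V) :
    H.dist (F a) (F b) = G.dist a b := by
  obtain ⟨ξ, hξ⟩ := exists_rayTo_eq hT a b
  set r := rayTo hT.isTree a ξ with hr
  have h0 : r.toFun 0 = a := rayTo_zero hT.isTree a ξ
  have h1 := dist_eq_of_nonbacktracking hH (f := fun n => F (r.toFun n))
    (fun n => hF.adj (r.adj n)) (fun n h2 => ?_) 0 (G.dist a b)
  · simpa [h0, hξ] using h1
  · have h3 := hF.snd_eq hf (d := r.dart (n + 1)) (e := (r.dart n).symm) rfl h2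
    exact r.ne_add_two n (congrArg (fun d : G.Dart => d.snd) h3)

/-- A lift is locally surjective. -/
theorem IsLift.exists_adj {F : V → W} (hF : IsLift ι F) (hf' : ActsFreely Γ') {x : V} {w : W}
    (h : H.Adj (F x) w) : ∃ y, G.Adj x y ∧ F y = w := by
  let e : H.Dart := ⟨(F x, w), h⟩
  obtain ⟨d, hd, hq⟩ := exists_dart_of_src (hΓ := hΓ) (q := ι.edge.symm (dartClass hΓ' e))
    (z := x) (ι.vert.injective (by
      rw [← ι.src_edge, Equiv.apply_symm_apply, src_dartClass, ← hF.1 x]))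
  obtain ⟨e', h1, h2, h3⟩ := hF.2 d
  rw [hq, Equiv.apply_symm_apply] at h3
  have h4 : e' = e := hf'.eq_of_dartClass_eq (by rw [h1, hd]) h3
  refine ⟨d.snd, hd ▸ d.adj, ?_⟩
  rw [← h2, h4]

theorem IsLift.surjective {F : V → W} (hF : IsLift ι F) (hf' : ActsFreely Γ') (hG : G.IsTree)
    (hH : H.IsTree) : Function.Surjective F := by
  obtain ⟨x⟩ := hG.connected.nonempty
  intro w
  obtain ⟨p⟩ := hH.connected.preconnected (F x) w
  generalize hz : F x = z at p
  induction p generalizing x with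
  | nil => exact ⟨x, hz⟩
  | cons h p ih =>
    rw [← hz] at h
    obtain ⟨y, -, hy⟩ := hF.exists_adj hf' h
    exact ih y hy

theorem IsLift.injective {F : V → W} (hF : IsLift ι F) (hf : ActsFreely Γ)
    (hT : IsLocallyFiniteLeaflessTree G) (hH : H.IsTree) : Function.Injective F := by
  intro a b hab
  rw [← hT.isTree.connected.dist_eq_zero_iff, ← hF.dist_eq hf hT hH, hab, SimpleGraph.dist_self]

/-- Two lifts that agree at one vertex agree. -/
theorem IsLift.eq {F F' : V → W} (hF : IsLift ι F) (hF' : IsLift ι F') (hf' : ActsFreely Γ')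
    (hG : G.IsTree) {x : V} (h : F x = F' x) (z : V) : F z = F' z := by
  obtain ⟨p⟩ := hG.connected.preconnected x z
  induction p with
  | nil => exact h
  | @cons a b _ hab p ih =>
    refine ih ?_
    obtain ⟨e, h1, h2, h3⟩ := hF.2 ⟨(a, b), hab⟩
    obtain ⟨e', h4, h5, h6⟩ := hF'.2 ⟨(a, b), hab⟩
    have h7 : e = e' := hf'.eq_of_dartClass_eq (by rw [h1, h4]; exact h) (h3.trans h6.symm)
    exact h2.symm.trans ((congrArg (fun d : H.Dart => d.snd) h7).trans h5)

theorem vertClass_apply {γ : G ≃g G} (hγ : γ ∈ Γ) (z : V) :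
    vertClass hΓ (γ z) = vertClass hΓ z :=
  (vertClass_eq_iff.2 ⟨γ, hγ, rfl⟩).symm

theorem dartClass_mapDart {γ : G ≃g G} (hγ : γ ∈ Γ) (d : G.Dart) :
    dartClass hΓ (mapDart γ d) = dartClass hΓ d :=
  (dartClass_eq_iff.2 ⟨γ, hγ, rfl⟩).symm

theorem IsLift.comp_right {F : V → W} (hF : IsLift ι F) {γ : G ≃g G} (hγ : γ ∈ Γ) :
    IsLift ι fun z => F (γ z) := by
  refine ⟨fun z => by rw [hF.1, vertClass_apply hγ], fun d => ?_⟩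
  obtain ⟨e, h1, h2, h3⟩ := hF.2 (mapDart γ d)
  exact ⟨e, h1, h2, by rw [h3, dartClass_mapDart hγ]⟩

theorem IsLift.comp_left {F : V → W} (hF : IsLift ι F) {γ : H ≃g H} (hγ : γ ∈ Γ') :
    IsLift ι fun z => γ (F z) := by
  refine ⟨fun z => by rw [vertClass_apply hγ, hF.1], fun d => ?_⟩
  obtain ⟨e, h1, h2, h3⟩ := hF.2 d
  exact ⟨mapDart γ e, congrArg γ h1, congrArg γ h2, by rw [dartClass_mapDart hγ, h3]⟩

/-- Isomorphic quotient graphs of free actions come from conjugate actions: an isomorphism lifts to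
the universal coverings. -/
theorem exists_conjugacy_of_iso (hT : IsLocallyFiniteLeaflessTree G)
    (hS : IsLocallyFiniteLeaflessTree H) (hf : ActsFreely Γ) (hf' : ActsFreely Γ')
    (ι : SerreGraph.Iso (quotientGraph Γ hΓ) (quotientGraph Γ' hΓ')) :
    ∃ (α : Γ ≃* Γ') (F : V → W), Function.Bijective F ∧
      (∀ a b, H.dist (F a) (F b) = G.dist a b) ∧
      ∀ (γ : Γ) (a : V), F ((γ : G ≃g G) a) = (α γ : H ≃g H) (F a) := by
  have hG := hT.isTree
  have hH := hS.isTree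
  obtain ⟨F, hF⟩ := exists_isLift hG ι
  have hbij : Function.Bijective F := ⟨hF.injective hf hT hH, hF.surjective hf' hG hH⟩
  obtain ⟨x⟩ := hG.connected.nonempty
  have h1 : ∀ γ : Γ, ∃ β : Γ', ∀ z, F ((γ : G ≃g G) z) = (β : H ≃g H) (F z) := by
    intro γ
    have h2 : vertClass hΓ' (F x) = vertClass hΓ' (F ((γ : G ≃g G) x)) := by
      rw [hF.1, hF.1, vertClass_apply γ.2]
    obtain ⟨β, hβ, h3⟩ := vertClass_eq_iff.1 h2
    exact ⟨⟨β, hβ⟩, (hF.comp_right γ.2).eq (hF.comp_left hβ) hf' hG h3.symm⟩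
  have h2 : ∀ β : Γ', ∃ γ : Γ, ∀ z, F ((γ : G ≃g G) z) = (β : H ≃g H) (F z) := by
    intro β
    obtain ⟨y, hy⟩ := hbij.2 ((β : H ≃g H) (F x))
    have h3 : vertClass hΓ x = vertClass hΓ y := ι.vert.injective (by
      rw [← hF.1, ← hF.1, hy, vertClass_apply β.2])
    obtain ⟨γ, hγ, h4⟩ := vertClass_eq_iff.1 h3
    refine ⟨⟨γ, hγ⟩, (hF.comp_right hγ).eq (hF.comp_left β.2) hf' hG (x := x) ?_⟩
    rw [h4, hy]
  choose α hα using h1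
  choose α' hα' using h2
  have huniq : ∀ {β β' : Γ'}, (β : H ≃g H) (F x) = (β' : H ≃g H) (F x) → β = β' := by
    intro β β' h
    have h3 : ((β'⁻¹ * β : Γ') : H ≃g H) (F x) = F x := by
      change (β' : H ≃g H).symm ((β : H ≃g H) (F x)) = F x
      rw [h]
      exact (β' : H ≃g H).symm_apply_apply _
    exact (inv_mul_eq_one.1 (Subtype.ext (hf' _ (β'⁻¹ * β).2 _ h3))).symm
  have huniq' : ∀ {γ γ' : Γ}, (γ : G ≃g G) x = (γ' : G ≃g G) x → γ = γ' := by
    intro γ γ' h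
    have h3 : ((γ'⁻¹ * γ : Γ) : G ≃g G) x = x := by
      change (γ' : G ≃g G).symm ((γ : G ≃g G) x) = x
      rw [h]
      exact (γ' : G ≃g G).symm_apply_apply _
    exact (inv_mul_eq_one.1 (Subtype.ext (hf _ (γ'⁻¹ * γ).2 _ h3))).symm
  refine ⟨{ toFun := α, invFun := α', left_inv := fun γ => ?_, right_inv := fun β => ?_,
            map_mul' := fun γ γ' => ?_ }, F, hbij, hF.dist_eq hf hT hH, hα⟩
  · exact huniq' (hbij.1 (by rw [hα', hα]))
  · exact huniq (by rw [← hα, hα'])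
  · refine huniq ?_
    rw [← hα]
    change F ((γ : G ≃g G) ((γ' : G ≃g G) x)) = (α γ : H ≃g H) ((α γ' : H ≃g H) (F x))
    rw [hα, hα]

/-- The bijection between the oriented edges that an isomorphism of graphs induces. -/
def mapDartEquiv (F : G ≃g H) : G.Dart ≃ H.Dart where
  toFun := mapDart F
  invFun := mapDart F.symm
  left_inv d := mapDart_symm_mapDart F d
  right_inv d := mapDart_mapDart_symm F d

/-- Conjugate actions have isomorphic quotient graphs. -/
theorem nonempty_iso_of_conjugacy (α : Γ ≃* Γ') (F : G ≃g H)
    (h : ∀ (γ : Γ) (a : V), F ((γ : G ≃g G) a) = (α γ : H ≃g H) (F a)) :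
    Nonempty (SerreGraph.Iso (quotientGraph Γ hΓ) (quotientGraph Γ' hΓ')) := by
  have hdart : ∀ (γ : Γ) (d : G.Dart),
      mapDart F (mapDart (γ : G ≃g G) d) = mapDart (α γ : H ≃g H) (mapDart F d) :=
    fun γ d => Dart.ext' (h γ _) (h γ _)
  refine ⟨{ vert := _root_.Quotient.congr F.toEquiv fun a b => ?_
            edge := _root_.Quotient.congr (mapDartEquiv F) fun d e => ?_
            src_edge := ?_
            tgt_edge := ?_
            rev_edge := ?_ }⟩
  · constructor
    · rintro ⟨γ, hγ, rfl⟩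
      exact ⟨α ⟨γ, hγ⟩, (α ⟨γ, hγ⟩).2, (h ⟨γ, hγ⟩ a).symm⟩
    · rintro ⟨β, hβ, h1⟩
      have h2 := h (α.symm ⟨β, hβ⟩) a
      rw [α.apply_symm_apply] at h2
      exact ⟨_, (α.symm ⟨β, hβ⟩).2, F.injective (h2.trans h1)⟩
  · constructor
    · rintro ⟨γ, hγ, h1, h2⟩
      refine ⟨α ⟨γ, hγ⟩, (α ⟨γ, hγ⟩).2, ?_, ?_⟩
      · exact (h ⟨γ, hγ⟩ d.fst).symm.trans (congrArg F h1)
      · exact (h ⟨γ, hγ⟩ d.snd).symm.trans (congrArg F h2)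
    · rintro ⟨β, hβ, h1, h2⟩
      have h3 := h (α.symm ⟨β, hβ⟩)
      rw [α.apply_symm_apply] at h3
      exact ⟨_, (α.symm ⟨β, hβ⟩).2, F.injective ((h3 _).trans h1),
        F.injective ((h3 _).trans h2)⟩
  · rintro ⟨d⟩
    rfl
  · rintro ⟨d⟩
    rfl
  · rintro ⟨d⟩
    rfl

end QuotientGraphs

/-! ### Conjugate actions have equivalent measures -/

section Transport

open scoped ENNReal

variable {V : Type u} {W : Type v} {G : SimpleGraph V} {H : SimpleGraph W}
  {Γ : Subgroup (G ≃g G)} {Γ' : Subgroup (H ≃g H)}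

/-- An equivariant isomorphism pulls eigenfunctions back to eigenfunctions. -/
theorem IsUniformLattice.IsEigenfunction.comp_mapDart {hU : IsUniformLattice Γ}
    {hU' : IsUniformLattice Γ'} {δ : ℝ} {h : H.Dart → ℝ} (hh : hU'.IsEigenfunction δ h)
    (α : Γ ≃* Γ') (F : G ≃g H)
    (hF : ∀ (γ : Γ) (a : V), F ((γ : G ≃g G) a) = (α γ : H ≃g H) (F a)) :
    hU.IsEigenfunction δ fun d => h (mapDart F d) where
  invariant γ hγ d := by
    have h1 : mapDart F (mapDart γ d) = mapDart (α ⟨γ, hγ⟩ : H ≃g H) (mapDart F d) :=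
      Dart.ext' (hF ⟨γ, hγ⟩ _) (hF ⟨γ, hγ⟩ _)
    simp only [h1]
    exact hh.invariant _ (α ⟨γ, hγ⟩).2 _
  pos d := hh.pos _
  eigen d := by
    rw [← hh.eigen]
    refine Finset.sum_bij (fun e _ => mapDart F e) (fun e he => ?_) (fun _ _ _ _ h1 =>
      mapDart_injective F h1) (fun e he => ?_) (fun _ _ => rfl)
    · exact mem_succs.2 ((mem_succs.1 he).map F)
    · refine ⟨mapDart F.symm e, mem_succs.2 ?_, mapDart_mapDart_symm F e⟩
      simpa using (mem_succs.1 he).map F.symm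

/-- Visual measures with proportional densities have the same null sets. -/
theorem IsVisual.null_iff (hT : IsLocallyFiniteLeaflessTree G) {δ c : ℝ} (hc : 0 < c)
    {h k : G.Dart → ℝ} (hk : ∀ d, k d = c * h d) {x y : V} {μ ν : Measure (Boundary G)}
    [IsFiniteMeasure μ] (hμ : IsVisual δ h x μ) (hν : IsVisual δ k y ν) [IsFiniteMeasure ν]
    {A : Set (Boundary G)} (hA : MeasurableSet A) : ν A = 0 ↔ μ A = 0 := by
  have hcount := countable_darts hT
  have hcover : A = ⋃ d : {d : G.Dart // x ∉ shadow d ∧ y ∉ shadow d}, A ∩ endShadow d.1 := by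
    rw [← Set.inter_iUnion]
    refine (Set.inter_eq_left.2 fun ξ _ => Set.mem_iUnion.2 ?_).symm
    obtain ⟨d, hξ, hd⟩ := exists_dart_away hT.isTree x y ξ
    exact ⟨⟨d, hd⟩, hξ⟩
  rw [hcover, measure_iUnion_null_iff, measure_iUnion_null_iff]
  refine forall_congr' fun ⟨d, hd1, hd2⟩ => ?_
  rw [hμ.measure_eq hT hc.le hk hν hd1 hd2 (hA.inter (measurableSet_endShadow d))
    Set.inter_subset_right, mul_eq_zero,
    or_iff_right (ENNReal.ofReal_pos.2 (mul_pos hc (Real.exp_pos _))).ne']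

/-- The null sets of the visual measures correspond under an equivariant isomorphism. -/
theorem null_image_iff {hU : IsUniformLattice Γ} {hU' : IsUniformLattice Γ'} {δ : ℝ}
    {h : G.Dart → ℝ} {h' : H.Dart → ℝ} (hh : hU.IsEigenfunction δ h)
    (hh' : hU'.IsEigenfunction δ h') {x : V} {y : W} {μ : Measure (Boundary G)}
    {μ' : Measure (Boundary H)} [IsFiniteMeasure μ] [IsFiniteMeasure μ'] (hμ : IsVisual δ h x μ)
    (hμ' : IsVisual δ h' y μ') (α : Γ ≃* Γ') (F : G ≃g H)
    (hF : ∀ (γ : Γ) (a : V), F ((γ : G ≃g G) a) = (α γ : H ≃g H) (F a))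
    {A : Set (Boundary G)} (hA : MeasurableSet A) :
    μ' (boundaryHomeo F '' A) = 0 ↔ μ A = 0 := by
  have hk : hU.IsEigenfunction δ fun d => h' (mapDart F d) := hh'.comp_mapDart α F hF
  obtain ⟨c, hc⟩ := hU.eq_mul_of_superharmonic (Real.exp_pos (-δ)) hh.invariant hk.invariant
    hh.pos hh.harmonic fun d => (hk.harmonic d).ge
  have hc0 : 0 < c := by
    obtain ⟨d⟩ := hU.exists_dart
    have h1 := hk.pos d
    rw [hc d] at h1
    exact pos_of_mul_pos_left h1 (hh.pos d).le
  have hmeas : Measurable (boundaryMapIso F.symm) := (boundaryHomeo F).symm.continuous.measurable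
  have := Measure.isFiniteMeasure_map μ' (boundaryMapIso F.symm)
  rw [← hμ.null_iff hU.tree hc0 hc (hμ'.map F) hA, Measure.map_apply hmeas hA,
    Homeomorph.image_eq_preimage_symm]
  rfl

end Transport

end TreeRigidity

theorem theorem1p7
    {V₁ : Type u} {V₂ : Type v} (T₁ : SimpleGraph V₁) (T₂ : SimpleGraph V₂)
    (hT₁ : TreeRigidity.IsLocallyFiniteLeaflessTree T₁)
    (hT₂ : TreeRigidity.IsLocallyFiniteLeaflessTree T₂)
    (Γ₁ : Subgroup (T₁ ≃g T₁)) (Γ₂ : Subgroup (T₂ ≃g T₂))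
    (hΓ₁ : TreeRigidity.IsTreeSchottky Γ₁) (hΓ₂ : TreeRigidity.IsTreeSchottky Γ₂)
    (g : ℕ) (hg : 2 ≤ g) (hg₁ : hΓ₁.genus = g) (hg₂ : hΓ₂.genus = g)
    (hΛ₁ : TreeRigidity.limitSet Γ₁ = Set.univ) (hΛ₂ : TreeRigidity.limitSet Γ₂ = Set.univ)
    -- base vertices `x₀`, `y₀` and vertices `x`, `y` whose orbits define the measures
    (x₀ x : V₁) (y₀ y : V₂) :
    ∃ (μ₁ : Measure (TreeRigidity.Boundary T₁)) (μ₂ : Measure (TreeRigidity.Boundary T₂)),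
      TreeRigidity.IsPattersonSullivan Γ₁ x₀ x μ₁ ∧
      TreeRigidity.IsPattersonSullivan Γ₂ y₀ y μ₂ ∧
      TreeRigidity.IsConformal Γ₁ x₀ (TreeRigidity.criticalExponent Γ₁ x₀ x) μ₁ ∧
      TreeRigidity.IsConformal Γ₂ y₀ (TreeRigidity.criticalExponent Γ₂ y₀ y) μ₂ ∧
      List.TFAE [
        -- the quotient graphs are isomorphic
        Nonempty (TreeRigidity.SerreGraph.Iso
          (TreeRigidity.quotientGraph Γ₁ hΓ₁.withoutInversion)
          (TreeRigidity.quotientGraph Γ₂ hΓ₂.withoutInversion)),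
        -- a bijective isometry conjugates the groups
        ∃ (α : Γ₁ ≃* Γ₂) (F : V₁ → V₂), Function.Bijective F ∧
          (∀ a b, T₂.dist (F a) (F b) = T₁.dist a b) ∧
          ∀ (γ : Γ₁) (a : V₁), F ((γ : T₁ ≃g T₁) a) = (α γ : T₂ ≃g T₂) (F a),
        -- an equivariant homeomorphism is absolutely continuous, and the dimensions are equal
        (∃ (α : Γ₁ ≃* Γ₂) (φ : TreeRigidity.Boundary T₁ ≃ₜ TreeRigidity.Boundary T₂),
          (∀ (γ : Γ₁) (ξ : TreeRigidity.Boundary T₁),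
            φ (TreeRigidity.boundaryMap (γ : T₁ ≃g T₁) ξ) =
              TreeRigidity.boundaryMap (α γ : T₂ ≃g T₂) (φ ξ)) ∧
          TreeRigidity.IsAbsolutelyContinuousMap φ μ₁ μ₂) ∧
          TreeRigidity.criticalExponent Γ₁ x₀ x = TreeRigidity.criticalExponent Γ₂ y₀ y,
        -- the same with absolute continuity in both directions
        (∃ (α : Γ₁ ≃* Γ₂) (φ : TreeRigidity.Boundary T₁ ≃ₜ TreeRigidity.Boundary T₂),
          (∀ (γ : Γ₁) (ξ : TreeRigidity.Boundary T₁),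
            φ (TreeRigidity.boundaryMap (γ : T₁ ≃g T₁) ξ) =
              TreeRigidity.boundaryMap (α γ : T₂ ≃g T₂) (φ ξ)) ∧
          TreeRigidity.IsAbsolutelyContinuousMap φ μ₁ μ₂ ∧
          TreeRigidity.IsAbsolutelyContinuousMap φ.symm μ₂ μ₁) ∧
          TreeRigidity.criticalExponent Γ₁ x₀ x = TreeRigidity.criticalExponent Γ₂ y₀ y
      ] := by
  have hU₁ := hΓ₁.isUniformLattice hT₁ hΛ₁ (hg₁ ▸ hg)
  have hU₂ := hΓ₂.isUniformLattice hT₂ hΛ₂ (hg₂ ▸ hg)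
  obtain ⟨h₁, μ₁, hh₁, hps₁, hconf₁, hv₁⟩ := hU₁.exists_measure x₀ x
  obtain ⟨h₂, μ₂, hh₂, hps₂, hconf₂, hv₂⟩ := hU₂.exists_measure y₀ y
  have hprob₁ := hps₁.1
  have hprob₂ := hps₂.1
  refine ⟨μ₁, μ₂, hps₁, hps₂, hconf₁, hconf₂, ?_⟩
  tfae_have 1 → 2 := by
    rintro ⟨ι⟩
    exact TreeRigidity.exists_conjugacy_of_iso hT₁ hT₂ hU₁.free hU₂.free ι
  tfae_have 2 → 1 := by
    rintro ⟨α, F, hF, hdist, hequiv⟩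
    exact TreeRigidity.nonempty_iso_of_conjugacy α (TreeRigidity.isoOfDist F hF hdist) hequiv
  tfae_have 2 → 4 := by
    rintro ⟨α, F, hF, hdist, hequiv⟩
    let F' : T₁ ≃g T₂ := TreeRigidity.isoOfDist F hF hdist
    have hexp : TreeRigidity.criticalExponent Γ₁ x₀ x = TreeRigidity.criticalExponent Γ₂ y₀ y :=
      (hh₂.comp_mapDart (hU := hU₁) α F' hequiv).criticalExponent_eq x₀ x
    rw [← hexp] at hh₂ hv₂
    have hnull : ∀ A, MeasurableSet A → (μ₂ (TreeRigidity.boundaryHomeo F' '' A) = 0 ↔ μ₁ A = 0) :=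
      fun A hA => TreeRigidity.null_image_iff hh₁ hh₂ hv₁ hv₂ α F' hequiv hA
    refine ⟨⟨α, TreeRigidity.boundaryHomeo F', fun γ ξ => ?_, fun A hA h0 => (hnull A hA).2 h0,
      fun A hA h0 => ?_⟩, hexp⟩
    · have h1 : (γ : T₁ ≃g T₁).trans F' = F'.trans (α γ : T₂ ≃g T₂) :=
        RelIso.ext fun a => hequiv γ a
      have h2 := TreeRigidity.boundaryMapIso_trans (γ : T₁ ≃g T₁) F' ξ
      rw [h1, TreeRigidity.boundaryMapIso_trans] at h2
      exact h2.symm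
    · have h1 : MeasurableSet ((TreeRigidity.boundaryHomeo F').symm '' A) :=
        TreeRigidity.measurableSet_image_homeo hA
      have h2 : (TreeRigidity.boundaryHomeo F').symm '' A = TreeRigidity.boundaryHomeo F' ⁻¹' A :=
        Homeomorph.image_eq_preimage_symm _ A
      rw [← hnull _ h1, h2, Set.image_preimage_eq _ (TreeRigidity.boundaryHomeo F').surjective]
      exact h0
  tfae_have 4 → 3 := by
    rintro ⟨⟨α, φ, hφ, hac, -⟩, hexp⟩
    exact ⟨⟨α, φ, hφ, hac⟩, hexp⟩
  tfae_have 3 → 2 := by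
    rintro ⟨⟨α, φ, hφ, hac⟩, hexp⟩
    rw [← hexp] at hh₂ hv₂
    have hpair₁ : TreeRigidity.IsVisualPair Γ₁ (TreeRigidity.criticalExponent Γ₁ x₀ x) x₀ μ₁ :=
      ⟨hU₁, inferInstance, h₁, hh₁.invariant, hh₁.pos, hv₁⟩
    have hpair₂ : TreeRigidity.IsVisualPair Γ₂ (TreeRigidity.criticalExponent Γ₁ x₀ x) y₀ μ₂ :=
      ⟨hU₂, inferInstance, h₂, hh₂.invariant, hh₂.pos, hv₂⟩
    have hequiv : TreeRigidity.IsEquivariant α φ := hφ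
    obtain ⟨F, hF⟩ := TreeRigidity.exists_iso_of_absolutelyContinuous hh₁.exponent_pos hpair₁
      hpair₂ hequiv hac
    exact ⟨α, F, F.bijective, TreeRigidity.iso_dist F, hequiv.apply_eq hU₁ hF⟩
  tfae_finish
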